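/- Suppose there is a subexponentially secure (quantum-secure) one-way function, i.e. a function $f:\{0,1\}^*\to\{0,1\}^*$ that is computable in classical deterministic polynomial time and for which there is a constant $0<c<1$ such that every uniform quantum adversary $\mathcal A$ which, on challenges $(1^\lambda,f(x))$ with $x\in\{0,1\}^\lambda$, runs in time at most $2^{\lambda^c}$ for all sufficiently large $\lambda$, satisfies $$\Pr\big[f(x')=f(x) : x\gets\{0,1\}^\lambda,\ x'\gets\mathcal A(1^\lambda,f(x))\big]\le 2^{-\lambda^{c}}$$ for all sufficiently large $\lambda$. Then for every constant $\epsilon>0$ there exists an $\epsilon$-one-way state generator with $O(\log\log\lambda)$-qubit pure-state outputs. That is, there are (uniform) quantum polynomial-time algorithms $\mathsf{KeyGen}(1^\lambda)\to k$, with classical output, $\mathsf{StateGen}(k)\to\phi_k$, with quantum output, and $\mathsf{Ver}(k',\phi)\to\top/\bot$, and a function $m(\lambda)=O(\log\log\lambda)$, such that 1. (correctness) $\Pr[\top\gets\mathsf{Ver}(k,\phi_k) : k\gets\mathsf{KeyGen}(1^\lambda)]\ge 1-\mathsf{negl}(\lambda)$ for a negligible function $\mathsf{negl}$; 2. ($\epsilon$-one-wayness)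 for every quantum polynomial-time adversary $\mathcal A$ and every polynomial $t$, for all sufficiently large $\lambda$, $$\Pr\big[\top\gets\mathsf{Ver}(k',\phi_k) : k\gets\mathsf{KeyGen}(1^\lambda),\ k'\gets\mathcal A(1^\lambda,\phi_k^{\otimes t(\lambda)})\big]\le\epsilon;$$ 3. for every $\lambda$ and every $k$ in the support of $\mathsf{KeyGen}(1^\lambda)$, $\phi_k$ is a pure state of $m(\lambda)$ qubits. -/

import Mathlib

open scoped Matrix

namespace QCrypto

/-! ## Classical machine with a step count

A deterministic machine with finitely many bit stacks ("registers") and structured control.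
Every elementary action touches only the top symbol of one stack and costs one step, so up to a
constant factor the cost is the running time of a multi-tape Turing machine.
A program is a finite object and mentions only finitely many registers. -/

/-- Programs of the multi-stack machine. -/
inductive Prog : Type
  | skip : Prog
  /-- push the bit `b` on register `r` -/
  | push (r : ℕ) (b : Bool) : Prog
  /-- remove the top bit of register `r`, if there is one -/
  | pop (r : ℕ) : Prog
  /-- run the first program, then the second one -/
  | seq (p q : Prog) : Prog
  /-- three-way branch on register `r`: empty, top bit `false`, top bit `true` -/
  | branch (r : ℕ) (pEmpty pFalse pTrue : Prog) : Prog
  /-- repeat the body as long as register `r` is not empty -/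
  | loop (r : ℕ) (body : Prog) : Prog

/-- Contents of all registers; the head of a list is the top of the stack. -/
abbrev Store : Type := ℕ → List Bool

/-- `Runs p s t s'`: started on `s`, the program `p` halts after exactly `t` steps with `s'`. -/
inductive Runs : Prog → Store → ℕ → Store → Prop
  | skip (s : Store) : Runs .skip s 1 s
  | push (r : ℕ) (b : Bool) (s : Store) :
      Runs (.push r b) s 1 (Function.update s r (b :: s r))
  | pop (r : ℕ) (s : Store) : Runs (.pop r) s 1 (Function.update s r (s r).tail)
  | seq {p q : Prog} {s s' s'' : Store} {t t' : ℕ} :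
      Runs p s t s' → Runs q s' t' s'' → Runs (.seq p q) s (t + t') s''
  | branchEmpty {r : ℕ} {pE pF pT : Prog} {s s' : Store} {t : ℕ} :
      s r = [] → Runs pE s t s' → Runs (.branch r pE pF pT) s (t + 1) s'
  | branchFalse {r : ℕ} {pE pF pT : Prog} {s s' : Store} {t : ℕ} :
      (s r).head? = some false → Runs pF s t s' → Runs (.branch r pE pF pT) s (t + 1) s'
  | branchTrue {r : ℕ} {pE pF pT : Prog} {s s' : Store} {t : ℕ} :
      (s r).head? = some true → Runs pT s t s' → Runs (.branch r pE pF pT) s (t + 1) s'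
  | loopDone {r : ℕ} {p : Prog} {s : Store} : s r = [] → Runs (.loop r p) s 1 s
  | loopStep {r : ℕ} {p : Prog} {s s' s'' : Store} {t t' : ℕ} :
      s r ≠ [] → Runs p s t s' → Runs (.loop r p) s' t' s'' →
      Runs (.loop r p) s (t + t' + 1) s''

/-- The machine is deterministic: final store and number of steps are determined. -/
theorem Runs.det {p : Prog} {s : Store} {t : ℕ} {s' : Store} (h : Runs p s t s') :
    ∀ {u : ℕ} {s'' : Store}, Runs p s u s'' → t = u ∧ s' = s'' := by
  induction h with
  | skip s => intro u s'' h; cases h; exact ⟨rfl, rfl⟩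
  | push r b s => intro u s'' h; cases h; exact ⟨rfl, rfl⟩
  | pop r s => intro u s'' h; cases h; exact ⟨rfl, rfl⟩
  | seq _ _ ih₁ ih₂ =>
    intro u s'' h
    cases h with
    | seq h₁ h₂ =>
      obtain ⟨rfl, rfl⟩ := ih₁ h₁
      obtain ⟨rfl, rfl⟩ := ih₂ h₂
      exact ⟨rfl, rfl⟩
  | branchEmpty h₀ _ ih =>
    intro u s'' h
    cases h with
    | branchEmpty _ h₁ => obtain ⟨rfl, rfl⟩ := ih h₁; exact ⟨rfl, rfl⟩
    | branchFalse h₁ _ => simp [h₀] at h₁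
    | branchTrue h₁ _ => simp [h₀] at h₁
  | branchFalse h₀ _ ih =>
    intro u s'' h
    cases h with
    | branchEmpty h₁ _ => simp [h₁] at h₀
    | branchFalse _ h₁ => obtain ⟨rfl, rfl⟩ := ih h₁; exact ⟨rfl, rfl⟩
    | branchTrue h₁ _ => simp [h₀] at h₁
  | branchTrue h₀ _ ih =>
    intro u s'' h
    cases h with
    | branchEmpty h₁ _ => simp [h₁] at h₀
    | branchFalse h₁ _ => simp [h₀] at h₁
    | branchTrue _ h₁ => obtain ⟨rfl, rfl⟩ := ih h₁; exact ⟨rfl, rfl⟩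
  | loopDone h₀ =>
    intro u s'' h
    cases h with
    | loopDone _ => exact ⟨rfl, rfl⟩
    | loopStep h₁ _ _ => exact absurd h₀ h₁
  | loopStep h₀ _ _ ih₁ ih₂ =>
    intro u s'' h
    cases h with
    | loopDone h₁ => exact absurd h₁ h₀
    | loopStep _ h₁ h₂ =>
      obtain ⟨rfl, rfl⟩ := ih₁ h₁
      obtain ⟨rfl, rfl⟩ := ih₂ h₂
      exact ⟨rfl, rfl⟩

/-- Initial store: the inputs in registers `0, 1, 2, …`, all other registers empty. -/
def initStore (xs : List (List Bool)) : Store := fun i => xs.getD i []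

/-- `p.HaltsIn xs t`: on the inputs `xs` the program `p` halts after exactly `t` steps. -/
def Prog.HaltsIn (p : Prog) (xs : List (List Bool)) (t : ℕ) : Prop :=
  ∃ s : Store, Runs p (initStore xs) t s

open Classical in
/-- Content of register `r` when `p` halts on the inputs `xs` (empty if it does not halt). -/
noncomputable def Prog.output (p : Prog) (xs : List (List Bool)) (r : ℕ) : List Bool :=
  if h : ∃ (t : ℕ) (s : Store), Runs p (initStore xs) t s then h.choose_spec.choose r else []

/-- `f` is computable in classical deterministic polynomial time
(input and output in register `0`). -/
def PolyTimeComputable (f : List Bool → List Bool) : Prop :=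
  ∃ (p : Prog) (P : Polynomial ℕ), ∀ x : List Bool,
    (∃ t : ℕ, t ≤ P.eval x.length ∧ p.HaltsIn [x] t) ∧ p.output [x] 0 = f x

/-! ## Quantum circuits over the gate set `{X, H, T, CNOT, Toffoli}` -/

/-- A gate with the wires it acts on (controls first, target last). -/
inductive Gate : Type
  | X (t : ℕ) : Gate
  | H (t : ℕ) : Gate
  | T (t : ℕ) : Gate
  | cnot (c t : ℕ) : Gate
  | ccnot (c₁ c₂ t : ℕ) : Gate

/-- One more than the largest wire used by the gate. -/
def Gate.width : Gate → ℕ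
  | .X t => t + 1
  | .H t => t + 1
  | .T t => t + 1
  | .cnot c t => max c t + 1
  | .ccnot c₁ c₂ t => max (max c₁ c₂) t + 1

/-- Number of wires a circuit needs: it uses wires `0, …, width - 1`. -/
def circuitWidth (C : List Gate) : ℕ := (C.map Gate.width).foldr max 0

/-- Read a bit string `1^{n₁} 0 1^{n₂} 0 …` as the list `n₁, n₂, …` of unary numbers;
the second argument counts the ones read since the last zero. -/
def readUnary : List Bool → ℕ → List ℕ
  | [], _ => []
  | true :: l, n => readUnary l (n + 1)
  | false :: l, n => n :: readUnary l 0

/-- Read a list of numbers in blocks of four (gate name and three wires) as a circuit;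
wires which the gate does not need are ignored, unknown gate names are skipped. -/
def readGates : List ℕ → List Gate
  | 0 :: a :: _ :: _ :: l => Gate.X a :: readGates l
  | 1 :: a :: _ :: _ :: l => Gate.H a :: readGates l
  | 2 :: a :: _ :: _ :: l => Gate.T a :: readGates l
  | 3 :: a :: b :: _ :: l => Gate.cnot a b :: readGates l
  | 4 :: a :: b :: c :: l => Gate.ccnot a b c :: readGates l
  | _ :: _ :: _ :: _ :: l => readGates l
  | _ => []

/-- The circuit described by a bit string. The first gate of the list is applied first. -/
def decodeCircuit (d : List Bool) : List Gate := readGates (readUnary d 0)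

/-- Computational basis states of `N` qubits. -/
abbrev Basis (N : ℕ) : Type := Fin N → Bool

/-- Operators on `N` qubits. -/
abbrev Op (N : ℕ) : Type := Matrix (Basis N) (Basis N) ℂ

noncomputable def pauliX : Matrix Bool Bool ℂ := Matrix.of fun a b => if a = b then 0 else 1

noncomputable def hadamard : Matrix Bool Bool ℂ :=
  Matrix.of fun a b => (if a && b then -1 else 1) / (Real.sqrt 2 : ℂ)

noncomputable def tGate : Matrix Bool Bool ℂ :=
  Matrix.of fun a b =>
    if a = b then (if a then Complex.exp (Real.pi / 4 * Complex.I) else 1) else 0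

/-- The one-qubit operator `u` on wire `t`, controlled by the wires in `cs`. The identity if a
wire does not exist or the target is one of the controls. -/
noncomputable def controlled (N : ℕ) (cs : List ℕ) (t : ℕ) (u : Matrix Bool Bool ℂ) : Op N :=
  if h : t < N ∧ t ∉ cs ∧ ∀ c ∈ cs, c < N then
    Matrix.of fun s' s =>
      if ∀ j : Fin N, j.val ≠ t → s' j = s j then
        (if ∀ j : Fin N, j.val ∈ cs → s j = true then u else 1) (s' ⟨t, h.1⟩) (s ⟨t, h.1⟩)
      else 0
  else 1

/-- The unitary operator of a gate on `N` wires. -/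
noncomputable def Gate.op (N : ℕ) : Gate → Op N
  | .X t => controlled N [] t pauliX
  | .H t => controlled N [] t hadamard
  | .T t => controlled N [] t tGate
  | .cnot c t => controlled N [c] t pauliX
  | .ccnot c₁ c₂ t => controlled N [c₁, c₂] t pauliX

/-- The unitary operator of a circuit on `N` wires. -/
noncomputable def circuitOp (N : ℕ) : List Gate → Op N
  | [] => 1
  | g :: C => circuitOp N C * g.op N

/-- `|0…0⟩⟨0…0|` on `N` qubits. -/
noncomputable def zeroState (N : ℕ) : Op N :=
  Matrix.of fun s s' => if ∀ j : Fin N, s j = false ∧ s' j = false then 1 else 0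

/-- `ρ ⊗ |0…0⟩⟨0…0|` with `a` ancilla qubits in the last positions. -/
noncomputable def withAncillas {q : ℕ} (ρ : Op q) (a : ℕ) : Op (q + a) :=
  Matrix.of fun s s' =>
    if ∀ j : Fin a, s (Fin.natAdd q j) = false ∧ s' (Fin.natAdd q j) = false then
      ρ (fun i => s (Fin.castAdd a i)) (fun i => s' (Fin.castAdd a i))
    else 0

/-- Partial trace over the last `a` qubits. -/
noncomputable def traceOutLast {m a : ℕ} (σ : Op (m + a)) : Op m :=
  Matrix.of fun s s' => ∑ e : Basis a, σ (Fin.append s e) (Fin.append s' e)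

/-- `ρ ^ {⊗ t}`. -/
noncomputable def tensorPow {m : ℕ} (ρ : Op m) (t : ℕ) : Op (t * m) :=
  Matrix.of fun s s' =>
    ∏ i : Fin t, ρ (fun j => s (finProdFinEquiv (i, j))) (fun j => s' (finProdFinEquiv (i, j)))

/-- The state of zero qubits, used for algorithms without quantum input. -/
noncomputable def noQubits : Op 0 := 1

/-- The state obtained by running `C` on `ρ` and as many ancillas in state `|0⟩` as `C` needs. -/
noncomputable def runCircuit (C : List Gate) {q : ℕ} (ρ : Op q) :
    Op (q + (circuitWidth C - q)) :=
  circuitOp _ C * withAncillas ρ _ * (circuitOp _ C)ᴴ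

/-! ## Uniform quantum algorithms -/

/-- `1^n`. -/
def unary (n : ℕ) : List Bool := List.replicate n true

/-- A uniform quantum algorithm with classical output. On classical inputs `xs` and `q` input
qubits, the program `gen` computes from `xs` and `1^q` the description of a circuit, the circuit
is run on the input qubits and ancillas, all wires are measured in the computational basis, and
the program `post` computes the output from `xs`, `1^q` and the measurement outcome. -/
structure QAlg : Type where
  gen : Prog
  post : Prog

namespace QAlg

/-- The circuit which is run on classical inputs `xs` and `q` input qubits. -/
noncomputable def circuit (A : QAlg) (xs : List (List Bool)) (q : ℕ) : List Gate :=
  decodeCircuit (A.gen.output (xs ++ [unary q]) 0)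

/-- Number of wires of this circuit. -/
noncomputable def wires (A : QAlg) (xs : List (List Bool)) (q : ℕ) : ℕ :=
  q + (circuitWidth (A.circuit xs q) - q)

/-- On `xs` and `q` input qubits, for every measurement outcome, the algorithm halts within `T`
steps. (The number of gates is at most the length of the description written by `gen`.) -/
def HaltsWithin (A : QAlg) (xs : List (List Bool)) (q T : ℕ) : Prop :=
  ∃ t₁ : ℕ, A.gen.HaltsIn (xs ++ [unary q]) t₁ ∧
    ∀ z : Basis (A.wires xs q),
      ∃ t₂ : ℕ, A.post.HaltsIn (xs ++ [unary q, List.ofFn z]) t₂ ∧ t₁ + t₂ ≤ T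

/-- Expectation of `g` of the output of the algorithm on classical inputs `xs` and the quantum
input `ρ`. -/
noncomputable def expect (A : QAlg) (xs : List (List Bool)) {q : ℕ} (ρ : Op q)
    (g : List Bool → ℝ) : ℝ :=
  ∑ z : Basis (q + (circuitWidth (A.circuit xs q) - q)),
    (runCircuit (A.circuit xs q) ρ z z).re *
      g (A.post.output (xs ++ [unary q, List.ofFn z]) 0)

open Classical in
/-- Probability that the output is `y`. -/
noncomputable def probOut (A : QAlg) (xs : List (List Bool)) {q : ℕ} (ρ : Op q)
    (y : List Bool) : ℝ :=
  A.expect xs ρ fun z => if z = y then 1 else 0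

/-- Quantum polynomial time, for algorithms with `arity` classical inputs: the running time is
polynomial in the total length of the classical inputs and the number of input qubits. -/
def IsQPT (A : QAlg) (arity : ℕ) : Prop :=
  ∃ P : Polynomial ℕ, ∀ xs : List (List Bool), xs.length = arity → ∀ q : ℕ,
    A.HaltsWithin xs q (P.eval ((xs.map List.length).sum + q))

end QAlg

/-- A uniform quantum algorithm with one classical input and quantum output: the program `gen`
leaves the description of a circuit in register `0` and, in unary, the number of output qubits in
register `1`; the circuit is run on `|0…0⟩` and all but the first wires are traced out. -/
structure QStateAlg : Type where
  gen : Prog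

namespace QStateAlg

/-- Number of output qubits on input `k`. -/
noncomputable def numQubits (G : QStateAlg) (k : List Bool) : ℕ := (G.gen.output [k] 1).length

/-- The circuit which is run on input `k`. -/
noncomputable def circuit (G : QStateAlg) (k : List Bool) : List Gate :=
  decodeCircuit (G.gen.output [k] 0)

/-- The output state on input `k`, as a density operator. -/
noncomputable def state (G : QStateAlg) (k : List Bool) : Op (G.numQubits k) :=
  traceOutLast (a := circuitWidth (G.circuit k) - G.numQubits k)
    (circuitOp _ (G.circuit k) * zeroState _ * (circuitOp _ (G.circuit k))ᴴ)

/-- Quantum polynomial time. -/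
def IsQPT (G : QStateAlg) : Prop :=
  ∃ P : Polynomial ℕ, ∀ k : List Bool, ∃ t : ℕ, t ≤ P.eval k.length ∧ G.gen.HaltsIn [k] t

end QStateAlg

/-! ## One-way functions and one-way state generators -/

open Classical in
/-- `Pr[f(x') = f(x) : x ← {0,1}^n, x' ← A(1^n, f(x))]`. -/
noncomputable def invertProb (f : List Bool → List Bool) (A : QAlg) (n : ℕ) : ℝ :=
  (∑ x : Basis n, A.expect [unary n, f (List.ofFn x)] noQubits
    fun x' => if f x' = f (List.ofFn x) then 1 else 0) / 2 ^ n

/-- On challenges for security parameter `n`, the adversary runs for at most `2^{n^c}` steps, for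
all sufficiently large `n`. -/
def RunsInSubexpTime (f : List Bool → List Bool) (A : QAlg) (c : ℝ) : Prop :=
  ∀ᶠ n : ℕ in Filter.atTop, ∀ x : Basis n, ∃ T : ℕ,
    (T : ℝ) ≤ (2 : ℝ) ^ ((n : ℝ) ^ c) ∧ A.HaltsWithin [unary n, f (List.ofFn x)] 0 T

/-- Subexponentially secure one-way functions: for some constant `0 < c < 1`, every uniform
quantum adversary with running time at most `2^{n^c}` succeeds with probability at most
`2^{-n^c}`, for all sufficiently large `n`. -/
def IsSubexpSecureOWF (f : List Bool → List Bool) : Prop :=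
  PolyTimeComputable f ∧
  ∃ c : ℝ, 0 < c ∧ c < 1 ∧ ∀ A : QAlg, RunsInSubexpTime f A c →
    ∀ᶠ n : ℕ in Filter.atTop, invertProb f A n ≤ (2 : ℝ) ^ (-(n : ℝ) ^ c)

/-- The algorithms `(KeyGen, StateGen, Ver)` of a one-way state generator. `Ver` accepts a key
and a state if it outputs the one-bit string `1`. -/
structure StateGenScheme : Type where
  keyGen : QAlg
  stateGen : QStateAlg
  ver : QAlg

namespace StateGenScheme

/-- `φ_k`. -/
noncomputable def state (S : StateGenScheme) (k : List Bool) : Op (S.stateGen.numQubits k) :=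
  S.stateGen.state k

/-- `Pr[⊤ ← Ver(k', φ_k)]`. -/
noncomputable def acceptProb (S : StateGenScheme) (k' k : List Bool) : ℝ :=
  S.ver.probOut [k'] (S.state k) [true]

/-- `Pr[⊤ ← Ver(k, φ_k) : k ← KeyGen(1^n)]`. -/
noncomputable def correctProb (S : StateGenScheme) (n : ℕ) : ℝ :=
  S.keyGen.expect [unary n] noQubits fun k => S.acceptProb k k

/-- `Pr[⊤ ← Ver(k', φ_k) : k ← KeyGen(1^n), k' ← A(1^n, φ_k^{⊗ t})]`. -/
noncomputable def winProb (S : StateGenScheme) (A : QAlg) (t n : ℕ) : ℝ :=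
  S.keyGen.expect [unary n] noQubits fun k =>
    A.expect [unary n] (tensorPow (S.state k) t) fun k' => S.acceptProb k' k

/-- `k` is in the support of `KeyGen(1^n)`. -/
def InSupport (S : StateGenScheme) (n : ℕ) (k : List Bool) : Prop :=
  0 < S.keyGen.probOut [unary n] noQubits k

/-- `S` is an `ε`-one-way state generator. -/
def IsOWSG (S : StateGenScheme) (ε : ℕ → ℝ) : Prop :=
  (S.keyGen.IsQPT 1 ∧ S.stateGen.IsQPT ∧ S.ver.IsQPT 1) ∧
  (∃ μ : ℕ → ℝ, Asymptotics.SuperpolynomialDecay Filter.atTop (fun n : ℕ => (n : ℝ)) μ ∧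
    ∀ n : ℕ, 1 - μ n ≤ S.correctProb n) ∧
  (∀ A : QAlg, A.IsQPT 1 → ∀ t : Polynomial ℕ,
    ∀ᶠ n : ℕ in Filter.atTop, S.winProb A (t.eval n) n ≤ ε n)

/-- `S` has `m(n)`-qubit outputs. -/
def HasOutputLength (S : StateGenScheme) (m : ℕ → ℕ) : Prop :=
  ∀ (n : ℕ) (k : List Bool), S.InSupport n k → S.stateGen.numQubits k = m n

/-- `S` has pure output states: `φ_k = |ψ⟩⟨ψ|` for a unit vector `ψ`. -/
def HasPureOutputs (S : StateGenScheme) : Prop :=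
  ∀ (n : ℕ) (k : List Bool), S.InSupport n k →
    ∃ ψ : Basis (S.stateGen.numQubits k) → ℂ,
      ∑ b, ‖ψ b‖ ^ 2 = 1 ∧ S.state k = Matrix.vecMulVec ψ (star ψ)

end StateGenScheme

end QCrypto

/-! A key for security parameter `n` is a uniformly random string `k` of polylogarithmic length `m =
(size n)^K`, where `size n` is the bit length of `n`. Its state is a quantum fingerprint of `f k`:
the uniform superposition of the pairs of an index `i < 2^l` and the `i`-th symbol of a Reed–Solomon
encoding of `f k`, that is, the value at `i`, modulo a prime between `2^l` and `2^(l+1)`, of the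
monic polynomial whose lower coefficients are the bits of `f k`. It suffices that `2^l` is
polynomial in `m`, so there are `O(l) = O(log m) = O(log log n)` qubits.

To check `k'`, the verifier undoes the preparation of the fingerprint of `f k'` and accepts the
all-zero outcome. The acceptance probability is the squared overlap of two fingerprints, which is
the square of the fraction of indices where the two codewords agree (`overlap_prep`,
`acceptProb_eq`). Hence the right key is always accepted. Two different monic polynomials of degree
at most `L` agree in at most `L` points (`rs_agreement`), so a key with `f k' ≠ f k` is accepted
with probability at most a constant `δ ≤ ε / 2`, once `2^l` exceeds the length of the values of `f`
by a large constant factor (`acceptProb_le`).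

Apart from this `δ`, winning the game means inverting `f`. The fingerprint depends only on `f k` and
the length of `k`, so an inverter which is given `f k` can prepare all copies that an adversary
wants. The adversary is polynomial in `n < 2^(size n) = 2^(m^(1/K))`, and `K ≥ 2 / c` makes this
time at most `2^(m^c)` for large `m` (`eventually_polynomial_le`). One obstacle remains: many `n`
share the same key length `m`, and a uniform inverter which sees only `1^m` does not know which `n`
is meant. It therefore runs the adversary for every `n < 2^(m^(1/K))`, on disjoint blocks of wires,
and returns a candidate that `f` maps to the challenge. It succeeds at least as often as the
adversary does for any single `n` (`meas_layout`, `Attack.expect_le`, `winProb_le`).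

The machine model is explicit, so running times have to be proved. The predicate `FP` has enough
closure properties for most of these proofs to become calls of `fun_prop`. Circuits are analysed on
amplitude functions over infinitely many wires (`Amp`), so that circuits of different widths act on
the same object. -/

namespace QCrypto

/-! ## Running time up to a bound, renaming of registers -/

/-- `p` takes the store `s` to `s'` within `T` steps. -/
def Does (p : Prog) (s s' : Store) (T : ℕ) : Prop := ∃ t ≤ T, Runs p s t s'

theorem Does.mono {p : Prog} {s s' : Store} {T T' : ℕ} (h : Does p s s' T) (hT : T ≤ T') :
    Does p s s' T' := by
  obtain ⟨t, ht, h⟩ := h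
  exact ⟨t, ht.trans hT, h⟩

theorem Does.congr {p : Prog} {s s₁ s' : Store} {T T' : ℕ} (h : Does p s s₁ T) (hs : s₁ = s')
    (hT : T ≤ T') : Does p s s' T' := hs ▸ h.mono hT

theorem Does.seq {p q : Prog} {s s' s'' : Store} {T T' : ℕ} (h : Does p s s' T)
    (h' : Does q s' s'' T') : Does (.seq p q) s s'' (T + T') := by
  obtain ⟨t, ht, h⟩ := h
  obtain ⟨t', ht', h'⟩ := h'
  exact ⟨t + t', add_le_add ht ht', .seq h h'⟩

theorem Does.skip (s : Store) : Does .skip s s 1 := ⟨1, le_rfl, .skip s⟩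

theorem Does.push (r : ℕ) (b : Bool) (s : Store) :
    Does (.push r b) s (Function.update s r (b :: s r)) 1 := ⟨1, le_rfl, .push r b s⟩

theorem Does.pop (r : ℕ) (s : Store) :
    Does (.pop r) s (Function.update s r (s r).tail) 1 := ⟨1, le_rfl, .pop r s⟩

theorem Does.loopDone {r : ℕ} (p : Prog) {s : Store} (h : s r = []) : Does (.loop r p) s s 1 :=
  ⟨1, le_rfl, .loopDone h⟩

theorem Does.loopStep {r : ℕ} {p : Prog} {s s' s'' : Store} {T T' : ℕ} (h : s r ≠ [])
    (h₁ : Does p s s' T) (h₂ : Does (.loop r p) s' s'' T') :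
    Does (.loop r p) s s'' (T + T' + 1) := by
  obtain ⟨t, ht, h₁⟩ := h₁
  obtain ⟨t', ht', h₂⟩ := h₂
  exact ⟨t + t' + 1, by omega, .loopStep h h₁ h₂⟩

theorem Does.branchFalse {r : ℕ} {pE pF pT : Prog} {s s' : Store} {T : ℕ} {l : List Bool}
    (h : s r = false :: l) (h₁ : Does pF s s' T) : Does (.branch r pE pF pT) s s' (T + 1) := by
  obtain ⟨t, ht, h₁⟩ := h₁
  exact ⟨t + 1, by omega, .branchFalse (by simp [h]) h₁⟩

theorem Does.branchTrue {r : ℕ} {pE pF pT : Prog} {s s' : Store} {T : ℕ} {l : List Bool}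
    (h : s r = true :: l) (h₁ : Does pT s s' T) : Does (.branch r pE pF pT) s s' (T + 1) := by
  obtain ⟨t, ht, h₁⟩ := h₁
  exact ⟨t + 1, by omega, .branchTrue (by simp [h]) h₁⟩

/-- Rename the registers of a program. -/
def Prog.rename (σ : ℕ → ℕ) : Prog → Prog
  | .skip => .skip
  | .push r b => .push (σ r) b
  | .pop r => .pop (σ r)
  | .seq p q => .seq (p.rename σ) (q.rename σ)
  | .branch r pE pF pT => .branch (σ r) (pE.rename σ) (pF.rename σ) (pT.rename σ)
  | .loop r p => .loop (σ r) (p.rename σ)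

/-- A program sees only the registers it names, so an injective renaming reproduces each run step by
step. The last clause is the frame condition which makes programs composable. -/
theorem Runs.rename {σ : ℕ → ℕ} (hσ : Function.Injective σ) {p : Prog} {s : Store} {t : ℕ}
    {s' : Store} (h : Runs p s t s') : ∀ S : Store, (∀ i, S (σ i) = s i) →
      ∃ S' : Store, Runs (p.rename σ) S t S' ∧ (∀ i, S' (σ i) = s' i) ∧
        ∀ j, (∀ i, σ i ≠ j) → S' j = S j := by
  induction h with
  | skip s => exact fun S hS => ⟨S, .skip S, hS, fun _ _ => rfl⟩
  | push r b s =>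
    refine fun S hS => ⟨_, .push _ b S, fun i => ?_, fun j hj => ?_⟩
    · by_cases hi : i = r
      · subst hi; simp [hS]
      · rw [Function.update_of_ne (hσ.ne hi), Function.update_of_ne hi, hS]
    · rw [Function.update_of_ne (hj r).symm]
  | pop r s =>
    refine fun S hS => ⟨_, .pop _ S, fun i => ?_, fun j hj => ?_⟩
    · by_cases hi : i = r
      · subst hi; simp [hS]
      · rw [Function.update_of_ne (hσ.ne hi), Function.update_of_ne hi, hS]
    · rw [Function.update_of_ne (hj r).symm]
  | seq _ _ ih₁ ih₂ =>
    intro S hS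
    obtain ⟨S', h₁, h₂, h₃⟩ := ih₁ S hS
    obtain ⟨S'', h₄, h₅, h₆⟩ := ih₂ S' h₂
    exact ⟨S'', .seq h₁ h₄, h₅, fun j hj => (h₆ j hj).trans (h₃ j hj)⟩
  | branchEmpty h₀ _ ih =>
    intro S hS
    obtain ⟨S', h₁, h₂⟩ := ih S hS
    exact ⟨S', .branchEmpty (by rw [hS, h₀]) h₁, h₂⟩
  | branchFalse h₀ _ ih =>
    intro S hS
    obtain ⟨S', h₁, h₂⟩ := ih S hS
    exact ⟨S', .branchFalse (by rw [hS, h₀]) h₁, h₂⟩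
  | branchTrue h₀ _ ih =>
    intro S hS
    obtain ⟨S', h₁, h₂⟩ := ih S hS
    exact ⟨S', .branchTrue (by rw [hS, h₀]) h₁, h₂⟩
  | loopDone h₀ => exact fun S hS => ⟨S, .loopDone (by rw [hS, h₀]), hS, fun _ _ => rfl⟩
  | loopStep h₀ _ _ ih₁ ih₂ =>
    intro S hS
    obtain ⟨S', h₁, h₂, h₃⟩ := ih₁ S hS
    obtain ⟨S'', h₄, h₅, h₆⟩ := ih₂ S' h₂
    exact ⟨S'', .loopStep (by rw [hS]; exact h₀) h₁ h₄, h₅,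
      fun j hj => (h₆ j hj).trans (h₃ j hj)⟩

/-- One more than the largest register used by the program. -/
def Prog.bound : Prog → ℕ
  | .skip => 0
  | .push r _ => r + 1
  | .pop r => r + 1
  | .seq p q => max p.bound q.bound
  | .branch r pE pF pT => max (r + 1) (max pE.bound (max pF.bound pT.bound))
  | .loop r p => max (r + 1) p.bound

/-- Confines the garbage left by an arbitrary program to finitely many registers, so that a fixed
program can delete it. -/
theorem Runs.eq_of_bound_le {p : Prog} {s : Store} {t : ℕ} {s' : Store} (h : Runs p s t s') :
    ∀ i, p.bound ≤ i → s' i = s i := by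
  induction h with
  | skip s => exact fun _ _ => rfl
  | push r b s =>
    intro i hi
    simp only [Prog.bound] at hi
    rw [Function.update_of_ne (by omega)]
  | pop r s =>
    intro i hi
    simp only [Prog.bound] at hi
    rw [Function.update_of_ne (by omega)]
  | seq _ _ ih₁ ih₂ =>
    intro i hi
    simp only [Prog.bound] at hi
    rw [ih₂ i (by omega), ih₁ i (by omega)]
  | branchEmpty _ _ ih => intro i hi; simp only [Prog.bound] at hi; exact ih i (by omega)
  | branchFalse _ _ ih => intro i hi; simp only [Prog.bound] at hi; exact ih i (by omega)
  | branchTrue _ _ ih => intro i hi; simp only [Prog.bound] at hi; exact ih i (by omega)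
  | loopDone _ => exact fun _ _ => rfl
  | loopStep _ _ _ ih₁ ih₂ =>
    intro i hi
    rw [ih₂ i hi]
    simp only [Prog.bound] at hi
    exact ih₁ i (by omega)

/-- One step pushes at most one symbol. Running time therefore bounds output size as well as the
cost of cleaning up. -/
theorem Runs.length_le {p : Prog} {s : Store} {t : ℕ} {s' : Store} (h : Runs p s t s') :
    ∀ i, (s' i).length ≤ (s i).length + t := by
  induction h with
  | skip s => intro i; omega
  | push r b s =>
    intro i
    by_cases hi : i = r
    · subst hi; simp
    · rw [Function.update_of_ne hi]; omega
  | pop r s =>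
    intro i
    by_cases hi : i = r
    · subst hi; simp; omega
    · rw [Function.update_of_ne hi]; omega
  | seq _ _ ih₁ ih₂ => intro i; have := ih₁ i; have := ih₂ i; omega
  | branchEmpty _ _ ih => intro i; have := ih i; omega
  | branchFalse _ _ ih => intro i; have := ih i; omega
  | branchTrue _ _ ih => intro i; have := ih i; omega
  | loopDone _ => intro i; omega
  | loopStep _ _ _ ih₁ ih₂ => intro i; have := ih₁ i; have := ih₂ i; omega

/-- Determinism makes the choice in `Prog.output` harmless. -/
theorem Prog.output_eq {p : Prog} {xs : List (List Bool)} {t : ℕ} {s : Store}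
    (h : Runs p (initStore xs) t s) (r : ℕ) : p.output xs r = s r := by
  have h' : ∃ (t : ℕ) (s : Store), Runs p (initStore xs) t s := ⟨t, s, h⟩
  unfold Prog.output
  rw [dif_pos h', (h'.choose_spec.choose_spec.det h).2]

/-! ## Stores given by a list of registers -/

theorem initStore_append (A B : List (List Bool)) (i : ℕ) :
    initStore (A ++ B) i = if i < A.length then initStore A i else initStore B (i - A.length) := by
  unfold initStore
  split_ifs with h
  · rw [List.getD_append _ _ _ _ h]
  · rw [List.getD_append_right _ _ _ _ (by omega)]

theorem initStore_of_le {A : List (List Bool)} {i : ℕ} (h : A.length ≤ i) :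
    initStore A i = [] := by
  unfold initStore
  rw [List.getD_eq_default _ _ h]

theorem initStore_append_right (A B : List (List Bool)) (i : ℕ) :
    initStore (A ++ B) (A.length + i) = initStore B i := by
  rw [initStore_append, if_neg (by omega), Nat.add_sub_cancel_left]

@[simp] theorem initStore_cons_zero (a : List Bool) (A : List (List Bool)) :
    initStore (a :: A) 0 = a := rfl

@[simp] theorem initStore_cons_succ (a : List Bool) (A : List (List Bool)) (i : ℕ) :
    initStore (a :: A) (i + 1) = initStore A i := by simp [initStore]

@[simp] theorem initStore_nil (i : ℕ) : initStore [] i = [] := rfl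

theorem initStore_concat_nil (A : List (List Bool)) : initStore (A ++ [[]]) = initStore A := by
  funext i
  rw [initStore_append]
  split_ifs with h
  · rfl
  · rw [initStore_of_le (by omega : A.length ≤ i)]
    cases i - A.length <;> simp

theorem update_initStore (A B : List (List Bool)) (a b : List Bool) {r : ℕ} (hr : r = A.length) :
    Function.update (initStore (A ++ a :: B)) r b = initStore (A ++ b :: B) := by
  subst hr
  funext i
  by_cases hi : i = A.length
  · subst hi
    rw [Function.update_self]
    simpa using (initStore_append_right A (b :: B) 0).symm
  · rw [Function.update_of_ne hi, initStore_append, initStore_append]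
    split_ifs with h
    · rfl
    · obtain ⟨j, hj⟩ : ∃ j, i - A.length = j + 1 := ⟨i - A.length - 1, by omega⟩
      rw [hj]; simp

theorem update_initStore_length (A : List (List Bool)) (b : List Bool) :
    Function.update (initStore A) A.length b = initStore (A ++ [b]) := by
  rw [← initStore_concat_nil, update_initStore A [] [] b rfl]

theorem initStore_apply_length (A B : List (List Bool)) (a : List Bool) {r : ℕ}
    (hr : r = A.length) : initStore (A ++ a :: B) r = a := by
  subst hr
  simpa using initStore_append_right A (a :: B) 0

/-- Shift the registers from `a` on by `m`. -/
def insertShift (a m i : ℕ) : ℕ := if i < a then i else i + m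

theorem insertShift_injective (a m : ℕ) : Function.Injective (insertShift a m) := by
  intro i j h
  unfold insertShift at h
  split_ifs at h <;> omega

/-- The frame rule: renaming lets a program jump over a block `M` inserted between the registers `A`
and its workspace. -/
theorem Does.insert {p : Prog} {A X Y : List (List Bool)} {T : ℕ} (M : List (List Bool))
    (h : Does p (initStore (A ++ X)) (initStore (A ++ Y)) T) :
    Does (p.rename (insertShift A.length M.length)) (initStore (A ++ M ++ X))
      (initStore (A ++ M ++ Y)) T := by
  obtain ⟨t, ht, h⟩ := h
  have key : ∀ (Z : List (List Bool)) i, initStore (A ++ M ++ Z) (insertShift A.length M.length i)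
      = initStore (A ++ Z) i := by
    intro Z i
    unfold insertShift
    split_ifs with hi
    · rw [List.append_assoc, initStore_append, if_pos hi, initStore_append, if_pos hi]
    · obtain ⟨j, rfl⟩ : ∃ j, i = A.length + j := ⟨i - A.length, by omega⟩
      rw [initStore_append_right, show A.length + j + M.length = (A ++ M).length + j by
        simp; omega, initStore_append_right]
  obtain ⟨S', h₁, h₂, h₃⟩ := h.rename (insertShift_injective A.length M.length)
    (initStore (A ++ M ++ X)) (key X)
  refine ⟨t, ht, ?_⟩
  convert h₁ using 1
  funext j
  by_cases hj : ∃ i, insertShift A.length M.length i = j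
  · obtain ⟨i, rfl⟩ := hj
    rw [h₂, key]
  · push Not at hj
    rw [h₃ j hj]
    have hl : A.length ≤ j := by
      by_contra hlt
      exact hj j (by unfold insertShift; rw [if_pos (by omega)])
    have hr : j < A.length + M.length := by
      by_contra hlt
      exact hj (j - M.length) (by unfold insertShift; rw [if_neg (by omega)]; omega)
    rw [initStore_append, initStore_append (A ++ M), if_pos (by simpa using hr),
      if_pos (by simpa using hr)]

theorem Does.after {p : Prog} {X Y : List (List Bool)} {T : ℕ} (M : List (List Bool))
    (h : Does p (initStore X) (initStore Y) T) :
    Does (p.rename (insertShift 0 M.length)) (initStore (M ++ X)) (initStore (M ++ Y)) T :=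
  Does.insert (A := []) M h

/-! ## Moving and copying registers -/

/-- Empty a register. -/
def clearProg (r : ℕ) : Prog := .loop r (.pop r)

theorem does_clear (r : ℕ) (s : Store) :
    Does (clearProg r) s (Function.update s r []) (2 * (s r).length + 1) := by
  obtain ⟨l, hl⟩ : ∃ l, s r = l := ⟨_, rfl⟩
  induction l generalizing s with
  | nil =>
    rw [← hl, Function.update_eq_self]
    exact (Does.loopDone _ hl).mono (by omega)
  | cons b l ih =>
    have h := ih (Function.update s r (s r).tail) (by simp [hl])
    rw [Function.update_idem] at h
    refine (Does.loopStep (by simp [hl]) (.pop r s) h).mono ?_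
    simp [hl]; omega

/-- Move the content of register `r` in reverse order on top of the registers `d` and `e`. -/
def pourTwo (r d e : ℕ) : Prog :=
  .loop r (.branch r .skip
    (.seq (.pop r) (.seq (.push d false) (.push e false)))
    (.seq (.pop r) (.seq (.push d true) (.push e true))))

/-- Move the content of register `r` in reverse order on top of register `d`. -/
def pour (r d : ℕ) : Prog :=
  .loop r (.branch r .skip (.seq (.pop r) (.push d false)) (.seq (.pop r) (.push d true)))

theorem does_pour {r d : ℕ} (hd : r ≠ d) (s : Store) :
    Does (pour r d) s (Function.update (Function.update s r []) d ((s r).reverse ++ s d))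
      (4 * (s r).length + 1) := by
  obtain ⟨l, hl⟩ : ∃ l, s r = l := ⟨_, rfl⟩
  induction l generalizing s with
  | nil =>
    rw [hl, ← hl, Function.update_eq_self]
    simp only [hl, List.reverse_nil, List.nil_append, Function.update_eq_self]
    exact (Does.loopDone _ hl).mono (by omega)
  | cons b l ih =>
    have hs : Does (.branch r .skip (.seq (.pop r) (.push d false)) (.seq (.pop r) (.push d true)))
        s (Function.update (Function.update s r l) d (b :: s d)) 3 := by
      have h := fun b' => (Does.pop r s).seq (.push d b' _)
      simp only [hl, List.tail_cons, Function.update_of_ne hd.symm] at h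
      cases b
      · exact .branchFalse hl (h false)
      · exact .branchTrue hl (h true)
    have h := ih _ (by
      rw [Function.update_of_ne hd, Function.update_self] :
        Function.update (Function.update s r l) d (b :: s d) r = l)
    refine (Does.loopStep (by simp [hl]) hs h).congr ?_ ?_
    · funext i
      by_cases h₁ : i = d
      · subst h₁; simp [hl, hd]
      · by_cases h₂ : i = r
        · subst h₂; simp [hd]
        · simp [h₁, h₂]
    · simp [hl, Function.update_of_ne hd]; omega

theorem does_pourTwo {r d e : ℕ} (hd : r ≠ d) (he : r ≠ e) (hde : d ≠ e) (s : Store) :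
    Does (pourTwo r d e) s
      (Function.update (Function.update (Function.update s r []) d ((s r).reverse ++ s d)) e
        ((s r).reverse ++ s e)) (5 * (s r).length + 1) := by
  obtain ⟨l, hl⟩ : ∃ l, s r = l := ⟨_, rfl⟩
  induction l generalizing s with
  | nil =>
    have : Function.update (Function.update (Function.update s r []) d ((s r).reverse ++ s d)) e
        ((s r).reverse ++ s e) = s := by
      funext i
      by_cases h₁ : i = d
      · subst h₁; simp [hl, hde]
      · by_cases h₂ : i = r
        · subst h₂; simp [hd, he, hl]
        · by_cases h₃ : i = e
          · subst h₃; simp [hl]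
          · simp [h₁, h₂, h₃]
    rw [this]
    exact (Does.loopDone _ hl).mono (by omega)
  | cons b l ih =>
    have hs : Does (.branch r .skip
        (.seq (.pop r) (.seq (.push d false) (.push e false)))
        (.seq (.pop r) (.seq (.push d true) (.push e true))))
        s (Function.update (Function.update (Function.update s r l) d (b :: s d)) e
          (b :: s e)) 4 := by
      have h := fun b' => (Does.pop r s).seq ((Does.push d b' _).seq (.push e b' _))
      simp only [hl, List.tail_cons, Function.update_of_ne hd.symm, Function.update_of_ne he.symm,
        Function.update_of_ne hde.symm] at h
      cases b
      · exact .branchFalse hl (h false)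
      · exact .branchTrue hl (h true)
    have h := ih _ (by
      rw [Function.update_of_ne he, Function.update_of_ne hd, Function.update_self] :
        Function.update (Function.update (Function.update s r l) d (b :: s d)) e (b :: s e) r = l)
    refine (Does.loopStep (by simp [hl]) hs h).congr ?_ ?_
    · funext i
      by_cases h₁ : i = d
      · subst h₁; simp [hl, hd, hde, he]
      · by_cases h₂ : i = r
        · subst h₂; simp [hd, he]
        · by_cases h₃ : i = e
          · subst h₃; simp [hl, he, hd]
          · simp [h₁, h₂, h₃]
    · simp [hl, Function.update_of_ne hd, Function.update_of_ne he]; omega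

/-- Move register `r` to the empty register `d`, with the help of the empty register `e`. -/
def moveProg (r d e : ℕ) : Prog := .seq (pour r e) (pour e d)

/-- Pouring a stack reverses it, hence the detour through a second stack. -/
theorem does_move {r d e : ℕ} (hd : r ≠ d) (he : r ≠ e) (hde : d ≠ e) (s : Store)
    (h₁ : s d = []) (h₂ : s e = []) :
    Does (moveProg r d e) s (Function.update (Function.update s r []) d (s r))
      (8 * (s r).length + 2) := by
  have h := (does_pour he s).seq (does_pour hde.symm _)
  simp only [Function.update_self, h₂, List.append_nil, List.reverse_reverse, List.length_reverse]
    at h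
  refine h.congr ?_ (by omega)
  funext i
  by_cases hi : i = d
  · subst hi; simp [hde, hd.symm, h₁]
  · by_cases hi₂ : i = e
    · subst hi₂; simp [hi, he.symm, h₂]
    · by_cases hi₃ : i = r
      · subst hi₃; simp [hi, hi₂]
      · simp [hi, hi₂, hi₃]

/-- Copy register `r` to the empty register `d`, with the help of the empty register `e`. -/
def copyProg (r d e : ℕ) : Prog := .seq (pour r e) (pourTwo e r d)

theorem does_copy {r d e : ℕ} (hd : r ≠ d) (he : r ≠ e) (hde : d ≠ e) (s : Store)
    (h₁ : s d = []) (h₂ : s e = []) :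
    Does (copyProg r d e) s (Function.update s d (s r)) (9 * (s r).length + 2) := by
  have h := (does_pour he s).seq (does_pourTwo he.symm hde.symm hd _)
  simp only [Function.update_self, h₂, List.append_nil, List.reverse_reverse, List.length_reverse]
    at h
  refine h.congr ?_ (by omega)
  funext i
  by_cases hi : i = d
  · subst hi; simp [hde, hd.symm, h₁]
  · by_cases hi₂ : i = e
    · subst hi₂; simp [hi, he.symm, h₂]
    · by_cases hi₃ : i = r
      · subst hi₃; simp [hi, hi₂]
      · simp [hi, hi₂, hi₃]

/-- Total length of a list of registers. -/
def totalLength (A : List (List Bool)) : ℕ := (A.map List.length).sum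

@[simp] theorem totalLength_append (A B : List (List Bool)) :
    totalLength (A ++ B) = totalLength A + totalLength B := by simp [totalLength]

@[simp] theorem totalLength_cons (a : List Bool) (A : List (List Bool)) :
    totalLength (a :: A) = a.length + totalLength A := by simp [totalLength]

@[simp] theorem totalLength_nil : totalLength [] = 0 := rfl

/-- Move the `g` registers after the empty register `x` down by one. -/
def shiftDown (x : ℕ) : ℕ → Prog
  | 0 => .skip
  | g + 1 => .seq (moveProg (x + 1) x (x + g + 2)) (shiftDown (x + 1) g)

theorem does_shiftDown (X G : List (List Bool)) :
    Does (shiftDown X.length G.length) (initStore (X ++ [] :: G)) (initStore (X ++ G))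
      (8 * totalLength G + 2 * G.length + 1) := by
  induction G generalizing X with
  | nil =>
    rw [initStore_concat_nil, List.append_nil]
    exact (Does.skip _).mono (by omega)
  | cons g G ih =>
    have e₁ : X ++ [] :: g :: G = (X ++ [[]]) ++ g :: G := by simp
    have hm := does_move (r := X.length + 1) (d := X.length) (e := X.length + G.length + 2)
      (by omega) (by omega) (by omega) (initStore (X ++ [] :: g :: G))
      (initStore_apply_length _ _ _ rfl) (initStore_of_le (by simp; omega))
    rw [e₁, initStore_apply_length _ _ _ (by simp), update_initStore _ _ _ _ (by simp),
      List.append_assoc X _ ([] :: G), List.singleton_append, update_initStore _ _ _ _ rfl] at hm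
    have e₂ : X ++ g :: [] :: G = (X ++ [g]) ++ [] :: G := by simp
    have e₃ : X ++ g :: G = (X ++ [g]) ++ G := by simp
    have hs := ih (X ++ [g])
    rw [← e₂, ← e₃] at hs
    rw [e₁]
    simp only [List.append_assoc, List.singleton_append, List.length_append, List.length_cons,
      List.length_nil, zero_add] at hs hm ⊢
    refine (hm.seq hs).mono ?_
    simp; omega

/-- Delete register `x`, which is followed by `g` registers. -/
def deleteProg (x g : ℕ) : Prog := .seq (clearProg x) (shiftDown x g)

theorem does_delete (X G : List (List Bool)) (r : List Bool) {x g : ℕ} (hx : x = X.length)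
    (hg : g = G.length) :
    Does (deleteProg x g) (initStore (X ++ r :: G)) (initStore (X ++ G))
      (2 * r.length + 8 * totalLength G + 2 * G.length + 2) := by
  subst hx hg
  have hc := does_clear X.length (initStore (X ++ r :: G))
  rw [initStore_apply_length _ _ _ rfl, update_initStore _ _ _ _ rfl] at hc
  exact (hc.seq (does_shiftDown X G)).mono (by omega)

/-- Delete `c` registers from register `x` on, which are followed by `g` registers. -/
def deleteBlock (x g : ℕ) : ℕ → Prog
  | 0 => .skip
  | c + 1 => .seq (deleteProg x (c + g)) (deleteBlock x g c)

theorem does_deleteBlock (X F G : List (List Bool)) {x f g : ℕ} (hx : x = X.length)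
    (hf : f = F.length) (hg : g = G.length) :
    Does (deleteBlock x g f) (initStore (X ++ F ++ G)) (initStore (X ++ G))
      ((8 * totalLength (F ++ G) + 2 * (F ++ G).length + 2) * F.length + 1) := by
  subst hx hf hg
  induction F with
  | nil => simpa [deleteBlock] using Does.skip _
  | cons r F ih =>
    have hd := does_delete X (F ++ G) r rfl rfl
    rw [← List.append_assoc] at hd
    simp only [List.append_assoc, List.cons_append, List.length_cons, deleteBlock] at hd ih ⊢
    rw [List.length_append] at hd
    refine (hd.seq ih).mono ?_
    simp only [totalLength_append, totalLength_cons, List.length_append]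
    nlinarith

/-- Append copies of the registers `x, …, x + c - 1` after the first `n` registers. -/
def copyBlock (x n : ℕ) : ℕ → Prog
  | 0 => .skip
  | c + 1 => .seq (copyProg x n (n + 1)) (copyBlock (x + 1) (n + 1) c)

theorem does_copyBlock (X F G Z : List (List Bool)) {x n c : ℕ} (hx : x = X.length)
    (hn : n = (X ++ F ++ G ++ Z).length) (hc : c = F.length) :
    Does (copyBlock x n c) (initStore (X ++ F ++ G ++ Z)) (initStore (X ++ F ++ G ++ Z ++ F))
      (9 * totalLength F + 2 * F.length + 1) := by
  subst hx hn hc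
  induction F generalizing X Z with
  | nil => simpa [copyBlock] using Does.skip _
  | cons r F ih =>
    have hd := does_copy (r := X.length) (d := (X ++ (r :: F) ++ G ++ Z).length)
      (e := (X ++ (r :: F) ++ G ++ Z).length + 1) (by simp) (by simp; omega) (by simp)
      (initStore (X ++ (r :: F) ++ G ++ Z)) (initStore_of_le le_rfl) (initStore_of_le (by omega))
    rw [update_initStore_length] at hd
    have e : initStore (X ++ (r :: F) ++ G ++ Z) X.length = r := by
      rw [List.append_assoc, List.append_assoc, List.cons_append, initStore_apply_length _ _ _ rfl]
    rw [e] at hd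
    have h := ih (X ++ [r]) (Z ++ [r])
    simp only [List.append_assoc, List.cons_append, List.nil_append, List.length_append,
      List.length_cons, List.length_nil, copyBlock, zero_add] at hd h ⊢
    rw [show X.length + (F.length + (G.length + (Z.length + 1)) + 1) =
      X.length + (F.length + (G.length + Z.length) + 1) + 1 by omega] at h
    refine (hd.seq h).mono ?_
    simp only [totalLength_cons]
    omega

end QCrypto

namespace QCrypto

/-! ## Polynomial bounds -/

theorem polynomial_eval_mono (P : Polynomial ℕ) : Monotone fun n : ℕ => P.eval n := by
  intro a b h
  simp only [Polynomial.eval_eq_sum_range]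
  exact Finset.sum_le_sum fun i _ => Nat.mul_le_mul_left _ (Nat.pow_le_pow_left h i)

/-- `τ` is bounded by a polynomial in `sz`. -/
def PolyBd {α : Type} (sz τ : α → ℕ) : Prop := ∃ P : Polynomial ℕ, ∀ a, τ a ≤ P.eval (sz a)

namespace PolyBd

variable {α β : Type} {sz τ τ' : α → ℕ}

theorem self : PolyBd sz sz := ⟨Polynomial.X, fun a => by simp⟩

theorem const (c : ℕ) : PolyBd sz fun _ => c := ⟨Polynomial.C c, fun a => by simp⟩

theorem mono (h : PolyBd sz τ') (hle : ∀ a, τ a ≤ τ' a) : PolyBd sz τ := by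
  obtain ⟨P, hP⟩ := h
  exact ⟨P, fun a => (hle a).trans (hP a)⟩

theorem add (h : PolyBd sz τ) (h' : PolyBd sz τ') : PolyBd sz fun a => τ a + τ' a := by
  obtain ⟨P, hP⟩ := h
  obtain ⟨P', hP'⟩ := h'
  exact ⟨P + P', fun a => by simpa using add_le_add (hP a) (hP' a)⟩

theorem mul (h : PolyBd sz τ) (h' : PolyBd sz τ') : PolyBd sz fun a => τ a * τ' a := by
  obtain ⟨P, hP⟩ := h
  obtain ⟨P', hP'⟩ := h'
  exact ⟨P * P', fun a => by simpa using Nat.mul_le_mul (hP a) (hP' a)⟩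

theorem polyEval (h : PolyBd sz τ) (P : Polynomial ℕ) : PolyBd sz fun a => P.eval (τ a) := by
  obtain ⟨Q, hQ⟩ := h
  exact ⟨P.comp Q, fun a => by simpa using polynomial_eval_mono P (hQ a)⟩

theorem comp {sz' τ' : β → ℕ} (h : PolyBd sz' τ') (f : α → β)
    (hf : PolyBd sz fun a => sz' (f a)) : PolyBd sz fun a => τ' (f a) := by
  obtain ⟨P, hP⟩ := h
  exact (hf.polyEval P).mono fun a => hP (f a)

end PolyBd

/-! ## Encodings and functions computable in polynomial time -/

/-- Encoding of a type by a fixed number of registers, with a size measure. -/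
class Enc (α : Type) where
  width : ℕ
  enc : α → List (List Bool)
  length_enc : ∀ a, (enc a).length = width
  size : α → ℕ
  totalLength_le : ∀ a, totalLength (enc a) ≤ size a

open Enc (enc size)

instance : Enc (List Bool) where
  width := 1
  enc l := [l]
  length_enc _ := rfl
  size l := l.length
  totalLength_le l := by simp

instance : Enc ℕ where
  width := 1
  enc n := [unary n]
  length_enc _ := rfl
  size n := n
  totalLength_le n := by simp [unary]

instance : Enc Bool where
  width := 1
  enc b := [[b]]
  length_enc _ := rfl
  size _ := 1
  totalLength_le b := by simp

instance {α β : Type} [Enc α] [Enc β] : Enc (α × β) where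
  width := Enc.width α + Enc.width β
  enc a := enc a.1 ++ enc a.2
  length_enc a := by simp [Enc.length_enc]
  size a := size a.1 + size a.2
  totalLength_le a := by simpa using add_le_add (Enc.totalLength_le a.1) (Enc.totalLength_le a.2)

theorem enc_prod {α β : Type} [Enc α] [Enc β] (a : α × β) : enc a = enc a.1 ++ enc a.2 := rfl

@[simp] theorem size_prod {α β : Type} [Enc α] [Enc β] (a : α × β) :
    size a = size a.1 + size a.2 := rfl

@[simp] theorem size_nat (n : ℕ) : size n = n := rfl

@[simp] theorem size_bool (b : Bool) : size b = 1 := rfl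

@[simp] theorem size_list (l : List Bool) : size l = l.length := rfl

@[simp] theorem enc_list (l : List Bool) : enc l = [l] := rfl

/-- `f` is computable in time polynomial in the size of the argument. The input is kept in the
first registers, the output follows it, and all other registers are empty in the end. -/
def FP {α β : Type} [Enc α] [Enc β] (f : α → β) : Prop :=
  PolyBd size (fun a => size (f a)) ∧ ∃ (p : Prog) (τ : α → ℕ), PolyBd size τ ∧
    ∀ a, Does p (initStore (enc a)) (initStore (enc a ++ enc (f a))) (τ a)

namespace FP

variable {α β γ δ : Type} [Enc α] [Enc β] [Enc γ] [Enc δ]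

theorem size_bd {f : α → β} (h : FP f) : PolyBd size fun a => size (f a) := h.1

/-- A function whose values have the same encoding as those of a computable function. -/
theorem recode {f : α → β} (h : FP f) (g : α → γ) (he : ∀ a, enc (g a) = enc (f a))
    (hs : PolyBd size fun a => size (g a)) : FP g := by
  obtain ⟨_, p, τ, hτ, hp⟩ := h
  exact ⟨hs, p, τ, hτ, fun a => by rw [he]; exact hp a⟩

/-- A mere change of type costs one copy of the registers. The size is a separate hypothesis because
`size` may exceed the length of the encoding. -/
theorem of_enc_eq {f : α → β} (he : ∀ a, enc (f a) = enc a)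
    (hs : PolyBd size fun a => size (f a)) : FP f := by
  refine ⟨hs, copyBlock 0 (Enc.width α) (Enc.width α), _,
    ((PolyBd.self.mul (.const 9)).add (.const (2 * Enc.width α + 1))), fun a => ?_⟩
  have h := does_copyBlock [] (enc a) [] [] (x := 0) (n := Enc.width α) (c := Enc.width α) rfl
    (by simp [Enc.length_enc]) (by simp [Enc.length_enc])
  simp only [List.nil_append, List.append_nil] at h
  rw [he]
  refine h.mono ?_
  have := Enc.totalLength_le a
  rw [Enc.length_enc]
  omega

theorem id : FP (fun a : α => a) := of_enc_eq (fun _ => rfl) .self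

theorem fst : FP (Prod.fst : α × β → α) := by
  refine ⟨PolyBd.self.mono fun a => by simp, copyBlock 0 (Enc.width α + Enc.width β) (Enc.width α),
    _, ((PolyBd.self.mul (.const 9)).add (.const (2 * Enc.width α + 1))), fun a => ?_⟩
  have h := does_copyBlock [] (enc a.1) (enc a.2) [] (x := 0) (n := Enc.width α + Enc.width β)
    (c := Enc.width α) rfl (by simp [Enc.length_enc]) (by simp [Enc.length_enc])
  simp only [List.nil_append, List.append_nil] at h
  refine h.mono ?_
  have := Enc.totalLength_le a.1
  rw [Enc.length_enc, size_prod]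
  omega

theorem snd : FP (Prod.snd : α × β → β) := by
  refine ⟨PolyBd.self.mono fun a => by simp, copyBlock (Enc.width α) (Enc.width α + Enc.width β)
    (Enc.width β), _, ((PolyBd.self.mul (.const 9)).add (.const (2 * Enc.width β + 1))),
    fun a => ?_⟩
  have h := does_copyBlock (enc a.1) (enc a.2) [] [] (x := Enc.width α)
    (n := Enc.width α + Enc.width β) (c := Enc.width β) (by simp [Enc.length_enc])
    (by simp [Enc.length_enc]) (by simp [Enc.length_enc])
  simp only [List.append_nil] at h
  refine h.mono ?_
  have := Enc.totalLength_le a.2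
  rw [Enc.length_enc, size_prod]
  omega

/-- The program for `g` runs behind the saved input; afterwards the intermediate value is deleted,
which restores the layout of input followed by output. -/
theorem comp {g : β → γ} {f : α → β} (hg : FP g) (hf : FP f) : FP fun a => g (f a) := by
  obtain ⟨bf, p, τ, hτ, hp⟩ := hf
  obtain ⟨bg, q, σ, hσ, hq⟩ := hg
  have bgf := bg.comp f bf
  refine ⟨bgf, .seq p (.seq (q.rename (insertShift 0 (Enc.width α)))
    (deleteBlock (Enc.width α) (Enc.width γ) (Enc.width β))), _,
    hτ.add ((hσ.comp f bf).add (((((PolyBd.const 8).mul (bf.add bgf)).add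
      (.const (2 * (Enc.width β + Enc.width γ) + 2))).mul (.const (Enc.width β))).add (.const 1))),
    fun a => (hp a).seq (Does.seq (s' := initStore (enc a ++ (enc (f a) ++ enc (g (f a))))) ?_ ?_)⟩
  · have h := (hq (f a)).after (enc a)
    rwa [Enc.length_enc] at h
  · have h := does_deleteBlock (enc a) (enc (f a)) (enc (g (f a))) (Enc.length_enc _).symm
      (Enc.length_enc _).symm (Enc.length_enc _).symm
    rw [List.append_assoc] at h
    refine h.mono ?_
    simp only [totalLength_append, List.length_append, Enc.length_enc]
    have h₁ := Enc.totalLength_le (f a)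
    have h₂ := Enc.totalLength_le (g (f a))
    refine Nat.add_le_add_right (Nat.mul_le_mul_right _ ?_) _
    omega

theorem pair {f : α → β} {g : α → γ} (hf : FP f) (hg : FP g) : FP fun a => (f a, g a) := by
  obtain ⟨bf, p, τ, hτ, hp⟩ := hf
  obtain ⟨bg, q, σ, hσ, hq⟩ := hg
  refine ⟨bf.add bg, .seq p (q.rename (insertShift (Enc.width α) (Enc.width β))), _, hτ.add hσ,
    fun a => (hp a).seq ?_⟩
  have h := Does.insert (A := enc a) (X := []) (enc (f a)) (by simpa using hq a)
  simpa [Enc.length_enc, enc_prod] using h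

/-- Push a bit string on register `r`. -/
def pushList (r : ℕ) : List Bool → Prog
  | [] => .skip
  | b :: l => .seq (pushList r l) (.push r b)

theorem does_pushList (A : List (List Bool)) (l : List Bool) :
    Does (pushList A.length l) (initStore A) (initStore (A ++ [l])) (l.length + 1) := by
  induction l with
  | nil => rw [initStore_concat_nil]; exact .skip _
  | cons b l ih =>
    refine (ih.seq (.push _ b _)).congr ?_ (by simp)
    rw [initStore_apply_length _ _ _ rfl, update_initStore _ _ _ _ rfl]

/-- Write bit strings to the registers from `r` on. -/
def pushLists (r : ℕ) : List (List Bool) → Prog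
  | [] => .skip
  | l :: L => .seq (pushList r l) (pushLists (r + 1) L)

theorem does_pushLists (A L : List (List Bool)) :
    ∃ T, Does (pushLists A.length L) (initStore A) (initStore (A ++ L)) T ∧
      T ≤ totalLength L + L.length + 1 := by
  induction L generalizing A with
  | nil => exact ⟨1, by simpa [pushLists] using Does.skip _, by simp⟩
  | cons l L ih =>
    obtain ⟨T, h, hT⟩ := ih (A ++ [l])
    simp only [List.length_append, List.length_singleton, List.append_assoc, List.singleton_append]
      at h
    exact ⟨_, (does_pushList A l).seq h, by simp; omega⟩

theorem const (b : β) : FP fun _ : α => b := by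
  refine ⟨.const _, pushLists (Enc.width α) (enc b), _,
    .const (totalLength (enc b) + (enc b).length + 1), fun a => ?_⟩
  obtain ⟨T, h, hT⟩ := does_pushLists (enc a) (enc b)
  rw [Enc.length_enc] at h
  exact h.mono hT

theorem cond {c : α → Bool} {f g : α → β} (hc : FP c) (hf : FP f) (hg : FP g) :
    FP fun a => bif c a then f a else g a := by
  obtain ⟨_, p, τ, hτ, hp⟩ := hc
  obtain ⟨bf, q, σ, hσ, hq⟩ := hf
  obtain ⟨bg, r, ρ, hρ, hr⟩ := hg
  refine ⟨(bf.add bg).mono fun a => by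
    cases h : c a <;> simp [h], .seq p (.branch (Enc.width α) .skip
    (.seq (.pop (Enc.width α)) r) (.seq (.pop (Enc.width α)) q)), _,
    hτ.add ((hσ.add hρ).add (.const 2)), fun a => (hp a).seq ?_⟩
  have e : initStore (enc a ++ enc (c a)) (Enc.width α) = [c a] :=
    initStore_apply_length _ [] _ (Enc.length_enc a).symm
  have hpop := Does.pop (Enc.width α) (initStore (enc a ++ enc (c a)))
  rw [e, List.tail_cons] at hpop
  -- Popping the tested bit leaves a trailing empty register, which a store cannot distinguish from
  -- no register. Both branches thus start on the bare input.
  rw [show Function.update (initStore (enc a ++ enc (c a))) (Enc.width α) [] = initStore (enc a) by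
    rw [← initStore_concat_nil (enc a)]
    exact update_initStore (enc a) [] [c a] [] (Enc.length_enc a).symm] at hpop
  show Does _ _ (initStore (enc a ++ enc (bif c a then f a else g a))) _
  cases hca : c a
  · rw [hca] at e
    refine (Does.branchFalse e ((hca ▸ hpop).seq (hr a))).mono (by omega)
  · rw [hca] at e
    refine (Does.branchTrue e ((hca ▸ hpop).seq (hq a))).mono (by omega)

theorem ite {c : α → Prop} [DecidablePred c] {f g : α → β} (hc : FP fun a => decide (c a))
    (hf : FP f) (hg : FP g) : FP fun a => if c a then f a else g a := by
  have h := cond hc hf hg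
  simpa [Bool.cond_decide] using h

theorem cons {b : α → Bool} {l : α → List Bool} (hb : FP b) (hl : FP l) :
    FP fun a => b a :: l a := by
  suffices h : FP fun x : Bool × List Bool => x.1 :: x.2 from h.comp (hb.pair hl)
  refine ⟨(PolyBd.self.add (.const 1)).mono fun x => by simp,
    .seq (copyProg 1 2 3) (.branch 0 .skip (.push 2 false) (.push 2 true)), _,
    (((PolyBd.const 9).mul .self).add (.const 4)), ?_⟩
  rintro ⟨b, l⟩
  have h := does_copy (r := 1) (d := 2) (e := 3) (by omega) (by omega) (by omega)
    (initStore [[b], l]) rfl rfl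
  rw [show initStore [[b], l] 1 = l from rfl, show Function.update (initStore [[b], l]) 2 l =
    initStore [[b], l, l] from update_initStore_length [[b], l] l] at h
  have h₂ := fun b' => Does.push 2 b' (initStore [[b], l, l])
  rw [show initStore [[b], l, l] 2 = l from rfl] at h₂
  have h₃ : ∀ b', Function.update (initStore [[b], l, l]) 2 (b' :: l) =
      initStore [[b], l, b' :: l] := fun b' => update_initStore [[b], l] [] l (b' :: l) rfl
  simp only [h₃] at h₂
  have h₄ : Does (.branch 0 .skip (.push 2 false) (.push 2 true)) (initStore [[b], l, l])
      (initStore [[b], l, b :: l]) 2 := by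
    cases b
    · exact Does.branchFalse (l := []) rfl (h₂ false)
    · exact Does.branchTrue (l := []) rfl (h₂ true)
  exact (h.seq h₄).mono (by simp)

theorem tail {l : α → List Bool} (hl : FP l) : FP fun a => (l a).tail := by
  suffices h : FP fun x : List Bool => x.tail from h.comp hl
  refine ⟨PolyBd.self.mono fun x => by simp, .seq (copyProg 0 1 2) (.pop 1), _,
    (((PolyBd.const 9).mul .self).add (.const 3)), ?_⟩
  intro l
  have h := does_copy (r := 0) (d := 1) (e := 2) (by omega) (by omega) (by omega)
    (initStore [l]) rfl rfl
  rw [show initStore [l] 0 = l from rfl, show Function.update (initStore [l]) 1 l =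
    initStore [l, l] from update_initStore_length [l] l] at h
  refine (h.seq (Does.pop _ _)).congr ?_ (by simp)
  exact update_initStore [l] [] l l.tail rfl

/-- The body of the loop which computes a fold. -/
def foldBody (v w : ℕ) (p : Prog) : Prog :=
  .branch v .skip
    (.seq (.pop v) (.seq (.push (v + 1 + w) false)
      (.seq (p.rename (insertShift v 1))
        (deleteBlock (v + 1) (w) (w + 1)))))
    (.seq (.pop v) (.seq (.push (v + 1 + w) true)
      (.seq (p.rename (insertShift v 1))
        (deleteBlock (v + 1) (w) (w + 1)))))

/-- One round of the loop which computes a fold. -/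
theorem does_foldl_step {p : Prog} {a : α} {b b' : β} {c : Bool} {T : ℕ} (l : List Bool)
    (h : Does p (initStore (enc (a, b, c))) (initStore (enc (a, b, c) ++ enc b')) T) :
    Does (foldBody (Enc.width α) (Enc.width β) p)
      (initStore (enc a ++ (c :: l) :: enc b)) (initStore (enc a ++ l :: enc b'))
      (T + ((8 * (size b + 1 + size b') + 2 * (2 * Enc.width β + 1) + 2) * (Enc.width β + 1)) +
        4) := by
  have e₀ : initStore (enc a ++ (c :: l) :: enc b) (Enc.width α) = c :: l :=
    initStore_apply_length _ _ _ (Enc.length_enc a).symm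
  have h₁ := Does.pop (Enc.width α) (initStore (enc a ++ (c :: l) :: enc b))
  rw [e₀, List.tail_cons, update_initStore _ _ _ _ (Enc.length_enc a).symm] at h₁
  have h₂ := Does.push (Enc.width α + 1 + Enc.width β) c (initStore (enc a ++ l :: enc b))
  have e₁ : Enc.width α + 1 + Enc.width β = (enc a ++ l :: enc b).length := by
    simp [Enc.length_enc]; omega
  rw [e₁, update_initStore_length, initStore_of_le le_rfl, ← e₁] at h₂
  have h₃ := Does.insert (A := enc a) (X := enc b ++ [[c]]) (Y := enc b ++ [[c]] ++ enc b') [l]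
    (by simpa [enc_prod, show enc c = [[c]] from rfl] using h)
  rw [Enc.length_enc, List.length_singleton] at h₃
  have h₄ := does_deleteBlock (enc a ++ [l]) (enc b ++ [[c]]) (enc b')
    (x := Enc.width α + 1) (f := Enc.width β + 1) (g := Enc.width β) (by simp [Enc.length_enc])
    (by simp [Enc.length_enc]) (by simp [Enc.length_enc])
  simp only [List.append_assoc, List.cons_append, List.nil_append] at h₂ h₃ h₄
  have h₅ := h₁.seq (h₂.seq (h₃.seq h₄))
  have hb := Enc.totalLength_le b
  have hb' := Enc.totalLength_le b'
  have hT : (8 * totalLength (enc b ++ [c] :: enc b') + 2 * (enc b ++ [c] :: enc b').length + 2) *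
      (enc b ++ [[c]]).length ≤
      (8 * (size b + 1 + size b') + 2 * (2 * Enc.width β + 1) + 2) * (Enc.width β + 1) := by
    simp only [totalLength_append, totalLength_cons, List.length_append, List.length_cons,
      List.length_nil, Enc.length_enc, zero_add]
    gcongr ?_ * _
    omega
  cases c
  · exact (Does.branchFalse e₀ h₅).mono (by omega)
  · exact (Does.branchTrue e₀ h₅).mono (by omega)

/-- Iterating a polynomial-time step may blow up sizes exponentially. The bound `B` on the partial
results over all prefixes excludes this, and then every round takes uniformly polynomial time. -/
theorem foldl {l : α → List Bool} {init : α → β} {step : α → β → Bool → β} (hl : FP l)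
    (hi : FP init) (hs : FP fun x : α × β × Bool => step x.1 x.2.1 x.2.2) {B : α → ℕ}
    (hB : PolyBd size B)
    (hb : ∀ a l₁ l₂, l a = l₁ ++ l₂ → size (l₁.foldl (step a) (init a)) ≤ B a) :
    FP fun a => (l a).foldl (step a) (init a) := by
  obtain ⟨bl, p, τ, hτ, hp⟩ := hl
  obtain ⟨-, q, σ, hσ, hq⟩ := hi
  obtain ⟨-, r, ρ, ⟨P, hP⟩, hr⟩ := hs
  have hround : PolyBd size fun a : α => P.eval (size a + (B a + 1)) +
      ((8 * (B a + 1 + B a) + 2 * (2 * Enc.width β + 1) + 2) * (Enc.width β + 1)) + 5 :=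
    (((PolyBd.self.add (hB.add (.const 1))).polyEval P).add
      (((((PolyBd.const 8).mul ((hB.add (.const 1)).add hB)).add (.const _)).add (.const 2)).mul
        (.const _))).add (.const 5)
  refine ⟨hB.mono fun a => hb a (l a) [] (by simp), .seq p (.seq
    (q.rename (insertShift (Enc.width α) 1)) (.seq (.loop (Enc.width α)
      (foldBody (Enc.width α) (Enc.width β) r))
      (deleteProg (Enc.width α) (Enc.width β)))), _,
    hτ.add (hσ.add (((bl.mul hround).add (.const 1)).add
      (((PolyBd.const 8).mul hB).add (.const (2 * Enc.width β + 2))))), fun a => (hp a).seq ?_⟩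
  have h₁ := Does.insert (A := enc a) (X := []) [l a] (by simpa using hq a)
  simp only [Enc.length_enc, List.length_singleton, List.append_assoc, List.append_nil,
    List.singleton_append] at h₁
  refine h₁.seq (Does.seq (s' := initStore (enc a ++ [] :: enc ((l a).foldl (step a) (init a))))
    ?_ ?_)
  -- Loop invariant: `l₂` is still to be read, and the accumulator holds the fold over the part `l₁`
  -- already consumed.
  · have key : ∀ l₂ l₁, l a = l₁ ++ l₂ → Does
        (.loop (Enc.width α) (foldBody (Enc.width α) (Enc.width β) r))
        (initStore (enc a ++ l₂ :: enc (l₁.foldl (step a) (init a))))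
        (initStore (enc a ++ [] :: enc ((l a).foldl (step a) (init a))))
        (l₂.length * (P.eval (size a + (B a + 1)) +
          ((8 * (B a + 1 + B a) + 2 * (2 * Enc.width β + 1) + 2) * (Enc.width β + 1)) + 5) + 1) := by
      intro l₂
      induction l₂ with
      | nil =>
        intro l₁ h
        rw [h, List.append_nil]
        exact (Does.loopDone _ (initStore_apply_length _ _ _ (Enc.length_enc a).symm)).mono
          (by omega)
      | cons c l₂ ih =>
        intro l₁ h
        have h' : l a = (l₁ ++ [c]) ++ l₂ := by simp [h]
        have b₁ := hb a l₁ _ h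
        have b₂ := hb a (l₁ ++ [c]) _ h'
        have hstep := does_foldl_step l₂ (hr (a, l₁.foldl (step a) (init a), c))
        have hrest := ih (l₁ ++ [c]) h'
        simp only [List.foldl_append, List.foldl_cons, List.foldl_nil] at hrest b₂
        refine (Does.loopStep ?_ hstep hrest).mono ?_
        · rw [initStore_apply_length _ _ _ (Enc.length_enc a).symm]
          simp
        · have hPt := (hP (a, l₁.foldl (step a) (init a), c)).trans (polynomial_eval_mono P
            (show size (a, l₁.foldl (step a) (init a), c) ≤ size a + (B a + 1) by simp; omega))
          have hmul : (8 * (size (l₁.foldl (step a) (init a)) + 1 +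
              size (step a (l₁.foldl (step a) (init a)) c)) + 2 * (2 * Enc.width β + 1) + 2) *
              (Enc.width β + 1) ≤
              (8 * (B a + 1 + B a) + 2 * (2 * Enc.width β + 1) + 2) * (Enc.width β + 1) := by
            gcongr
          simp only [List.length_cons, Nat.add_mul, Nat.one_mul] at hPt hmul ⊢
          omega
    exact key (l a) [] rfl
  · have h := does_delete (enc a) (enc ((l a).foldl (step a) (init a))) [] (Enc.length_enc a).symm
      (Enc.length_enc _).symm
    refine h.mono ?_
    have h₁ := Enc.totalLength_le ((l a).foldl (step a) (init a))
    have h₂ := hb a (l a) [] (by simp)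
    simp only [List.length_nil, Enc.length_enc]
    omega

theorem initStore_map_range {s : Store} {R : ℕ} (h : ∀ i, R ≤ i → s i = []) :
    initStore ((List.range R).map s) = s := by
  funext i
  by_cases hi : i < R
  · simp [initStore, List.getD, hi]
  · rw [initStore_of_le (by simpa using hi), h i (by omega)]

/-- Calling an arbitrary program which halts in polynomial time. -/
theorem run (p : Prog) (r : ℕ) {f : α → β} (hf : FP f) {T : α → ℕ} (hT : PolyBd size T)
    (h : ∀ a, ∃ t ≤ T a, p.HaltsIn (enc (f a)) t) : FP fun a => p.output (enc (f a)) r := by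
  obtain ⟨bf, q, σ, hσ, hq⟩ := hf
  have hlen : ∀ {a t s}, Runs p (initStore (enc (f a))) t s → ∀ i,
      (s i).length ≤ size (f a) + t := by
    intro a t s hs i
    refine (hs.length_le i).trans (Nat.add_le_add_right ?_ _)
    refine le_trans ?_ (Enc.totalLength_le (f a))
    generalize enc (f a) = L
    induction L generalizing i with
    | nil => simp
    | cons x L ih =>
      cases i with
      | zero => simp
      | succ i => simpa using (ih i).trans (Nat.le_add_left _ _)
  -- So many registers cover everything `p` may touch, its input, and the register `r` that is read
  -- off.
  let R := max (max p.bound (Enc.width β)) (r + 1)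
  refine ⟨(bf.add hT).mono fun a => ?_, .seq q (.seq (p.rename (insertShift 0 (Enc.width α)))
    (.seq (copyBlock (Enc.width α + r) (Enc.width α + R) 1)
      (deleteBlock (Enc.width α) 1 R))), _, hσ.add (hT.add
        ((((PolyBd.const 9).mul (bf.add hT)).add (.const 3)).add
          (((((PolyBd.const 8).mul ((PolyBd.const (R + 1)).mul (bf.add hT))).add
            (.const (2 * (R + 1) + 2))).mul (.const R)).add (.const 1)))), fun a => (hq a).seq ?_⟩
  · obtain ⟨t, ht, s, hs⟩ := h a
    simp only [p.output_eq hs, size_list]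
    exact (hlen hs r).trans (Nat.add_le_add_left ht _)
  · obtain ⟨t, ht, s, hs⟩ := h a
    simp only [p.output_eq hs]
    have hs₀ : ∀ i, R ≤ i → s i = [] := by
      intro i hi
      rw [hs.eq_of_bound_le i (by omega), initStore_of_le (by rw [Enc.length_enc]; omega)]
    have h₁ : Does p (initStore (enc (f a))) (initStore ((List.range R).map s)) (T a) := by
      rw [initStore_map_range hs₀]
      exact ⟨t, ht, hs⟩
    have h₂ := h₁.after (enc a)
    rw [Enc.length_enc] at h₂
    have hsplit : (List.range R).map s = (List.range r).map s ++ [s r] ++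
        (List.range (R - (r + 1))).map (fun i => s (r + 1 + i)) := by
      conv_lhs => rw [show R = r + 1 + (R - (r + 1)) by omega, List.range_add, List.range_succ]
      simp [Function.comp_def]
    have h₃ := does_copyBlock (enc a ++ (List.range r).map s) [s r]
      ((List.range (R - (r + 1))).map (fun i => s (r + 1 + i))) [] (x := Enc.width α + r)
      (n := Enc.width α + R) (c := 1) (by simp [Enc.length_enc])
      (by simp [Enc.length_enc]; omega) rfl
    have h₄ := does_deleteBlock (enc a) ((List.range R).map s) [s r] (x := Enc.width α) (f := R)
      (g := 1) (Enc.length_enc a).symm (by simp) rfl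
    have e : enc a ++ (List.range r).map s ++ [s r] ++
        (List.range (R - (r + 1))).map (fun i => s (r + 1 + i)) = enc a ++ (List.range R).map s := by
      rw [hsplit]; simp
    rw [List.append_nil, e] at h₃
    have hsum : totalLength ((List.range R).map s ++ [s r]) ≤ (R + 1) * (size (f a) + T a) := by
      have hl := fun i => (hlen hs i).trans (Nat.add_le_add_left ht _)
      have : totalLength ((List.range R).map s) ≤ R * (size (f a) + T a) := by
        unfold totalLength
        refine (List.sum_le_card_nsmul _ (size (f a) + T a) ?_).trans (by simp)
        intro x hx
        simp only [List.mem_map] at hx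
        obtain ⟨_, ⟨i, _, rfl⟩, rfl⟩ := hx
        exact hl i
      have := hl r
      simp only [totalLength_append, totalLength_cons, totalLength_nil]
      linarith
    refine (h₂.seq (h₃.seq h₄)).mono ?_
    have hl := (hlen hs r).trans (Nat.add_le_add_left ht _)
    simp only [totalLength_cons, totalLength_nil, List.length_append, List.length_map,
      List.length_range, List.length_singleton]
    refine add_le_add le_rfl (add_le_add ?_ (Nat.add_le_add_right (Nat.mul_le_mul_right _ ?_) _))
      <;> omega

end FP

/-- A computable function of several registers yields a program with the outputs in the first
registers. -/
theorem FP.exists_prog {α β : Type} [Enc α] [Enc β] {f : α → β} (hf : FP f) :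
    ∃ (p : Prog) (τ : α → ℕ), PolyBd size τ ∧
      ∀ a, Does p (initStore (enc a)) (initStore (enc (f a))) (τ a) := by
  obtain ⟨bf, p, τ, hτ, hp⟩ := hf
  refine ⟨.seq p (deleteBlock 0 (Enc.width β) (Enc.width α)), _, hτ.add
    (((((PolyBd.const 8).mul (PolyBd.self.add bf)).add
      (.const (2 * (Enc.width α + Enc.width β) + 2))).mul (.const (Enc.width α))).add (.const 1)),
    fun a => (hp a).seq ?_⟩
  have h := does_deleteBlock [] (enc a) (enc (f a)) rfl (Enc.length_enc a).symm
    (Enc.length_enc (f a)).symm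
  refine h.mono ?_
  simp only [totalLength_append, List.length_append, Enc.length_enc]
  have h₁ := Enc.totalLength_le a
  have h₂ := Enc.totalLength_le (f a)
  refine Nat.add_le_add_right (Nat.mul_le_mul_right _ ?_) _
  omega

end QCrypto

namespace QCrypto
open Enc (enc size)

-- Polynomial-time arithmetic on unary numbers and operations on bit strings

attribute [fun_prop] FP FP.id FP.const FP.comp FP.pair FP.cond FP.ite FP.cons FP.tail

/-- Primitive recursion with constant result type. -/
def natLoop {β : Type} (n : ℕ) (init : β) (step : ℕ → β → β) : β := Nat.rec init step n

@[simp] theorem natLoop_zero {β : Type} (init : β) (step : ℕ → β → β) :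
    natLoop 0 init step = init := rfl

theorem natLoop_succ {β : Type} (n : ℕ) (init : β) (step : ℕ → β → β) :
    natLoop (n + 1) init step = step n (natLoop n init step) := rfl

/-- Primitive recursion is a fold over a unary string which carries a counter. This reduces
`FP.natLoop` to `FP.foldl`. -/
theorem foldl_unary {β : Type} (n : ℕ) (init : β) (step : ℕ → β → β) :
    (unary n).foldl (fun (s : ℕ × β) (_ : Bool) => (s.1 + 1, step s.1 s.2)) (0, init) =
      (n, natLoop n init step) := by
  induction n with
  | zero => rfl
  | succ n ih =>
    rw [unary, List.replicate_succ', List.foldl_append]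
    rw [unary] at ih
    rw [ih]
    rfl

namespace FP

variable {α β γ δ : Type} [Enc α] [Enc β] [Enc γ] [Enc δ]

theorem of_eq {f g : α → β} (hf : FP f) (h : ∀ a, f a = g a) : FP g := funext h ▸ hf

@[fun_prop] theorem fst' {f : α → β × γ} (hf : FP f) : FP fun a => (f a).1 := fst.comp hf

@[fun_prop] theorem snd' {f : α → β × γ} (hf : FP f) : FP fun a => (f a).2 := snd.comp hf

@[fun_prop] theorem unary {f : α → ℕ} (hf : FP f) : FP fun a => unary (f a) :=
  (of_enc_eq (fun _ => rfl) (PolyBd.self.mono fun n => by simp [QCrypto.unary]) :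
    FP QCrypto.unary).comp hf

@[fun_prop] theorem succ {f : α → ℕ} (hf : FP f) : FP fun a => f a + 1 :=
  (recode (f := fun a => true :: QCrypto.unary (f a)) (by fun_prop) _ (fun _ => rfl)
    (hf.size_bd.add (.const 1)))

theorem natLoop {n : α → ℕ} {init : α → β} {step : α → ℕ → β → β} (hn : FP n) (hi : FP init)
    (hs : FP fun x : α × ℕ × β => step x.1 x.2.1 x.2.2) {B : α → ℕ} (hB : PolyBd size B)
    (hb : ∀ a, ∀ i ≤ n a, size (natLoop i (init a) (step a)) ≤ B a) :
    FP fun a => natLoop (n a) (init a) (step a) := by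
  have h : FP fun a => (QCrypto.unary (n a)).foldl
      (fun (s : ℕ × β) (_ : Bool) => (s.1 + 1, step a s.1 s.2)) (0, init a) := by
    refine foldl (α := α) (β := ℕ × β) (step := fun a s _ => (s.1 + 1, step a s.1 s.2))
      (by fun_prop) (by fun_prop) ?_ (hn.size_bd.add hB) ?_
    · have h₂ : FP fun x : α × (ℕ × β) × Bool => step x.1 x.2.1.1 x.2.1.2 :=
        hs.comp (f := fun x : α × (ℕ × β) × Bool => (x.1, x.2.1.1, x.2.1.2)) (by fun_prop)
      fun_prop
    · intro a l₁ l₂ h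
      -- A prefix of a unary string is unary, so partial folds are partial loops and the assumed
      -- bound applies.
      have hl : l₁ = QCrypto.unary l₁.length := by
        refine List.eq_replicate_of_mem fun b hb => ?_
        exact List.eq_of_mem_replicate (n := n a) (by
          change b ∈ QCrypto.unary (n a); rw [h]; exact List.mem_append_left _ hb)
      have hle : l₁.length ≤ n a := by
        have := congrArg List.length h
        simp [QCrypto.unary] at this
        omega
      rw [hl, foldl_unary]
      have := hb a _ hle
      simp only [size_prod, size_nat]
      omega
  have h₂ := h.snd'
  simpa only [foldl_unary] using h₂

@[fun_prop] theorem length {l : α → List Bool} (hl : FP l) : FP fun a => (l a).length := by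
  have h : FP fun a => (l a).foldl (fun n _ => n + 1) 0 :=
    foldl (step := fun _ n _ => n + 1) hl (.const 0) (by fun_prop) hl.size_bd (by
      intro a l₁ l₂ h
      simp [h])
  simpa using h

@[fun_prop] theorem reverse {l : α → List Bool} (hl : FP l) : FP fun a => (l a).reverse := by
  have h : FP fun a => (l a).foldl (fun acc b => b :: acc) [] :=
    foldl (step := fun _ acc b => b :: acc) hl (.const []) (by fun_prop) hl.size_bd (by
      intro a l₁ l₂ h
      simp [h])
  simpa using h

@[fun_prop] theorem append {l l' : α → List Bool} (hl : FP l) (hl' : FP l') :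
    FP fun a => l a ++ l' a := by
  have h : FP fun a => (l a).reverse.foldl (fun acc b => b :: acc) (l' a) :=
    foldl (step := fun _ acc b => b :: acc) hl.reverse hl' (by fun_prop)
      (hl.size_bd.add hl'.size_bd) (by
        intro a l₁ l₂ h
        have := congrArg List.length h
        simp at this
        simp; omega)
  simpa using h

-- Overwriting the accumulator while reading the reversed list leaves the first bit.
@[fun_prop] theorem headD {l : α → List Bool} (hl : FP l) (d : Bool) :
    FP fun a => (l a).headD d := by
  have h : FP fun a => (l a).reverse.foldl (fun _ b => b) d :=
    foldl (step := fun _ _ b => b) hl.reverse (.const d) (by fun_prop) (.const 1) (by simp)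
  refine h.of_eq fun a => ?_
  cases l a <;> simp

@[fun_prop] theorem not {f : α → Bool} (hf : FP f) : FP fun a => !f a := by
  have h : FP fun a => bif f a then false else true := by fun_prop
  refine h.of_eq fun a => ?_
  cases f a <;> rfl

@[fun_prop] theorem and {f g : α → Bool} (hf : FP f) (hg : FP g) : FP fun a => f a && g a := by
  have h : FP fun a => bif f a then g a else false := by fun_prop
  refine h.of_eq fun a => ?_
  cases f a <;> rfl

theorem pred {f : α → ℕ} (hf : FP f) : FP fun a => f a - 1 :=
  recode (f := fun a => (QCrypto.unary (f a)).tail) (by fun_prop) _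
    (fun a => by simp [enc, QCrypto.unary]) (hf.size_bd.mono fun a => by simp)

@[fun_prop] theorem add {f g : α → ℕ} (hf : FP f) (hg : FP g) : FP fun a => f a + g a := by
  have e : ∀ b i : ℕ, QCrypto.natLoop i b (fun _ n => n + 1) = b + i := by
    intro b i
    induction i with
    | zero => rfl
    | succ i ih => rw [natLoop_succ, ih]; rfl
  have h := natLoop (step := fun _ _ n => n + 1) hg hf (by fun_prop)
    (hf.size_bd.add hg.size_bd) (by intro a i hi; rw [e]; simp; omega)
  simpa only [e] using h

@[fun_prop] theorem sub {f g : α → ℕ} (hf : FP f) (hg : FP g) : FP fun a => f a - g a := by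
  have e : ∀ b i : ℕ, QCrypto.natLoop i b (fun _ n => n - 1) = b - i := by
    intro b i
    induction i with
    | zero => rfl
    | succ i ih => rw [natLoop_succ, ih]; omega
  have h := natLoop (step := fun _ _ n => n - 1) hg hf (pred (by fun_prop))
    hf.size_bd (by intro a i hi; rw [e]; simp)
  simpa only [e] using h

theorem isZero {f : α → ℕ} (hf : FP f) : FP fun a => decide (f a = 0) := by
  have e : ∀ i : ℕ, QCrypto.natLoop i true (fun _ _ => false) = decide (i = 0) := by
    intro i
    cases i <;> rfl
  have h := natLoop (step := fun _ _ _ => false) hf (.const true) (by fun_prop)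
    (.const 1) (by simp)
  simpa only [e] using h

@[fun_prop] theorem le {f g : α → ℕ} (hf : FP f) (hg : FP g) :
    FP fun a => decide (f a ≤ g a) := by
  have h := isZero (hf.sub hg)
  simpa only [Nat.sub_eq_zero_iff_le] using h

@[fun_prop] theorem lt {f g : α → ℕ} (hf : FP f) (hg : FP g) :
    FP fun a => decide (f a < g a) := hf.succ.le hg

@[fun_prop] theorem eq {f g : α → ℕ} (hf : FP f) (hg : FP g) :
    FP fun a => decide (f a = g a) := by
  have h := (hf.le hg).and (hg.le hf)
  refine h.of_eq fun a => ?_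
  rw [← Bool.decide_and]
  exact decide_eq_decide.2 (by omega)

@[fun_prop] theorem sumRange {n : α → ℕ} {g : α → ℕ → ℕ} (hn : FP n)
    (hg : FP fun x : α × ℕ => g x.1 x.2) : FP fun a => ∑ i ∈ Finset.range (n a), g a i := by
  have e : ∀ a i, QCrypto.natLoop i 0 (fun i s => s + g a i) = ∑ j ∈ Finset.range i, g a j := by
    intro a i
    induction i with
    | zero => rfl
    | succ i ih => rw [natLoop_succ, ih, Finset.sum_range_succ]
  have h₂ : FP fun x : α × ℕ × ℕ => g x.1 x.2.1 :=
    hg.comp (f := fun x : α × ℕ × ℕ => (x.1, x.2.1)) (by fun_prop)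
  obtain ⟨P, hP⟩ := hg.size_bd
  have h := natLoop (step := fun a i s => s + g a i) hn (.const 0) (by fun_prop)
    (hn.size_bd.mul ((PolyBd.self.add hn.size_bd).polyEval P)) (by
      intro a i hi
      rw [e]
      have : ∀ j ∈ Finset.range i, g a j ≤ P.eval (size a + n a) := fun j hj =>
        (hP (a, j)).trans (polynomial_eval_mono P (by
          have := Finset.mem_range.1 hj
          simp; omega))
      refine (Finset.sum_le_card_nsmul _ _ _ this).trans ?_
      simp only [Finset.card_range, smul_eq_mul, size_nat]
      gcongr)
  simpa only [e] using h

@[fun_prop] theorem mul {f g : α → ℕ} (hf : FP f) (hg : FP g) : FP fun a => f a * g a := by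
  have h : FP fun a => ∑ _i ∈ Finset.range (f a), g a := by fun_prop
  simpa using h

@[fun_prop] theorem pow {f : α → ℕ} (hf : FP f) (k : ℕ) : FP fun a => f a ^ k := by
  induction k with
  | zero => simpa using FP.const 1
  | succ k ih => simpa only [pow_succ] using ih.mul hf

@[fun_prop] theorem polyEval {f : α → ℕ} (hf : FP f) (P : Polynomial ℕ) :
    FP fun a => P.eval (f a) := by
  induction P using Polynomial.induction_on' with
  | add p q hp hq => simpa using hp.add hq
  | monomial n c =>
    simp only [Polynomial.eval_monomial]
    fun_prop

@[fun_prop] theorem mod {f g : α → ℕ} (hf : FP f) (hg : FP g) : FP fun a => f a % g a := by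
  -- A counter which wraps around at `d`. For `d = 0` it never wraps, in agreement with `i % 0 = i`.
  have e : ∀ d i : ℕ, QCrypto.natLoop i 0 (fun _ m => if m + 1 = d then 0 else m + 1) = i % d := by
    intro d i
    induction i with
    | zero => simp
    | succ i ih =>
      rw [natLoop_succ, ih, Nat.add_mod_eq_ite]
      rcases Nat.lt_trichotomy d 1 with h | rfl | h
      · obtain rfl : d = 0 := by omega
        simp
      · simp [Nat.mod_one]
      · rw [Nat.mod_eq_of_lt h]
        have := Nat.mod_lt i (by omega : 0 < d)
        split_ifs <;> omega
  have h := natLoop (step := fun a _ m => if m + 1 = g a then 0 else m + 1) hf (.const 0)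
    (by fun_prop) hf.size_bd (by
      intro a i hi
      rw [e]
      exact (Nat.mod_le _ _).trans hi)
  simpa only [e] using h

theorem half {f : α → ℕ} (hf : FP f) : FP fun a => f a / 2 := by
  -- The half of a number counts the odd numbers below it.
  have h : FP fun a => ∑ i ∈ Finset.range (f a), i % 2 := by fun_prop
  refine h.of_eq fun a => ?_
  induction f a with
  | zero => rfl
  | succ n ih => rw [Finset.sum_range_succ, ih]; omega

@[fun_prop] theorem testBit {f g : α → ℕ} (hf : FP f) (hg : FP g) :
    FP fun a => (f a).testBit (g a) := by
  have e : ∀ b i : ℕ, QCrypto.natLoop i b (fun _ n => n / 2) = b / 2 ^ i := by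
    intro b i
    induction i with
    | zero => simp
    | succ i ih => rw [natLoop_succ, ih, Nat.div_div_eq_div_mul, pow_succ]
  have h := natLoop (step := fun _ _ n => n / 2) hg hf (half (by fun_prop))
    hf.size_bd (by intro a i hi; rw [e]; exact Nat.div_le_self _ _)
  simp only [e] at h
  have h₂ : FP fun a => decide (f a / 2 ^ g a % 2 = 1) := by fun_prop
  simpa only [Nat.testBit_eq_decide_div_mod_eq] using h₂

@[fun_prop] theorem forallLt {n : α → ℕ} {c : α → ℕ → Bool} (hn : FP n)
    (hc : FP fun x : α × ℕ => c x.1 x.2) : FP fun a => decide (∀ i < n a, c a i = true) := by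
  have e : ∀ a i, QCrypto.natLoop i true (fun i b => b && c a i) =
      decide (∀ j < i, c a j = true) := by
    intro a i
    induction i with
    | zero => simp
    | succ i ih =>
      rw [natLoop_succ, ih]
      rw [Bool.eq_iff_iff]
      simp only [Bool.and_eq_true, decide_eq_true_eq, Nat.lt_succ_iff_lt_or_eq]
      exact ⟨fun h j hj => hj.elim (h.1 j) fun e => e ▸ h.2,
        fun h => ⟨fun j hj => h j (.inl hj), h i (.inr rfl)⟩⟩
  have h₂ : FP fun x : α × ℕ × Bool => c x.1 x.2.1 :=
    hc.comp (f := fun x : α × ℕ × Bool => (x.1, x.2.1)) (by fun_prop)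
  have h := natLoop (step := fun a i b => b && c a i) hn (.const true) (by fun_prop)
    (.const 1) (by simp)
  simpa only [e] using h

-- Numbers are written in unary, so trial division by all smaller numbers is polynomial.
@[fun_prop] theorem prime {f : α → ℕ} (hf : FP f) : FP fun a => decide (f a).Prime := by
  have h : FP fun a => decide (1 < f a) &&
      decide (∀ i < f a, (!(decide (1 < i) && decide (f a % i = 0))) = true) := by
    fun_prop
  refine h.of_eq fun a => ?_
  rw [Bool.eq_iff_iff]
  simp only [Nat.prime_def_lt', Bool.and_eq_true, decide_eq_true_eq, Bool.not_eq_true',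
    Bool.and_eq_false_iff, decide_eq_false_iff_not, Nat.dvd_iff_mod_eq_zero]
  refine and_congr Iff.rfl ⟨fun h m hm hlt => ?_, fun h i hi => ?_⟩
  · exact (h m hlt).resolve_left (by omega)
  · by_cases h1 : 1 < i
    · exact .inr (h i h1 hi)
    · exact .inl h1

@[fun_prop] theorem getD {l : α → List Bool} {i : α → ℕ} (hl : FP l) (hi : FP i) :
    FP fun a => (l a).getD (i a) false := by
  have e : ∀ (l : List Bool) i, QCrypto.natLoop i l (fun _ l => l.tail) = l.drop i := by
    intro l i
    induction i with
    | zero => rfl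
    | succ i ih => rw [natLoop_succ, ih, List.tail_drop]
  have h := natLoop (step := fun _ _ l => l.tail) hi hl (by fun_prop) hl.size_bd (by
    intro a i hi; rw [e]; simp)
  simp only [e] at h
  have h₂ := h.headD false
  refine h₂.of_eq fun a => ?_
  simp [List.getD_eq_getElem?_getD, List.headD_eq_head?_getD]

@[fun_prop] theorem list_eq {l l' : α → List Bool} (hl : FP l) (hl' : FP l') :
    FP fun a => decide (l a = l' a) := by
  have hxor : FP fun x : Bool × Bool => bif x.1 then x.2 else !x.2 := by fun_prop
  have h : FP fun a => decide ((l a).length = (l' a).length) && decide (∀ i < (l a).length,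
      (bif (l a).getD i false then (l' a).getD i false else !(l' a).getD i false) = true) := by
    fun_prop
  refine h.of_eq fun a => ?_
  rw [Bool.eq_iff_iff]
  simp only [Bool.and_eq_true, decide_eq_true_eq]
  constructor
  · rintro ⟨h₁, h₂⟩
    refine List.ext_getElem h₁ fun i h h' => ?_
    have := h₂ i h
    rw [List.getD_eq_getElem _ _ h, List.getD_eq_getElem _ _ h'] at this
    revert this
    cases (l a)[i] <;> cases (l' a)[i] <;> simp
  · intro h
    rw [h]
    refine ⟨rfl, fun i _ => ?_⟩
    cases (l' a).getD i false <;> rfl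

theorem size_mem_foldl_append {l : List ℕ} (g : ℕ → List Bool) (B : ℕ)
    (h : ∀ i ∈ l, (g i).length ≤ B) : (l.flatMap g).length ≤ l.length * B := by
  rw [List.length_flatMap]
  refine (List.sum_le_card_nsmul _ B ?_).trans (by simp)
  intro x hx
  obtain ⟨i, hi, rfl⟩ := List.mem_map.1 hx
  exact h i hi

@[fun_prop] theorem flatMapRange {n : α → ℕ} {g : α → ℕ → List Bool} (hn : FP n)
    (hg : FP fun x : α × ℕ => g x.1 x.2) : FP fun a => (List.range (n a)).flatMap (g a) := by
  have e : ∀ a i, QCrypto.natLoop i [] (fun i l => l ++ g a i) = (List.range i).flatMap (g a) := by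
    intro a i
    induction i with
    | zero => rfl
    | succ i ih => rw [natLoop_succ, ih, List.range_succ, List.flatMap_append]; simp
  have h₂ : FP fun x : α × ℕ × List Bool => g x.1 x.2.1 :=
    hg.comp (f := fun x : α × ℕ × List Bool => (x.1, x.2.1)) (by fun_prop)
  obtain ⟨P, hP⟩ := hg.size_bd
  have h := natLoop (step := fun a i l => l ++ g a i) hn (.const []) (by fun_prop)
    (hn.size_bd.mul ((PolyBd.self.add hn.size_bd).polyEval P)) (by
      intro a i hi
      rw [e]
      refine (size_mem_foldl_append (g a) (P.eval (size a + n a)) fun j hj =>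
        (hP (a, j)).trans (polynomial_eval_mono P (by
          have := List.mem_range.1 hj
          simp; omega))).trans ?_
      simp only [List.length_range, size_nat]
      gcongr)
  simpa only [e] using h

@[fun_prop] theorem mapRange {n : α → ℕ} {g : α → ℕ → Bool} (hn : FP n)
    (hg : FP fun x : α × ℕ => g x.1 x.2) : FP fun a => (List.range (n a)).map (g a) := by
  have h : FP fun a => (List.range (n a)).flatMap fun i => [g a i] := by fun_prop
  simpa only [List.flatMap_singleton'] using h.of_eq fun a => (List.map_eq_flatMap ..).symm

/-- Exponentials are not polynomial in general, but this power of two is short enough to be written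
in unary. -/
theorem two_pow_size_le (n : ℕ) : 2 ^ n.size ≤ 2 * n + 1 := by
  rcases Nat.eq_zero_or_pos n with rfl | h
  · simp
  · have h₁ : 0 < n.size := Nat.size_pos.2 h
    have h₂ : 2 ^ (n.size - 1) ≤ n := Nat.lt_size.1 (by omega)
    have h₃ : 2 ^ n.size = 2 * 2 ^ (n.size - 1) := by
      rw [← pow_succ', Nat.sub_add_cancel h₁]
    omega

/-- Both numbers are computed together, because the power of two is the threshold at which the bit
length grows. -/
theorem size_pair {f : α → ℕ} (hf : FP f) : FP fun a => ((f a).size, 2 ^ (f a).size) := by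
  have e : ∀ i : ℕ, QCrypto.natLoop i (0, 1)
      (fun i s => if s.2 ≤ i + 1 then (s.1 + 1, 2 * s.2) else s) = (i.size, 2 ^ i.size) := by
    intro i
    induction i with
    | zero => simp
    | succ i ih =>
      rw [natLoop_succ, ih]
      have h₁ : i < 2 ^ i.size := Nat.lt_size_self i
      by_cases h : 2 ^ i.size ≤ i + 1
      · have : (i + 1).size = i.size + 1 := by
          refine le_antisymm (Nat.size_le.2 ?_) (Nat.lt_size.2 h)
          rw [pow_succ]; omega
        simp [h, this, pow_succ']
      · have : (i + 1).size = i.size :=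
          le_antisymm (Nat.size_le.2 (by omega)) (Nat.size_le_size (by omega))
        simp [h, this]
  have h := natLoop (step := fun _ i (s : ℕ × ℕ) =>
      if s.2 ≤ i + 1 then (s.1 + 1, 2 * s.2) else s) hf (.const (0, 1)) (by fun_prop)
    ((((PolyBd.const 4).mul hf.size_bd).add (.const 2))) (by
      intro a i hi
      rw [e]
      have h₁ := two_pow_size_le i
      have h₂ : i.size < 2 ^ i.size := Nat.lt_two_pow_self
      simp only [size_prod, size_nat]
      omega)
  simpa only [e] using h

@[fun_prop] theorem nat_size {f : α → ℕ} (hf : FP f) : FP fun a => (f a).size :=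
  (size_pair hf).fst'

@[fun_prop] theorem two_pow_size {f : α → ℕ} (hf : FP f) : FP fun a => 2 ^ (f a).size :=
  (size_pair hf).snd'

end FP

end QCrypto

namespace QCrypto
open Enc (enc size)

/-! ## Circuits as data -/

/-- A gate as a gate name and three wires. -/
def Gate.code : Gate → ℕ × ℕ × ℕ × ℕ
  | .X t => (0, t, 0, 0)
  | .H t => (1, t, 0, 0)
  | .T t => (2, t, 0, 0)
  | .cnot c t => (3, c, t, 0)
  | .ccnot c₁ c₂ t => (4, c₁, c₂, t)

/-- The gate with a given name and wires. -/
def gateOf (k a b c : ℕ) : Gate :=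
  if k = 0 then .X a else if k = 1 then .H a else if k = 2 then .T a else if k = 3 then .cnot a b
  else .ccnot a b c

/-- Shift all wires of a gate. -/
def Gate.shift (o : ℕ) : Gate → Gate
  | .X t => .X (t + o)
  | .H t => .H (t + o)
  | .T t => .T (t + o)
  | .cnot c t => .cnot (c + o) (t + o)
  | .ccnot c₁ c₂ t => .ccnot (c₁ + o) (c₂ + o) (t + o)

theorem Gate.width_eq (g : Gate) : g.width = if g.code.1 < 3 then g.code.2.1 + 1 else
    if g.code.1 = 3 then max g.code.2.1 g.code.2.2.1 + 1 else
    max (max g.code.2.1 g.code.2.2.1) g.code.2.2.2 + 1 := by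
  cases g <;> rfl

theorem Gate.shift_eq (o : ℕ) (g : Gate) :
    g.shift o = gateOf g.code.1 (g.code.2.1 + o) (g.code.2.2.1 + o) (g.code.2.2.2 + o) := by
  cases g <;> rfl

theorem readGates_cons (k a b c : ℕ) (l : List ℕ) : readGates (k :: a :: b :: c :: l) =
    if k ≤ 4 then gateOf k a b c :: readGates l else readGates l := by
  rcases k with _ | _ | _ | _ | _ | k <;> simp [readGates, gateOf]

theorem readGates_of_length_lt {l : List ℕ} (h : l.length < 4) : readGates l = [] := by
  rcases l with _ | ⟨a, _ | ⟨b, _ | ⟨c, _ | ⟨d, l⟩⟩⟩⟩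
  · simp [readGates]
  · simp [readGates]
  · simp [readGates]
  · simp [readGates]
  · simp at h; omega

theorem gateOf_code (g : Gate) : gateOf g.code.1 g.code.2.1 g.code.2.2.1 g.code.2.2.2 = g := by
  cases g <;> rfl

theorem Gate.code_fst_le (g : Gate) : g.code.1 ≤ 4 := by cases g <;> simp [Gate.code]

/-- Description of a gate. -/
def encGate (g : Gate) : List Bool :=
  unary g.code.1 ++ false :: (unary g.code.2.1 ++ false :: (unary g.code.2.2.1 ++
    false :: (unary g.code.2.2.2 ++ [false])))

/-- Description of a circuit. -/
def encGates (C : List Gate) : List Bool := C.flatMap encGate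

@[simp] theorem encGates_nil : encGates [] = [] := rfl

@[simp] theorem encGates_append (C D : List Gate) :
    encGates (C ++ D) = encGates C ++ encGates D := List.flatMap_append

@[simp] theorem encGates_cons (g : Gate) (C : List Gate) :
    encGates (g :: C) = encGate g ++ encGates C := rfl

theorem readUnary_unary_append (n m : ℕ) (l : List Bool) :
    readUnary (unary n ++ false :: l) m = (m + n) :: readUnary l 0 := by
  induction n generalizing m with
  | zero => rfl
  | succ n ih =>
    change readUnary (unary n ++ false :: l) (m + 1) = _
    rw [ih]
    congr 1
    omega

/-- Hence a program may specify any circuit by writing out its encoding. -/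
theorem decodeCircuit_encGates (C : List Gate) : decodeCircuit (encGates C) = C := by
  induction C with
  | nil => simp [decodeCircuit, readUnary, readGates]
  | cons g C ih =>
    unfold decodeCircuit at ih ⊢
    rw [encGates_cons, encGate]
    simp only [List.append_assoc, List.cons_append, List.nil_append, readUnary_unary_append,
      zero_add, readGates_cons, if_pos g.code_fst_le, gateOf_code, ih]

theorem length_encGate (g : Gate) :
    (encGate g).length = g.code.1 + g.code.2.1 + g.code.2.2.1 + g.code.2.2.2 + 4 := by
  simp [encGate, unary]; omega

theorem length_encGate_gateOf_le (k a b c : ℕ) (hk : k ≤ 4) :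
    (encGate (gateOf k a b c)).length ≤ k + a + b + c + 4 := by
  rw [length_encGate]
  unfold gateOf
  split_ifs <;> simp [Gate.code] <;> omega

theorem sum_readUnary_le (d : List Bool) (n : ℕ) :
    (readUnary d n).sum + (readUnary d n).length ≤ d.length + n := by
  induction d generalizing n with
  | nil => simp [readUnary]
  | cons b d ih =>
    cases b
    · have := ih 0
      simp only [readUnary, List.sum_cons, List.length_cons]
      omega
    · have := ih (n + 1)
      simp only [readUnary, List.length_cons]
      omega

/-- Normalising a description only drops unknown gate names and unused wires. This keeps decoding
polynomial in size for arbitrary, possibly malformed, descriptions. -/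
theorem length_encGates_readGates_le (l : List ℕ) :
    (encGates (readGates l)).length ≤ l.sum + l.length := by
  induction h : l.length using Nat.strong_induction_on generalizing l with
  | _ n ih =>
    by_cases hl : l.length < 4
    · simp [readGates_of_length_lt hl]
    · obtain ⟨k, a, b, c, l, rfl⟩ : ∃ k a b c l', l = k :: a :: b :: c :: l' := by
        rcases l with _ | ⟨a, _ | ⟨b, _ | ⟨c, _ | ⟨d, l⟩⟩⟩⟩
        · simp at hl
        · simp at hl
        · simp at hl
        · simp at hl
        · exact ⟨_, _, _, _, _, rfl⟩
      have := ih l.length (by simp at h; omega) l rfl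
      simp only [List.length_cons, List.sum_cons] at h ⊢
      rw [readGates_cons]
      split_ifs with hk
      · have := length_encGate_gateOf_le k a b c hk
        simp only [encGates_cons, List.length_append]
        omega
      · omega

theorem length_encGates_decodeCircuit_le (d : List Bool) :
    (encGates (decodeCircuit d)).length ≤ d.length :=
  (length_encGates_readGates_le _).trans (sum_readUnary_le d 0)

theorem circuitWidth_le (C : List Gate) : circuitWidth C ≤ (encGates C).length := by
  induction C with
  | nil => simp [circuitWidth]
  | cons g C ih =>
    have : g.width ≤ (encGate g).length := by
      rw [length_encGate]
      cases g <;> simp [Gate.width, Gate.code] <;> omega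
    simp only [circuitWidth, List.map_cons, List.foldr_cons, encGates_cons, List.length_append]
      at ih ⊢
    omega

theorem length_le_length_encGates (C : List Gate) : C.length ≤ (encGates C).length := by
  induction C with
  | nil => simp
  | cons g C ih =>
    have := length_encGate g
    simp only [List.length_cons, encGates_cons, List.length_append]
    omega

@[simp] theorem circuitWidth_nil : circuitWidth [] = 0 := rfl

@[simp] theorem circuitWidth_cons (g : Gate) (C : List Gate) :
    circuitWidth (g :: C) = max g.width (circuitWidth C) := rfl

@[simp] theorem circuitWidth_append (C D : List Gate) :
    circuitWidth (C ++ D) = max (circuitWidth C) (circuitWidth D) := by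
  induction C with
  | nil => simp
  | cons g C ih => simp [ih, max_assoc]

theorem circuitWidth_le_iff (C : List Gate) (N : ℕ) :
    circuitWidth C ≤ N ↔ ∀ g ∈ C, g.width ≤ N := by
  induction C with
  | nil => simp
  | cons g C ih => simp [ih]

/-- State of the automaton which reads the description of a circuit: a result, the number of wires
read of the current block, these wires, and the number of ones since the last zero. -/
abbrev ReadState (β : Type) : Type := β × ℕ × (ℕ × ℕ × ℕ) × ℕ

/-- One step of the automaton. -/
def readStep {β : Type} (step : β → Gate → β) (s : ReadState β) (bit : Bool) : ReadState β :=
  bif bit then (s.1, s.2.1, s.2.2.1, s.2.2.2 + 1)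
  else if s.2.1 = 0 then (s.1, 1, (s.2.2.2, s.2.2.1.2), 0)
  else if s.2.1 = 1 then (s.1, 2, (s.2.2.1.1, s.2.2.2, s.2.2.1.2.2), 0)
  else if s.2.1 = 2 then (s.1, 3, (s.2.2.1.1, s.2.2.1.2.1, s.2.2.2), 0)
  else (if s.2.2.1.1 ≤ 4 then
    step s.1 (gateOf s.2.2.1.1 s.2.2.1.2.1 s.2.2.1.2.2 s.2.2.2) else s.1, 0, s.2.2.1, 0)

/-- Total of the numbers stored by the automaton. -/
def ReadState.total {β : Type} (s : ReadState β) : ℕ :=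
  s.2.2.1.1 + s.2.2.1.2.1 + s.2.2.1.2.2 + s.2.2.2

theorem readStep_bound {β : Type} (step : β → Gate → β) (d : List Bool) (s : ReadState β)
    (hs : s.2.1 ≤ 3) : (d.foldl (readStep step) s).2.1 ≤ 3 ∧
      ReadState.total (d.foldl (readStep step) s) ≤ s.total + d.length := by
  induction d generalizing s with
  | nil => exact ⟨hs, le_rfl⟩
  | cons bit d ih =>
    have h : (readStep step s bit).2.1 ≤ 3 ∧ (readStep step s bit).total ≤ s.total + 1 := by
      unfold readStep ReadState.total
      cases bit
      · simp only [cond_false]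
        split_ifs <;> simp <;> omega
      · simp; omega
    have h₂ := ih _ h.1
    rw [List.foldl_cons, List.length_cons]
    exact ⟨h₂.1, by omega⟩

/-- The invariant: `k` of the stored numbers open the current block, and `cur` ones of the next
number have been seen. A gate is processed when the fourth number of its block ends. -/
theorem foldl_readStep {β : Type} (step : β → Gate → β) (d : List Bool) (b : β) (k : ℕ)
    (n : ℕ × ℕ × ℕ) (cur : ℕ) (hk : k ≤ 3) :
    (d.foldl (readStep step) (b, k, n, cur)).1 =
      (readGates ([n.1, n.2.1, n.2.2].take k ++ readUnary d cur)).foldl step b := by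
  induction d generalizing b k n cur with
  | nil =>
    rw [readGates_of_length_lt (by simp only [readUnary, List.append_nil, List.length_take]; omega)]
    rfl
  | cons bit d ih =>
    rw [List.foldl_cons]
    obtain ⟨n₀, n₁, n₂⟩ := n
    cases bit
    · simp only [readUnary]
      rcases k with _ | _ | _ | _ | k
      · exact ih _ _ _ _ (by omega)
      · exact ih _ _ _ _ (by omega)
      · exact ih _ _ _ _ (by omega)
      · refine (ih _ _ _ _ (by omega)).trans ?_
        simp only [List.take, List.nil_append, List.cons_append, readGates_cons]
        split_ifs <;> rfl
      · omega
    · exact ih _ _ _ _ hk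

theorem foldl_decodeCircuit {β : Type} (step : β → Gate → β) (d : List Bool) (b : β) :
    (d.foldl (readStep step) (b, 0, (0, 0, 0), 0)).1 = (decodeCircuit d).foldl step b := by
  rw [foldl_readStep _ _ _ _ _ _ (by omega)]
  rfl

theorem readUnary_append (d₁ d₂ : List Bool) (n : ℕ) :
    ∃ m, readUnary (d₁ ++ d₂) n = readUnary d₁ n ++ readUnary d₂ m := by
  induction d₁ generalizing n with
  | nil => exact ⟨n, rfl⟩
  | cons b d₁ ih =>
    cases b
    · obtain ⟨m, h⟩ := ih 0
      exact ⟨m, by simp [readUnary, h]⟩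
    · obtain ⟨m, h⟩ := ih (n + 1)
      exact ⟨m, by simp [readUnary, h]⟩

theorem readGates_append (l₁ l₂ : List ℕ) : readGates l₁ <+: readGates (l₁ ++ l₂) := by
  induction h : l₁.length using Nat.strong_induction_on generalizing l₁ with
  | _ n ih =>
    by_cases hl : l₁.length < 4
    · simp [readGates_of_length_lt hl]
    · obtain ⟨k, a, b, c, l, rfl⟩ : ∃ k a b c l', l₁ = k :: a :: b :: c :: l' := by
        rcases l₁ with _ | ⟨a, _ | ⟨b, _ | ⟨c, _ | ⟨d, l⟩⟩⟩⟩
        · simp at hl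
        · simp at hl
        · simp at hl
        · simp at hl
        · exact ⟨_, _, _, _, _, rfl⟩
      have := ih l.length (by simp at h; omega) l rfl
      simp only [List.cons_append, readGates_cons]
      split_ifs
      · exact (List.prefix_cons_inj _).2 this
      · exact this

/-- Reading goes from left to right, so a size bound for folds over prefixes of the circuit yields
one for folds over prefixes of its description. -/
theorem decodeCircuit_append (d₁ d₂ : List Bool) :
    decodeCircuit d₁ <+: decodeCircuit (d₁ ++ d₂) := by
  obtain ⟨m, h⟩ := readUnary_append d₁ d₂ 0
  rw [decodeCircuit, decodeCircuit, h]
  exact readGates_append _ _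

theorem foldl_snoc {γ δ : Type} (f : γ → δ) (l : List γ) (m : List δ) :
    l.foldl (fun acc x => acc ++ [f x]) m = m ++ l.map f := by
  induction l generalizing m with
  | nil => simp
  | cons x l ih => simp [ih]

instance : Enc Gate where
  width := Enc.width (ℕ × ℕ × ℕ × ℕ)
  enc g := enc g.code
  length_enc g := Enc.length_enc g.code
  size g := size g.code
  totalLength_le g := Enc.totalLength_le g.code

instance : Enc (List Gate) where
  width := 1
  enc C := [encGates C]
  length_enc _ := rfl
  size C := (encGates C).length
  totalLength_le C := by simp

theorem size_gate (g : Gate) : size g = g.code.1 + (g.code.2.1 + (g.code.2.2.1 + g.code.2.2.2)) :=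
  rfl

@[simp] theorem size_gates (C : List Gate) : size C = (encGates C).length := rfl

/-! ### Polynomial-time operations on circuits -/

namespace FP

variable {α β γ δ : Type} [Enc α] [Enc β] [Enc γ] [Enc δ]

@[fun_prop] theorem gate_code {g : α → Gate} (hg : FP g) : FP fun a => (g a).code :=
  (of_enc_eq (fun _ => rfl) .self : FP Gate.code).comp hg

@[fun_prop] theorem gate_X {t : α → ℕ} (ht : FP t) : FP fun a => Gate.X (t a) :=
  recode (f := fun a => (0, t a, 0, 0)) (by fun_prop) _ (fun _ => rfl)
    (ht.size_bd.mono fun _ => by simp [size_gate, Gate.code])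

@[fun_prop] theorem gate_H {t : α → ℕ} (ht : FP t) : FP fun a => Gate.H (t a) :=
  recode (f := fun a => (1, t a, 0, 0)) (by fun_prop) _ (fun _ => rfl)
    ((ht.size_bd.add (.const 1)).mono fun _ => by simp [size_gate, Gate.code]; omega)

@[fun_prop] theorem gate_T {t : α → ℕ} (ht : FP t) : FP fun a => Gate.T (t a) :=
  recode (f := fun a => (2, t a, 0, 0)) (by fun_prop) _ (fun _ => rfl)
    ((ht.size_bd.add (.const 2)).mono fun _ => by simp [size_gate, Gate.code]; omega)

@[fun_prop] theorem gate_cnot {c t : α → ℕ} (hc : FP c) (ht : FP t) :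
    FP fun a => Gate.cnot (c a) (t a) :=
  recode (f := fun a => (3, c a, t a, 0)) (by fun_prop) _ (fun _ => rfl)
    (((hc.size_bd.add ht.size_bd).add (.const 3)).mono fun _ => by
      simp [size_gate, Gate.code]; omega)

@[fun_prop] theorem gate_ccnot {c d t : α → ℕ} (hc : FP c) (hd : FP d) (ht : FP t) :
    FP fun a => Gate.ccnot (c a) (d a) (t a) :=
  recode (f := fun a => (4, c a, d a, t a)) (by fun_prop) _ (fun _ => rfl)
    ((((hc.size_bd.add hd.size_bd).add ht.size_bd).add (.const 4)).mono fun _ => by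
      simp [size_gate, Gate.code]; omega)

@[fun_prop] theorem gateOf {k a b c : α → ℕ} (hk : FP k) (ha : FP a) (hb : FP b) (hc : FP c) :
    FP fun x => gateOf (k x) (a x) (b x) (c x) := by
  unfold QCrypto.gateOf
  fun_prop

@[fun_prop] theorem gate_shift {o : α → ℕ} {g : α → Gate} (ho : FP o) (hg : FP g) :
    FP fun x => (g x).shift (o x) := by
  simp only [Gate.shift_eq]
  fun_prop

@[fun_prop] theorem max {f g : α → ℕ} (hf : FP f) (hg : FP g) : FP fun a => max (f a) (g a) := by
  simp only [max_def]
  fun_prop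

@[fun_prop] theorem gate_width {g : α → Gate} (hg : FP g) : FP fun x => (g x).width := by
  simp only [Gate.width_eq]
  fun_prop

@[fun_prop] theorem encGates {C : α → List Gate} (hC : FP C) : FP fun a => encGates (C a) :=
  recode hC _ (fun _ => rfl) hC.size_bd

theorem ofEncGates {C : α → List Gate} (hC : FP fun a => QCrypto.encGates (C a)) : FP C :=
  recode hC _ (fun _ => rfl) hC.size_bd

/-- A loop over the gates is a loop over the bits of the description, run by the reading automaton.
-/
theorem foldlDecode {d : α → List Bool} {init : α → β} {step : α → β → Gate → β} (hd : FP d)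
    (hi : FP init) (hs : FP fun x : α × β × Gate => step x.1 x.2.1 x.2.2) {B : α → ℕ}
    (hB : PolyBd size B) (hb : ∀ a C₁ C₂, decodeCircuit (d a) = C₁ ++ C₂ →
      size (C₁.foldl (step a) (init a)) ≤ B a) :
    FP fun a => (decodeCircuit (d a)).foldl (step a) (init a) := by
  have h : FP fun a => (d a).foldl (readStep (step a)) (init a, 0, (0, 0, 0), 0) := by
    refine foldl (step := fun a => readStep (step a)) hd (by fun_prop) ?_
      (hB.add (hd.size_bd.add (.const 3))) ?_
    · unfold readStep
      have h₂ : FP fun x : α × ReadState β × Bool => step x.1 x.2.1.1 (QCrypto.gateOf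
          x.2.1.2.2.1.1 x.2.1.2.2.1.2.1 x.2.1.2.2.1.2.2 x.2.1.2.2.2) :=
        hs.comp (f := fun x : α × ReadState β × Bool => (x.1, x.2.1.1, QCrypto.gateOf
          x.2.1.2.2.1.1 x.2.1.2.2.1.2.1 x.2.1.2.2.1.2.2 x.2.1.2.2.2)) (by fun_prop)
      fun_prop
    · intro a d₁ d₂ h
      have h₁ := readStep_bound (step a) d₁ (init a, 0, (0, 0, 0), 0) (by simp)
      have h₂ := foldl_decodeCircuit (step a) d₁ (init a)
      obtain ⟨C₂, hC₂⟩ := decodeCircuit_append d₁ d₂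
      have h₃ := hb a (decodeCircuit d₁) C₂ (by rw [h, hC₂])
      have h₄ := congrArg List.length h
      rw [← h₂] at h₃
      generalize d₁.foldl (readStep (step a)) (init a, 0, (0, 0, 0), 0) = s at *
      simp only [ReadState.total, List.length_append, size_prod, size_nat, size_list] at *
      omega
  exact h.fst'.of_eq fun a => foldl_decodeCircuit _ _ _

theorem foldlGates {C : α → List Gate} {init : α → β} {step : α → β → Gate → β} (hC : FP C)
    (hi : FP init) (hs : FP fun x : α × β × Gate => step x.1 x.2.1 x.2.2) {B : α → ℕ}
    (hB : PolyBd size B) (hb : ∀ a C₁ C₂, C a = C₁ ++ C₂ →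
      size (C₁.foldl (step a) (init a)) ≤ B a) :
    FP fun a => (C a).foldl (step a) (init a) := by
  have h := foldlDecode (d := fun a => QCrypto.encGates (C a)) (step := step) (by fun_prop) hi hs
    hB (by simpa only [decodeCircuit_encGates] using hb)
  simpa only [decodeCircuit_encGates] using h

theorem gates_snoc {C : α → List Gate} {g : α → Gate} (hC : FP C) (hg : FP g) :
    FP fun a => C a ++ [g a] := by
  apply ofEncGates
  simp only [encGates_append, encGates_cons, encGates_nil, encGate]
  fun_prop

@[fun_prop] theorem gates_cons {C : α → List Gate} {g : α → Gate} (hg : FP g) (hC : FP C) :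
    FP fun a => g a :: C a := by
  apply ofEncGates
  simp only [encGates_cons, encGate]
  fun_prop

@[fun_prop] theorem gates_append {C D : α → List Gate} (hC : FP C) (hD : FP D) :
    FP fun a => C a ++ D a := by
  apply ofEncGates
  simp only [encGates_append]
  fun_prop

@[fun_prop] theorem decodeCircuit {d : α → List Bool} (hd : FP d) :
    FP fun a => decodeCircuit (d a) := by
  have h := foldlDecode (step := fun _ C g => C ++ [g]) (init := fun _ => []) hd (.const [])
    (gates_snoc (by fun_prop) (by fun_prop)) hd.size_bd (by
      intro a C₁ C₂ h
      have h₁ := length_encGates_decodeCircuit_le (d a)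
      rw [h] at h₁
      rw [foldl_snoc (fun g => g)]
      simp at h₁ ⊢
      omega)
  simpa only [foldl_snoc (fun g : Gate => g), List.map_id', List.nil_append] using h

@[fun_prop] theorem gates_reverse {C : α → List Gate} (hC : FP C) :
    FP fun a => (C a).reverse := by
  have e : ∀ C : List Gate, (QCrypto.encGates C.reverse).length = (QCrypto.encGates C).length := by
    intro C
    induction C with
    | nil => rfl
    | cons g C ih => simp [ih]; omega
  have h := foldlGates (step := fun _ C g => g :: C) (init := fun _ => []) hC (.const [])
    (by fun_prop) hC.size_bd (by
      intro a C₁ C₂ h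
      have := e C₁
      simp [h, this])
  simpa using h

theorem length_encGates_shift_le (o : ℕ) (C : List Gate) :
    (QCrypto.encGates (C.map (Gate.shift o))).length ≤
      (QCrypto.encGates C).length + C.length * (3 * o) := by
  induction C with
  | nil => simp
  | cons g C ih =>
    have : (encGate (g.shift o)).length ≤ (encGate g).length + 3 * o := by
      simp only [length_encGate]
      cases g <;> simp [Gate.shift, Gate.code] <;> omega
    simp only [List.map_cons, encGates_cons, List.length_append, List.length_cons, Nat.add_mul,
      Nat.one_mul]
    omega

@[fun_prop] theorem gates_shift {o : α → ℕ} {C : α → List Gate} (ho : FP o) (hC : FP C) :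
    FP fun a => (C a).map (Gate.shift (o a)) := by
  have h := foldlGates (step := fun a D g => D ++ [g.shift (o a)]) (init := fun _ => []) hC
    (.const []) (gates_snoc (by fun_prop) (by fun_prop))
    (hC.size_bd.add (hC.size_bd.mul ((PolyBd.const 3).mul ho.size_bd))) (by
      intro a C₁ C₂ h
      rw [foldl_snoc (Gate.shift (o a)), List.nil_append]
      refine (length_encGates_shift_le _ _).trans ?_
      have h₁ : (QCrypto.encGates C₁).length ≤ (QCrypto.encGates (C a)).length := by simp [h]
      have h₂ := (length_le_length_encGates C₁).trans h₁
      simp only [size_gates, size_nat]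
      gcongr)
  exact h.of_eq fun a => by rw [foldl_snoc (Gate.shift (o a)), List.nil_append]

@[fun_prop] theorem circuitWidth {C : α → List Gate} (hC : FP C) :
    FP fun a => circuitWidth (C a) := by
  have e : ∀ (C : List Gate) (n : ℕ), C.foldl (fun n g => Max.max n g.width) n =
      Max.max n (QCrypto.circuitWidth C) := by
    intro C
    induction C with
    | nil => simp
    | cons g C ih => intro n; rw [List.foldl_cons, ih, circuitWidth_cons, max_assoc]
  have h := foldlGates (step := fun _ n g => Max.max n g.width) (init := fun _ => 0) hC (.const 0)
    (by fun_prop) hC.size_bd (by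
      intro a C₁ C₂ h
      rw [e]
      have := circuitWidth_le C₁
      simp [h]; omega)
  simpa only [e, zero_le, max_eq_right] using h

theorem encGates_flatMap (l : List ℕ) (g : ℕ → List Gate) :
    QCrypto.encGates (l.flatMap g) = l.flatMap fun i => QCrypto.encGates (g i) := by
  simp [QCrypto.encGates, List.flatMap_assoc]

@[fun_prop] theorem gates_flatMapRange {n : α → ℕ} {g : α → ℕ → List Gate} (hn : FP n)
    (hg : FP fun x : α × ℕ => g x.1 x.2) : FP fun a => (List.range (n a)).flatMap (g a) := by
  apply ofEncGates
  simp only [encGates_flatMap]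
  fun_prop

@[fun_prop] theorem gates_mapRange {n : α → ℕ} {g : α → ℕ → Gate} (hn : FP n)
    (hg : FP fun x : α × ℕ => g x.1 x.2) : FP fun a => (List.range (n a)).map (g a) := by
  have h : FP fun a => (List.range (n a)).flatMap fun i => [g a i] := by fun_prop
  exact h.of_eq fun a => (List.map_eq_flatMap ..).symm

end FP

end QCrypto

namespace QCrypto

/-! ## Amplitudes on infinitely many wires -/

/-- Classical configurations of infinitely many wires. -/
abbrev Cfg : Type := ℕ → Bool

/-- Amplitude functions. -/
abbrev Amp : Type := Cfg → ℂ

/-- Extend a basis state by zeros. -/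
def ext {N : ℕ} (z : Basis N) : Cfg := fun i => if h : i < N then z ⟨i, h⟩ else false

/-- Restriction of an amplitude function to the first `N` wires. -/
def restr (N : ℕ) (ψ : Amp) : Basis N → ℂ := fun z => ψ (ext z)

theorem ext_of_lt {N : ℕ} (z : Basis N) {i : ℕ} (h : i < N) : ext z i = z ⟨i, h⟩ := dif_pos h

theorem ext_of_le {N : ℕ} (z : Basis N) {i : ℕ} (h : N ≤ i) : ext z i = false :=
  dif_neg (by omega)

theorem ext_update {N : ℕ} (z : Basis N) (t : Fin N) (b : Bool) :
    ext (Function.update z t b) = Function.update (ext z) t.val b := by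
  funext i
  by_cases h : i < N
  · by_cases hi : i = t.val
    · subst hi; simp [ext_of_lt]
    · rw [Function.update_of_ne hi, ext_of_lt _ h, ext_of_lt _ h, Function.update_of_ne]
      exact fun e => hi (congrArg Fin.val e)
  · rw [ext_of_le _ (by omega), Function.update_of_ne (by omega), ext_of_le _ (by omega)]

theorem ext_eq {N : ℕ} (s : Cfg) (h : ∀ i, N ≤ i → s i = false) :
    ext (fun i : Fin N => s i) = s := by
  funext i
  by_cases hi : i < N
  · rw [ext_of_lt _ hi]
  · rw [ext_of_le _ (by omega), h i (by omega)]

theorem ext_injective {N : ℕ} : Function.Injective (ext : Basis N → Cfg) := by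
  intro z z' h
  funext i
  have := congrFun h i
  rwa [ext_of_lt _ i.2, ext_of_lt _ i.2] at this

/-- Control wires of a gate. -/
def Gate.ctrls : Gate → List ℕ
  | .X _ => []
  | .H _ => []
  | .T _ => []
  | .cnot c _ => [c]
  | .ccnot c₁ c₂ _ => [c₁, c₂]

/-- Target wire of a gate. -/
def Gate.target : Gate → ℕ
  | .X t => t
  | .H t => t
  | .T t => t
  | .cnot _ t => t
  | .ccnot _ _ t => t

/-- The one-qubit operator of a gate. -/
noncomputable def Gate.mat : Gate → Matrix Bool Bool ℂ
  | .X _ => pauliX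
  | .H _ => hadamard
  | .T _ => tGate
  | .cnot _ _ => pauliX
  | .ccnot _ _ _ => pauliX

theorem Gate.op_eq (N : ℕ) (g : Gate) : g.op N = controlled N g.ctrls g.target g.mat := by
  cases g <;> rfl

theorem Gate.width_le_iff (N : ℕ) (g : Gate) :
    g.width ≤ N ↔ g.target < N ∧ ∀ c ∈ g.ctrls, c < N := by
  cases g <;> simp [Gate.width, Gate.target, Gate.ctrls] <;> tauto

/-- Action of a gate on amplitudes. -/
noncomputable def Gate.act (g : Gate) (ψ : Amp) : Amp := fun s =>
  if g.target ∉ g.ctrls ∧ ∀ c ∈ g.ctrls, s c = true then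
    ∑ b : Bool, g.mat (s g.target) b * ψ (Function.update s g.target b)
  else ψ s

/-- Action of a circuit on amplitudes. -/
noncomputable def runAmp (C : List Gate) (ψ : Amp) : Amp := C.foldl (fun φ g => g.act φ) ψ

@[simp] theorem runAmp_nil (ψ : Amp) : runAmp [] ψ = ψ := rfl

@[simp] theorem runAmp_cons (g : Gate) (C : List Gate) (ψ : Amp) :
    runAmp (g :: C) ψ = runAmp C (g.act ψ) := rfl

@[simp] theorem runAmp_append (C D : List Gate) (ψ : Amp) :
    runAmp (C ++ D) ψ = runAmp D (runAmp C ψ) := List.foldl_append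

theorem sum_eq_sum_update {N : ℕ} (t : Fin N) (z : Basis N) (F : Basis N → ℂ)
    (hF : ∀ s, (∃ j, j ≠ t ∧ z j ≠ s j) → F s = 0) :
    ∑ s, F s = ∑ b, F (Function.update z t b) := by
  have hinj : Function.Injective fun b : Bool => Function.update z t b :=
    Function.update_injective z t
  rw [← Finset.sum_image (s := Finset.univ) (f := F) fun a _ b _ h => hinj h]
  symm
  refine Finset.sum_subset (Finset.subset_univ _) fun s _ hs => hF s ?_
  by_contra hcon
  push Not at hcon
  refine hs (Finset.mem_image.2 ⟨s t, Finset.mem_univ _, ?_⟩)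
  funext j
  by_cases hj : j = t
  · subst hj; simp
  · rw [Function.update_of_ne hj, hcon j hj]

/-- In row `z` only the columns that agree with `z` off the target wire contribute, which leaves the
two-term sum of `Gate.act`. The width bound excludes the convention that a gate on missing wires is
the identity; a target among its own controls gives the identity on both sides. -/
theorem Gate.op_mulVec {N : ℕ} (g : Gate) (hg : g.width ≤ N) (ψ : Amp) :
    g.op N *ᵥ restr N ψ = restr N (g.act ψ) := by
  rw [Gate.width_le_iff] at hg
  rw [Gate.op_eq]
  funext z
  unfold restr Gate.act controlled
  by_cases ht : g.target ∈ g.ctrls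
  · rw [dif_neg (by tauto), Matrix.one_mulVec, if_neg (by tauto)]
  rw [dif_pos ⟨hg.1, ht, hg.2⟩, Matrix.mulVec, dotProduct]
  rw [sum_eq_sum_update ⟨g.target, hg.1⟩ z]
  · have hc : ∀ b, (∀ j : Fin N, j.val ∈ g.ctrls →
        Function.update z ⟨g.target, hg.1⟩ b j = true) ↔ ∀ c ∈ g.ctrls, ext z c = true := by
      intro b
      constructor
      · intro h c hc
        have := h ⟨c, hg.2 c hc⟩ hc
        rw [Function.update_of_ne (fun e => ht (by have := congrArg Fin.val e; simp only at this; rwa [← this]))] at this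
        rw [ext_of_lt _ (hg.2 c hc), this]
      · intro h j hj
        rw [Function.update_of_ne (fun e => ht (by have := congrArg Fin.val e; simp only at this; rwa [← this]))]
        have := h j hj
        rwa [ext_of_lt _ j.2] at this
    have hne : ∀ b, ∀ j : Fin N, j.val ≠ g.target →
        z j = Function.update z ⟨g.target, hg.1⟩ b j := by
      intro b j hj
      rw [Function.update_of_ne (fun e => hj (congrArg Fin.val e))]
    simp only [Matrix.of_apply, if_pos (hne _), hc, Function.update_self, ext_update]
    by_cases h : ∀ c ∈ g.ctrls, ext z c = true
    · rw [if_pos (⟨ht, h⟩ : _ ∧ _)]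
      simp only [if_pos h, ext_of_lt _ hg.1]
    · rw [if_neg (fun hh : _ ∧ _ => h hh.2)]
      simp only [if_neg h, Matrix.one_apply, ite_mul, one_mul, zero_mul, Finset.sum_ite_eq,
        Finset.mem_univ, if_true]
      congr 1
      rw [← ext_of_lt z hg.1, Function.update_eq_self]
  · rintro s ⟨j, hj, hne⟩
    rw [Matrix.of_apply, if_neg, zero_mul]
    intro h
    exact hne (h j fun e => hj (Fin.ext e))

theorem circuitOp_mulVec {N : ℕ} (C : List Gate) (hC : circuitWidth C ≤ N) (ψ : Amp) :
    circuitOp N C *ᵥ restr N ψ = restr N (runAmp C ψ) := by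
  induction C generalizing ψ with
  | nil => simp [circuitOp]
  | cons g C ih =>
    rw [circuitWidth_cons, max_le_iff] at hC
    rw [circuitOp, ← Matrix.mulVec_mulVec, Gate.op_mulVec g hC.1, ih hC.2, runAmp_cons]

/-- Amplitudes of the all-zero state. -/
noncomputable def zeroAmp : Amp := fun s => open Classical in if ∀ i, s i = false then 1 else 0

/-- `ψ` vanishes outside configurations which use only the first `N` wires. -/
def Supp (N : ℕ) (ψ : Amp) : Prop := ∀ s : Cfg, (∃ i, N ≤ i ∧ s i = true) → ψ s = 0

theorem zeroAmp_of_forall {s : Cfg} (h : ∀ i, s i = false) : zeroAmp s = 1 := if_pos h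

theorem zeroAmp_of_ne {s : Cfg} {i : ℕ} (h : s i = true) : zeroAmp s = 0 :=
  if_neg fun h' => by simp [h' i] at h

theorem supp_zeroAmp (N : ℕ) : Supp N zeroAmp := by
  rintro s ⟨i, _, hi⟩
  exact zeroAmp_of_ne hi

theorem Supp.act {N : ℕ} {ψ : Amp} (h : Supp N ψ) {g : Gate} (hg : g.width ≤ N) :
    Supp N (g.act ψ) := by
  rw [Gate.width_le_iff] at hg
  rintro s ⟨i, hi, hs⟩
  unfold Gate.act
  split_ifs
  · refine Finset.sum_eq_zero fun b _ => ?_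
    rw [h _ ⟨i, hi, by rw [Function.update_of_ne (by omega), hs]⟩, mul_zero]
  · exact h s ⟨i, hi, hs⟩

theorem Supp.runAmp {N : ℕ} {C : List Gate} {ψ : Amp} (h : Supp N ψ) (hC : circuitWidth C ≤ N) :
    Supp N (runAmp C ψ) := by
  induction C generalizing ψ with
  | nil => exact h
  | cons g C ih =>
    rw [circuitWidth_cons, max_le_iff] at hC
    exact ih (h.act hC.1) hC.2

/-- The density operator `|ψ⟩⟨ψ|` on the first `N` wires. -/
noncomputable def pureState (N : ℕ) (ψ : Amp) : Op N :=
  Matrix.vecMulVec (restr N ψ) (star (restr N ψ))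

theorem pureState_apply {N : ℕ} (ψ : Amp) (z z' : Basis N) :
    pureState N ψ z z' = ψ (ext z) * star (ψ (ext z')) := rfl

theorem zeroState_eq (N : ℕ) : zeroState N = pureState N zeroAmp := by
  have h : ∀ z : Basis N, (∀ i, ext z i = false) ↔ ∀ i, z i = false := by
    intro z
    constructor
    · intro h i
      have := h i
      rwa [ext_of_lt _ i.2] at this
    · intro h i
      by_cases hi : i < N
      · rw [ext_of_lt _ hi, h]
      · rw [ext_of_le _ (by omega)]
  funext z z'
  simp only [zeroState, Matrix.of_apply, pureState_apply, zeroAmp, h, forall_and]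
  split_ifs <;> simp_all

theorem noQubits_eq : noQubits = pureState 0 zeroAmp := by
  funext z z'
  obtain rfl := Subsingleton.elim z z'
  rw [pureState_apply]
  have : ∀ i, ext z i = false := fun i => ext_of_le _ (by omega)
  simp [noQubits, zeroAmp, this]

/-- An amplitude function supported on `q` wires already describes all further wires as zero, so
adding ancillas changes nothing but the index type. -/
theorem withAncillas_pureState {q : ℕ} {ψ : Amp} (h : Supp q ψ) (a : ℕ) :
    withAncillas (pureState q ψ) a = pureState (q + a) ψ := by
  have key : ∀ z : Basis (q + a), (∀ j : Fin a, z (Fin.natAdd q j) = false) →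
      ext (fun i : Fin q => z (Fin.castAdd a i)) = ext z := by
    intro z hz
    funext i
    by_cases h₁ : i < q
    · rw [ext_of_lt _ h₁, ext_of_lt _ (by omega)]; rfl
    · rw [ext_of_le _ (by omega)]
      by_cases h₂ : i < q + a
      · rw [ext_of_lt _ h₂, ← hz ⟨i - q, by omega⟩]
        congr 1
        exact Fin.ext (by simp; omega)
      · rw [ext_of_le _ (by omega)]
  have hz : ∀ z : Basis (q + a), ¬ (∀ j : Fin a, z (Fin.natAdd q j) = false) →
      ψ (ext z) = 0 := by
    intro z hz
    push Not at hz
    obtain ⟨j, hj⟩ := hz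
    refine h _ ⟨q + j, by omega, ?_⟩
    rw [ext_of_lt _ (by omega)]
    simpa [Fin.natAdd] using hj
  funext z z'
  simp only [withAncillas, Matrix.of_apply, pureState_apply, forall_and]
  split_ifs with hc
  · rw [key z hc.1, key z' hc.2]
  · by_cases h₁ : ∀ j : Fin a, z (Fin.natAdd q j) = false
    · rw [hz z' (fun h₂ => hc ⟨h₁, h₂⟩), star_zero, mul_zero]
    · rw [hz z h₁, zero_mul]

theorem circuitOp_conj {N : ℕ} (C : List Gate) (hC : circuitWidth C ≤ N) (ψ : Amp) :
    circuitOp N C * pureState N ψ * (circuitOp N C)ᴴ = pureState N (runAmp C ψ) := by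
  rw [pureState, Matrix.mul_vecMulVec, Matrix.vecMulVec_mul, pureState, ← circuitOp_mulVec C hC,
    Matrix.star_mulVec]

theorem runCircuit_pureState {q : ℕ} (C : List Gate) {ψ : Amp} (h : Supp q ψ) :
    runCircuit C (pureState q ψ) = pureState (q + (circuitWidth C - q)) (runAmp C ψ) := by
  rw [runCircuit, withAncillas_pureState h, circuitOp_conj C (by omega)]

theorem pureState_diag {N : ℕ} (ψ : Amp) (z : Basis N) :
    (pureState N ψ z z).re = ‖ψ (ext z)‖ ^ 2 := by
  rw [pureState_apply, RCLike.star_def, Complex.mul_conj, Complex.normSq_eq_norm_sq,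
    Complex.ofReal_re]

/-- Expectation of `G` of the measurement outcome of the first `N` wires. -/
noncomputable def meas (N : ℕ) (ψ : Amp) (G : Cfg → ℝ) : ℝ :=
  ∑ z : Basis N, ‖ψ (ext z)‖ ^ 2 * G (ext z)

theorem ofFn_eq_map_range {N : ℕ} (z : Basis N) : List.ofFn z = (List.range N).map (ext z) := by
  refine List.ext_getElem (by simp) fun i h₁ h₂ => ?_
  simp only [List.length_ofFn] at h₁
  simp [ext_of_lt _ h₁]

theorem expect_pureState (A : QAlg) (xs : List (List Bool)) {q : ℕ} {ψ : Amp} (h : Supp q ψ)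
    (g : List Bool → ℝ) : A.expect xs (pureState q ψ) g =
      meas (A.wires xs q) (runAmp (A.circuit xs q) ψ) fun s =>
        g (A.post.output (xs ++ [unary q, (List.range (A.wires xs q)).map s]) 0) := by
  unfold QAlg.expect meas
  simp only [runCircuit_pureState _ h, pureState_diag, ofFn_eq_map_range]
  rfl

theorem meas_mono {N : ℕ} {ψ : Amp} {G G' : Cfg → ℝ} (hG : ∀ s, G s ≤ G' s) :
    meas N ψ G ≤ meas N ψ G' :=
  Finset.sum_le_sum fun _ _ => mul_le_mul_of_nonneg_left (hG _) (by positivity)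

/-- Measuring additional wires which are zero. -/
theorem meas_of_supp {N M : ℕ} (hNM : N ≤ M) {ψ : Amp} (h : Supp N ψ) (G : Cfg → ℝ) :
    meas M ψ G = meas N ψ G := by
  unfold meas
  have e : ∀ z : Basis N, ext (fun i : Fin M => ext z i) = ext z := fun z =>
    ext_eq _ fun i hi => ext_of_le _ (hNM.trans hi)
  have hinj : Function.Injective fun (z : Basis N) (i : Fin M) => ext z i := by
    intro z z' hz
    refine ext_injective ?_
    rw [← e z, ← e z']
    exact congrArg ext hz
  rw [← Finset.sum_subset (Finset.subset_univ (Finset.univ.image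
    fun (z : Basis N) (i : Fin M) => ext z i)), Finset.sum_image fun a _ b _ h => hinj h]
  · simp only [e]
  · intro s _ hs
    rw [h, norm_zero, zero_pow two_ne_zero, zero_mul]
    by_contra hcon
    push Not at hcon
    refine hs (Finset.mem_image.2 ⟨fun i => s (Fin.castLE hNM i), Finset.mem_univ _, ?_⟩)
    funext i
    by_cases hi : i.val < N
    · rw [ext_of_lt _ hi]; rfl
    · rw [ext_of_le _ (by omega)]
      have := hcon i (by omega)
      rw [ext_of_lt _ i.2] at this
      simpa using this.symm

/-! ## Norms -/

/-- Every basis state arises twice: from itself and from its neighbour across wire `t`. -/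
theorem sum_sum_update {N : ℕ} (t : Fin N) (F : Basis N → ℝ) :
    ∑ z, ∑ b, F (Function.update z t b) = 2 * ∑ z, F z := by
  have h : ∀ z : Basis N, ∑ b, F (Function.update z t b) =
      F z + F (Function.update z t (!z t)) := by
    intro z
    rw [Fintype.sum_bool]
    cases hz : z t
    · rw [← hz, Function.update_eq_self, hz, add_comm]; rfl
    · conv_lhs => rw [← hz, Function.update_eq_self]
      rfl
  simp only [h, Finset.sum_add_distrib]
  have hinv : Function.Involutive fun z : Basis N => Function.update z t (!z t) := by
    intro z; simp
  have h₂ := Equiv.sum_comp hinv.toPerm F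
  simp only [Function.Involutive.coe_toPerm] at h₂
  rw [h₂]
  ring

/-- The one-qubit operator preserves the norm. -/
def IsIsometryBool (u : Matrix Bool Bool ℂ) : Prop :=
  ∀ v : Bool → ℂ, ∑ a, ‖∑ b, u a b * v b‖ ^ 2 = ∑ b, ‖v b‖ ^ 2

theorem Gate.mat_isometry (g : Gate) : IsIsometryBool g.mat := by
  have hX : IsIsometryBool pauliX := by
    intro v
    simp [pauliX, add_comm]
  have hH : IsIsometryBool hadamard := by
    intro v
    have e : ∀ x : ℂ, ‖x‖ ^ 2 = Complex.normSq x := fun x => (Complex.normSq_eq_norm_sq x).symm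
    have h2 : (√2 : ℝ) * √2 = 2 := Real.mul_self_sqrt (by norm_num)
    have key : ∀ x y : ℂ, Complex.normSq (-1 / (√2 : ℂ) * x + 1 / (√2 : ℂ) * y) +
        Complex.normSq (1 / (√2 : ℂ) * x + 1 / (√2 : ℂ) * y) =
        Complex.normSq x + Complex.normSq y := by
      intro x y
      have e₁ : -1 / (√2 : ℂ) * x + 1 / (√2 : ℂ) * y = (y - x) * ((1 / √2 : ℝ) : ℂ) := by
        push_cast; ring
      have e₂ : 1 / (√2 : ℂ) * x + 1 / (√2 : ℂ) * y = (y + x) * ((1 / √2 : ℝ) : ℂ) := by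
        push_cast; ring
      rw [e₁, e₂, Complex.normSq_mul, Complex.normSq_mul, Complex.normSq_ofReal,
        show (1 / √2 : ℝ) * (1 / √2) = 1 / 2 by rw [div_mul_div_comm, h2]; norm_num]
      simp only [Complex.normSq_apply, Complex.add_re, Complex.add_im, Complex.sub_re,
        Complex.sub_im]
      ring
    simp only [Fintype.sum_bool, e]
    simpa [hadamard] using key (v true) (v false)
  have hT : IsIsometryBool tGate := by
    intro v
    have : ‖Complex.exp (Real.pi / 4 * Complex.I)‖ = 1 := by
      rw [show (Real.pi / 4 * Complex.I : ℂ) = ((Real.pi / 4 : ℝ) : ℂ) * Complex.I by push_cast; rfl]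
      exact Complex.norm_exp_ofReal_mul_I _
    simp [tGate, this]
  cases g
  · exact hX
  · exact hH
  · exact hT
  · exact hX
  · exact hX

/-- Basis states are paired along the target wire. The controls are constant on a pair, so the gate
acts there by a one-qubit isometry or not at all. -/
theorem Gate.norm_act {N : ℕ} (g : Gate) (hg : g.width ≤ N) (ψ : Amp) :
    ∑ z : Basis N, ‖g.act ψ (ext z)‖ ^ 2 = ∑ z : Basis N, ‖ψ (ext z)‖ ^ 2 := by
  rw [Gate.width_le_iff] at hg
  have h₁ := sum_sum_update ⟨g.target, hg.1⟩ fun z : Basis N => ‖g.act ψ (ext z)‖ ^ 2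
  have h₂ := sum_sum_update ⟨g.target, hg.1⟩ fun z : Basis N => ‖ψ (ext z)‖ ^ 2
  have h : ∀ z : Basis N, ∑ b, ‖g.act ψ (ext (Function.update z ⟨g.target, hg.1⟩ b))‖ ^ 2 =
      ∑ b, ‖ψ (ext (Function.update z ⟨g.target, hg.1⟩ b))‖ ^ 2 := by
    intro z
    simp only [ext_update]
    by_cases ht : g.target ∉ g.ctrls
    · have hc : ∀ b, (∀ c ∈ g.ctrls, Function.update (ext z) g.target b c = true) ↔
          ∀ c ∈ g.ctrls, ext z c = true := by
        intro b
        refine forall₂_congr fun c hc => ?_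
        rw [Function.update_of_ne (fun e => ht (by rwa [← e]))]
      by_cases hz : ∀ c ∈ g.ctrls, ext z c = true
      · simp only [Gate.act, hc, if_pos (⟨ht, hz⟩ : _ ∧ _), Function.update_self,
          Function.update_idem]
        exact g.mat_isometry fun b => ψ (Function.update (ext z) g.target b)
      · refine Finset.sum_congr rfl fun b _ => ?_
        rw [Gate.act, if_neg (by rw [hc]; tauto)]
    · refine Finset.sum_congr rfl fun b _ => ?_
      rw [Gate.act, if_neg (by tauto)]
  simp only [h] at h₁
  linarith

theorem norm_runAmp {N : ℕ} (C : List Gate) (hC : circuitWidth C ≤ N) (ψ : Amp) :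
    ∑ z : Basis N, ‖runAmp C ψ (ext z)‖ ^ 2 = ∑ z : Basis N, ‖ψ (ext z)‖ ^ 2 := by
  induction C generalizing ψ with
  | nil => rfl
  | cons g C ih =>
    rw [circuitWidth_cons, max_le_iff] at hC
    rw [runAmp_cons, ih hC.2, g.norm_act hC.1]

theorem norm_zeroAmp (N : ℕ) : ∑ z : Basis N, ‖zeroAmp (ext z)‖ ^ 2 = 1 := by
  have h := meas_of_supp (Nat.zero_le N) (supp_zeroAmp 0) fun _ => 1
  simp only [meas, mul_one] at h
  rw [h, Fintype.sum_unique]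
  rw [zeroAmp_of_forall fun i => ext_of_le _ (by omega)]
  simp

theorem meas_one {N : ℕ} {C : List Gate} (hC : circuitWidth C ≤ N) :
    (meas N (runAmp C zeroAmp) fun _ => 1) = 1 := by
  simp only [meas, mul_one]
  rw [norm_runAmp C hC, norm_zeroAmp]

/-! ## Disjoint blocks of wires -/

/-- Keep the first `N` wires. -/
def cut (N : ℕ) (s : Cfg) : Cfg := fun i => if i < N then s i else false

/-- Drop the first `N` wires. -/
def skip (N : ℕ) (s : Cfg) : Cfg := fun i => s (i + N)

/-- Tensor product of a state of the first `N` wires and a state of the other wires. -/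
noncomputable def tens (N : ℕ) (ψ φ : Amp) : Amp := fun s => ψ (cut N s) * φ (skip N s)

theorem cut_update_lt {N t : ℕ} (h : t < N) (s : Cfg) (b : Bool) :
    cut N (Function.update s t b) = Function.update (cut N s) t b := by
  funext i
  unfold cut
  by_cases hi : i = t
  · subst hi; simp [h]
  · simp [Function.update_of_ne hi]

theorem skip_update_lt {N t : ℕ} (h : t < N) (s : Cfg) (b : Bool) :
    skip N (Function.update s t b) = skip N s := by
  funext i
  unfold skip
  rw [Function.update_of_ne (by omega)]

theorem cut_update_add (N t : ℕ) (s : Cfg) (b : Bool) :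
    cut N (Function.update s (t + N) b) = cut N s := by
  funext i
  unfold cut
  split_ifs with h
  · rw [Function.update_of_ne (by omega)]
  · rfl

theorem skip_update_add (N t : ℕ) (s : Cfg) (b : Bool) :
    skip N (Function.update s (t + N) b) = Function.update (skip N s) t b := by
  funext i
  unfold skip
  by_cases hi : i = t
  · subst hi; simp
  · rw [Function.update_of_ne hi, Function.update_of_ne (by omega)]

theorem act_tens_left {N : ℕ} (g : Gate) (hg : g.width ≤ N) (ψ φ : Amp) :
    g.act (tens N ψ φ) = tens N (g.act ψ) φ := by
  rw [Gate.width_le_iff] at hg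
  funext s
  have hc : (∀ c ∈ g.ctrls, cut N s c = true) ↔ ∀ c ∈ g.ctrls, s c = true :=
    forall₂_congr fun c hc => by rw [cut, if_pos (hg.2 c hc)]
  simp only [Gate.act, tens, hc, cut_update_lt hg.1, skip_update_lt hg.1]
  rw [show cut N s g.target = s g.target from if_pos hg.1]
  split_ifs
  · rw [Finset.sum_mul]
    exact Finset.sum_congr rfl fun b _ => by ring
  · rfl

theorem Gate.shift_target (o : ℕ) (g : Gate) : (g.shift o).target = g.target + o := by
  cases g <;> rfl

theorem Gate.shift_ctrls (o : ℕ) (g : Gate) : (g.shift o).ctrls = g.ctrls.map (· + o) := by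
  cases g <;> rfl

theorem Gate.shift_mat (o : ℕ) (g : Gate) : (g.shift o).mat = g.mat := by
  cases g <;> rfl

theorem act_shift_tens {N : ℕ} (g : Gate) (ψ φ : Amp) :
    (g.shift N).act (tens N ψ φ) = tens N ψ (g.act φ) := by
  funext s
  have hc : (∀ c ∈ g.ctrls.map (· + N), s c = true) ↔ ∀ c ∈ g.ctrls, skip N s c = true := by
    simp [skip]
  have ht : g.target + N ∈ g.ctrls.map (· + N) ↔ g.target ∈ g.ctrls := by simp
  simp only [Gate.act, tens, Gate.shift_target, Gate.shift_ctrls, Gate.shift_mat, hc, ht,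
    cut_update_add, skip_update_add]
  rw [show skip N s g.target = s (g.target + N) from rfl]
  split_ifs
  · rw [Finset.mul_sum]
    exact Finset.sum_congr rfl fun b _ => by ring
  · rfl

theorem runAmp_tens_left {N : ℕ} (C : List Gate) (hC : circuitWidth C ≤ N) (ψ φ : Amp) :
    runAmp C (tens N ψ φ) = tens N (runAmp C ψ) φ := by
  induction C generalizing ψ with
  | nil => rfl
  | cons g C ih =>
    rw [circuitWidth_cons, max_le_iff] at hC
    rw [runAmp_cons, act_tens_left g hC.1, ih hC.2, runAmp_cons]

theorem runAmp_shift_tens {N : ℕ} (C : List Gate) (ψ φ : Amp) :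
    runAmp (C.map (Gate.shift N)) (tens N ψ φ) = tens N ψ (runAmp C φ) := by
  induction C generalizing φ with
  | nil => rfl
  | cons g C ih => rw [List.map_cons, runAmp_cons, act_shift_tens, ih, runAmp_cons]

theorem zeroAmp_eq_tens (N : ℕ) : zeroAmp = tens N zeroAmp zeroAmp := by
  funext s
  have : (∀ i, s i = false) ↔ (∀ i, cut N s i = false) ∧ ∀ i, skip N s i = false := by
    constructor
    · intro h
      refine ⟨fun i => ?_, fun i => h _⟩
      unfold cut
      split_ifs
      · exact h i
      · rfl
    · rintro ⟨h₁, h₂⟩ i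
      by_cases hi : i < N
      · have := h₁ i
        rwa [cut, if_pos hi] at this
      · have := h₂ (i - N)
        rwa [skip, Nat.sub_add_cancel (by omega)] at this
  by_cases h₁ : ∀ i, cut N s i = false
  · by_cases h₂ : ∀ i, skip N s i = false
    · rw [tens, zeroAmp_of_forall h₁, zeroAmp_of_forall h₂, zeroAmp_of_forall (this.2 ⟨h₁, h₂⟩),
        mul_one]
    · rw [tens, zeroAmp, zeroAmp, zeroAmp, if_neg (fun h => h₂ (this.1 h).2), if_neg h₂, mul_zero]
  · rw [tens, zeroAmp, zeroAmp, zeroAmp, if_neg (fun h => h₁ (this.1 h).1), if_neg h₁, zero_mul]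

/-- Circuits on disjoint wires prepare a product state, and by `meas_tens` their measurement
outcomes are independent. -/
theorem runAmp_append_shift {N : ℕ} (C D : List Gate) (hC : circuitWidth C ≤ N) :
    runAmp (C ++ D.map (Gate.shift N)) zeroAmp =
      tens N (runAmp C zeroAmp) (runAmp D zeroAmp) := by
  conv_lhs => rw [runAmp_append, zeroAmp_eq_tens N, runAmp_tens_left C hC, runAmp_shift_tens]

theorem meas_tens (N M : ℕ) (ψ φ : Amp) (G G' : Cfg → ℝ) :
    (meas (N + M) (tens N ψ φ) fun s => G (cut N s) * G' (skip N s)) =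
      meas N ψ G * meas M φ G' := by
  have h₁ : ∀ (x : Basis N) (y : Basis M), cut N (ext (Fin.append x y)) = ext x := by
    intro x y
    funext i
    unfold cut
    split_ifs with h
    · rw [ext_of_lt _ (by omega), ext_of_lt _ h]
      exact Fin.append_left x y ⟨i, h⟩
    · rw [ext_of_le _ (by omega)]
  have h₂ : ∀ (x : Basis N) (y : Basis M), skip N (ext (Fin.append x y)) = ext y := by
    intro x y
    funext i
    unfold skip
    by_cases h : i < M
    · rw [ext_of_lt _ (by omega), ext_of_lt _ h, ← Fin.append_right x y ⟨i, h⟩]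
      congr 1
      exact Fin.ext (Nat.add_comm i N)
    · rw [ext_of_le _ (by omega), ext_of_le _ (by omega)]
  unfold meas tens
  rw [← (Fin.appendEquiv N M).sum_comp, Fintype.sum_prod_type, Finset.sum_mul_sum]
  refine Finset.sum_congr rfl fun x _ => Finset.sum_congr rfl fun y _ => ?_
  change ‖ψ (cut N (ext (Fin.append x y))) * φ (skip N (ext (Fin.append x y)))‖ ^ 2 *
    (G (cut N (ext (Fin.append x y))) * G' (skip N (ext (Fin.append x y)))) = _
  rw [h₁, h₂, norm_mul]
  ring

end QCrypto

namespace QCrypto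

/-! ## Reversible classical circuits -/

/-- Action of a controlled bit flip on a configuration. -/
def Gate.flip (g : Gate) (s : Cfg) : Cfg :=
  if g.target ∉ g.ctrls ∧ ∀ c ∈ g.ctrls, s c = true then
    Function.update s g.target (!s g.target) else s

theorem Gate.flip_of {g : Gate} {s : Cfg} (h : g.target ∉ g.ctrls ∧ ∀ c ∈ g.ctrls, s c = true) :
    g.flip s = Function.update s g.target (!s g.target) := if_pos h

theorem Gate.flip_of_not {g : Gate} {s : Cfg}
    (h : ¬ (g.target ∉ g.ctrls ∧ ∀ c ∈ g.ctrls, s c = true)) : g.flip s = s := if_neg h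

theorem Gate.flip_apply_of_ne {g : Gate} {s : Cfg} {k : ℕ} (h : k ≠ g.target) :
    g.flip s k = s k := by
  unfold Gate.flip
  split_ifs
  · rw [Function.update_of_ne h]
  · rfl

theorem flip_X (t : ℕ) (s : Cfg) : (Gate.X t).flip s = Function.update s t (!s t) :=
  Gate.flip_of (by simp [Gate.ctrls])

theorem flip_ccnot_target {c d t : ℕ} (hc : t ≠ c) (hd : t ≠ d) (s : Cfg) :
    (Gate.ccnot c d t).flip s t = (s t ^^ (s c && s d)) := by
  by_cases h : s c = true ∧ s d = true
  · rw [Gate.flip_of (by simp [Gate.ctrls, Gate.target, hc, hd, h])]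
    simp [Gate.target, h]
  · rw [Gate.flip_of_not (by simpa [Gate.ctrls, Gate.target, hc, hd] using h)]
    cases hsc : s c <;> cases hsd : s d <;> simp_all

/-- Action of a reversible classical circuit on a configuration. -/
def runCfg (C : List Gate) (s : Cfg) : Cfg := C.foldl (fun s g => g.flip s) s

@[simp] theorem runCfg_nil (s : Cfg) : runCfg [] s = s := rfl

@[simp] theorem runCfg_cons (g : Gate) (C : List Gate) (s : Cfg) :
    runCfg (g :: C) s = runCfg C (g.flip s) := rfl

@[simp] theorem runCfg_append (C D : List Gate) (s : Cfg) :
    runCfg (C ++ D) s = runCfg D (runCfg C s) := List.foldl_append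

theorem Gate.act_eq_flip {g : Gate} (hg : g.mat = pauliX) (ψ : Amp) (s : Cfg) :
    g.act ψ s = ψ (g.flip s) := by
  unfold Gate.act Gate.flip
  split_ifs
  · rw [hg]
    cases h : s g.target <;> simp [pauliX]
  · rfl

/-- Controlled flips permute configurations. The new amplitude at `s` is the old one at the preimage
of `s`, which the reversed circuit computes. -/
theorem runAmp_eq_runCfg {C : List Gate} (hC : ∀ g ∈ C, g.mat = pauliX) (ψ : Amp) (s : Cfg) :
    runAmp C ψ s = ψ (runCfg C.reverse s) := by
  induction C generalizing ψ with
  | nil => rfl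
  | cons g C ih =>
    rw [runAmp_cons, ih (fun g' h => hC g' (List.mem_cons_of_mem _ h)), List.reverse_cons,
      runCfg_append, Gate.act_eq_flip (hC g List.mem_cons_self)]
    rfl

theorem Gate.flip_flip (g : Gate) (s : Cfg) : g.flip (g.flip s) = s := by
  by_cases h : g.target ∉ g.ctrls ∧ ∀ c ∈ g.ctrls, s c = true
  · have e : g.flip s = Function.update s g.target (!s g.target) := if_pos h
    have h' : g.target ∉ g.ctrls ∧
        ∀ c ∈ g.ctrls, Function.update s g.target (!s g.target) c = true := by
      refine ⟨h.1, fun c hc => ?_⟩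
      rw [Function.update_of_ne (fun e => h.1 (by rwa [← e])), h.2 c hc]
    rw [e, Gate.flip, if_pos h']
    simp
  · have e : g.flip s = s := if_neg h
    rw [e, e]

theorem runCfg_reverse (C : List Gate) (s : Cfg) : runCfg C.reverse (runCfg C s) = s := by
  induction C generalizing s with
  | nil => rfl
  | cons g C ih =>
    rw [runCfg_cons, List.reverse_cons, runCfg_append, ih, runCfg_cons, Gate.flip_flip, runCfg_nil]

/-- Add the bits of `v` to the wires from `V` on. -/
def xorFrom (V v : ℕ) (s : Cfg) : Cfg :=
  fun k => s k ^^ (decide (V ≤ k) && v.testBit (k - V))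

theorem xorFrom_of_lt {V v k : ℕ} (h : k < V) (s : Cfg) : xorFrom V v s k = s k := by
  simp [xorFrom, show ¬ V ≤ k by omega]

theorem xorFrom_xorFrom (V v : ℕ) (s : Cfg) : xorFrom V v (xorFrom V v s) = s := by
  funext k
  simp [xorFrom]

theorem flip_xorFrom {g : Gate} {V : ℕ} (hg : g.width ≤ V) (v : ℕ) (s : Cfg) :
    g.flip (xorFrom V v s) = xorFrom V v (g.flip s) := by
  rw [Gate.width_le_iff] at hg
  have hc : (∀ c ∈ g.ctrls, xorFrom V v s c = true) ↔ ∀ c ∈ g.ctrls, s c = true :=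
    forall₂_congr fun c hc => by rw [xorFrom_of_lt (hg.2 c hc)]
  by_cases h : g.target ∉ g.ctrls ∧ ∀ c ∈ g.ctrls, s c = true
  · rw [Gate.flip_of h, Gate.flip_of ⟨h.1, hc.2 h.2⟩, xorFrom_of_lt hg.1]
    funext k
    by_cases hk : k = g.target
    · subst hk
      simp [xorFrom, show ¬ V ≤ g.target by omega]
    · simp [xorFrom, Function.update_of_ne hk]
  · rw [Gate.flip_of_not h, Gate.flip_of_not (fun h' => h ⟨h'.1, hc.1 h'.2⟩)]

/-- A circuit below wire `V` neither reads nor changes the value wires. This lets auxiliary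
computations be undone after a value has been written. -/
theorem runCfg_xorFrom {C : List Gate} {V : ℕ} (hC : circuitWidth C ≤ V) (v : ℕ) (s : Cfg) :
    runCfg C (xorFrom V v s) = xorFrom V v (runCfg C s) := by
  induction C generalizing s with
  | nil => rfl
  | cons g C ih =>
    rw [circuitWidth_cons, max_le_iff] at hC
    rw [runCfg_cons, flip_xorFrom hC.1, ih hC.2, runCfg_cons]

/-! ## Table lookup

The wires `0, …, l - 1` hold an index, the wires `l, …, 2 * l` are auxiliary (the first one holds
`1`, the others `0`), the wires `2 * l + 1, …, 3 * l + 1` receive the value. -/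

/-- Flip the index bits which are `0` in `i`. -/
def selectCircuit (l i : ℕ) : List Gate :=
  (List.range l).flatMap fun j => if i.testBit j then [] else [Gate.X j]

/-- Compute the conjunctions of the first index bits. -/
def ladderCircuit (l : ℕ) : List Gate :=
  (List.range l).map fun j => Gate.ccnot (l + j) j (l + j + 1)

/-- Add the bits of `v` to the value wires if the conjunction of all index bits is `1`. -/
def writeCircuit (l v : ℕ) : List Gate :=
  (List.range (l + 1)).flatMap fun j =>
    if v.testBit j then [Gate.cnot (l + l) (l + l + 1 + j)] else []

/-- Add `v` to the value wires if the index is `i`. -/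
def entryCircuit (l i v : ℕ) : List Gate :=
  (selectCircuit l i ++ ladderCircuit l) ++ writeCircuit l v ++
    (selectCircuit l i ++ ladderCircuit l).reverse

/-- Add `E i` to the value wires, where `i` is the index. -/
def tableCircuit (l N : ℕ) (E : ℕ → ℕ) : List Gate :=
  (List.range N).flatMap fun i => entryCircuit l i (E i)

/-- Prepare the uniform superposition of the pairs of an index `i` and its value `E i`. -/
def prepCircuit (l N : ℕ) (E : ℕ → ℕ) : List Gate :=
  (List.range l).map Gate.H ++ (Gate.X l :: tableCircuit l N E)

theorem runCfg_select (m i : ℕ) (s : Cfg) :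
    runCfg (selectCircuit m i) s = fun k => if k < m then s k == i.testBit k else s k := by
  unfold selectCircuit
  induction m with
  | zero => simp
  | succ m ih =>
    rw [List.range_succ, List.flatMap_append, runCfg_append, ih]
    funext k
    by_cases hb : i.testBit m
    · by_cases hk : k = m
      · subst hk; simp [hb]
      · simp [hb, show k < m + 1 ↔ k < m by omega]
    · by_cases hk : k = m
      · subst hk
        simp [hb, Gate.flip, Gate.target, Gate.ctrls]
      · simp [hb, Gate.flip, Gate.target, Gate.ctrls, Function.update_of_ne hk,
          show k < m + 1 ↔ k < m by omega]

theorem runCfg_ladder (l m : ℕ) (hm : m ≤ l) (s : Cfg) (h₀ : s l = true)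
    (h₁ : ∀ j < l, s (l + j + 1) = false) :
    runCfg ((List.range m).map fun j => Gate.ccnot (l + j) j (l + j + 1)) s (l + m) =
        decide (∀ k < m, s k = true) ∧
      (∀ k < l, runCfg ((List.range m).map fun j => Gate.ccnot (l + j) j (l + j + 1)) s k = s k) ∧
      ∀ k, l + m < k →
        runCfg ((List.range m).map fun j => Gate.ccnot (l + j) j (l + j + 1)) s k = s k := by
  induction m with
  | zero => simp [h₀]
  | succ m ih =>
    obtain ⟨i₁, i₂, i₃⟩ := ih (by omega)
    rw [List.range_succ, List.map_append, runCfg_append]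
    generalize runCfg ((List.range m).map fun j => Gate.ccnot (l + j) j (l + j + 1)) s = r at *
    have hne : ∀ k, k ≠ l + m + 1 → (Gate.ccnot (l + m) m (l + m + 1)).flip r k = r k := by
      intro k hk
      exact Gate.flip_apply_of_ne hk
    refine ⟨?_, fun k hk => ?_, fun k hk => ?_⟩
    · simp only [List.map_cons, List.map_nil, runCfg_cons, runCfg_nil]
      have h₂ := i₂ m (by omega)
      have h₃ := i₃ (l + m + 1) (by omega)
      rw [h₁ m (by omega)] at h₃
      have e : (∀ k < m + 1, s k = true) ↔ (∀ k < m, s k = true) ∧ s m = true := by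
        constructor
        · exact fun h => ⟨fun k hk => h k (by omega), h m (by omega)⟩
        · rintro ⟨h, h'⟩ k hk
          rcases Nat.lt_succ_iff_lt_or_eq.1 hk with hk | rfl
          · exact h k hk
          · exact h'
      rw [← add_assoc, flip_ccnot_target (by omega) (by omega), h₃, i₁, h₂]
      simp only [e]
      cases s m <;> simp
    · exact (hne k (by omega)).trans (i₂ k hk)
    · exact (hne k (by omega)).trans (i₃ k (by omega))

/-- There are `l + 1` value wires, so the bound on `v` ensures that no bit of it is lost. -/
theorem runCfg_write {l v : ℕ} (hv : v < 2 ^ (l + 1)) (s : Cfg) :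
    runCfg (writeCircuit l v) s = if s (l + l) = true then xorFrom (l + l + 1) v s else s := by
  have key : ∀ m, runCfg ((List.range m).flatMap fun j =>
      if v.testBit j then [Gate.cnot (l + l) (l + l + 1 + j)] else []) s = fun k =>
      s k ^^ (s (l + l) && (decide (l + l + 1 ≤ k) && (decide (k - (l + l + 1) < m) &&
        v.testBit (k - (l + l + 1))))) := by
    intro m
    induction m with
    | zero => simp
    | succ m ih =>
      rw [List.range_succ, List.flatMap_append, runCfg_append, ih]
      funext k
      by_cases hk : k = l + l + 1 + m
      · subst hk
        have h₁ : ¬ (l + l + 1 ≤ l + l) := by omega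
        have h₂ : l + l + 1 + m - (l + l + 1) = m := by omega
        have h₃ : l + l + 1 + m ≠ l + l := by omega
        by_cases hb : v.testBit m
        · cases hc : s (l + l) <;>
            simp [hb, hc, Gate.flip, Gate.target, Gate.ctrls, h₂, h₃]
        · simp [hb, h₂]
      · have h₁ : l + l + 1 ≤ k → (k - (l + l + 1) < m + 1 ↔ k - (l + l + 1) < m) := by omega
        have h₂ : (decide (l + l + 1 ≤ k) && (decide (k - (l + l + 1) < m + 1) &&
            v.testBit (k - (l + l + 1)))) = (decide (l + l + 1 ≤ k) &&
            (decide (k - (l + l + 1) < m) && v.testBit (k - (l + l + 1)))) := by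
          by_cases h : l + l + 1 ≤ k
          · simp only [h₁ h]
          · simp [h]
        rw [h₂]
        by_cases hb : v.testBit m
        · simp only [List.flatMap_cons, List.flatMap_nil, hb, if_true, List.append_nil,
            runCfg_cons, runCfg_nil]
          rw [Gate.flip]
          split_ifs
          · rw [Function.update_of_ne (by exact hk)]
          · rfl
        · simp [hb]
  rw [writeCircuit, key]
  funext k
  by_cases hk : k - (l + l + 1) < l + 1
  · cases hc : s (l + l) <;> simp [hk, xorFrom]
  · have hz : v.testBit (k - (l + l + 1)) = false :=
      Nat.testBit_lt_two_pow (hv.trans_le (Nat.pow_le_pow_right (by norm_num) (by omega)))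
    cases hc : s (l + l) <;> simp [hz, xorFrom]

theorem circuitWidth_select_ladder (l i : ℕ) :
    circuitWidth (selectCircuit l i ++ ladderCircuit l) ≤ l + l + 1 := by
  rw [circuitWidth_le_iff]
  intro g hg
  simp only [selectCircuit, ladderCircuit, List.mem_append, List.mem_flatMap, List.mem_range,
    List.mem_map] at hg
  rcases hg with ⟨j, hj, hg⟩ | ⟨j, hj, rfl⟩
  · split_ifs at hg
    · simp at hg
    · obtain rfl := List.mem_singleton.1 hg
      simp [Gate.width]; omega
  · simp [Gate.width]; omega

theorem circuitWidth_reverse (C : List Gate) : circuitWidth C.reverse = circuitWidth C := by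
  induction C with
  | nil => rfl
  | cons g C ih => simp [ih, max_comm]

/-- Compute, write, uncompute: the ladder puts the truth value of "the index is `i`" on wire `2 *
l`, it controls the writing, and the reversed circuit clears the auxiliary wires. -/
theorem runCfg_entry {l v : ℕ} (i : ℕ) (hv : v < 2 ^ (l + 1)) (s : Cfg) (h₀ : s l = true)
    (h₁ : ∀ j < l, s (l + j + 1) = false) :
    runCfg (entryCircuit l i v) s =
      if ∀ k < l, s k = i.testBit k then xorFrom (l + l + 1) v s else s := by
  have hsel := runCfg_select l i s
  have hlad := (runCfg_ladder l l le_rfl (runCfg (selectCircuit l i) s) (by simp [hsel, h₀])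
    (by intro j hj; simp [hsel, h₁ j hj]; omega)).1
  have hlad' : runCfg (selectCircuit l i ++ ladderCircuit l) s (l + l) =
      decide (∀ k < l, s k = i.testBit k) := by
    rw [runCfg_append]
    refine hlad.trans (decide_eq_decide.2 (forall₂_congr fun k hk => ?_))
    simp [hsel, hk]
  rw [entryCircuit, runCfg_append, runCfg_append (_ ++ _), runCfg_write hv, hlad']
  by_cases h : ∀ k < l, s k = i.testBit k
  · rw [if_pos (by simpa using h), if_pos h, runCfg_xorFrom
      ((circuitWidth_reverse _).trans_le (circuitWidth_select_ladder l i)), runCfg_reverse]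
  · rw [if_neg (by simpa using h), if_neg h, runCfg_reverse]

theorem eq_of_testBit_lt {l x y : ℕ} (hx : x < 2 ^ l) (hy : y < 2 ^ l)
    (h : ∀ k < l, x.testBit k = y.testBit k) : x = y := by
  refine Nat.eq_of_testBit_eq fun k => ?_
  by_cases hk : k < l
  · exact h k hk
  · have hle : 2 ^ l ≤ 2 ^ k := Nat.pow_le_pow_right (by norm_num) (by omega)
    rw [Nat.testBit_lt_two_pow (hx.trans_le hle), Nat.testBit_lt_two_pow (hy.trans_le hle)]

theorem runCfg_table {l x : ℕ} (hx : x < 2 ^ l) (E : ℕ → ℕ) (hE : ∀ i < 2 ^ l, E i < 2 ^ (l + 1))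
    (s : Cfg) (h₀ : s l = true) (h₁ : ∀ j < l, s (l + j + 1) = false)
    (hs : ∀ k < l, s k = x.testBit k) :
    runCfg (tableCircuit l (2 ^ l) E) s = xorFrom (l + l + 1) (E x) s := by
  have key : ∀ m ≤ 2 ^ l, runCfg (tableCircuit l m E) s =
      if x < m then xorFrom (l + l + 1) (E x) s else s := by
    intro m
    induction m with
    | zero => intro _; rfl
    | succ m ih =>
      intro hm
      have e : tableCircuit l (m + 1) E = tableCircuit l m E ++ entryCircuit l m (E m) := by
        simp [tableCircuit, List.range_succ]
      rw [e, runCfg_append, ih (by omega)]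
      -- Earlier entries have changed only value wires, so index and auxiliary wires are ready for
      -- the next entry.
      have hlow : ∀ k < l + l + 1, (if x < m then xorFrom (l + l + 1) (E x) s else s) k = s k := by
        intro k hk
        split_ifs
        · exact xorFrom_of_lt hk s
        · rfl
      rw [runCfg_entry m (hE m (by omega)) _ (by rw [hlow _ (by omega), h₀])
        (by intro j hj; rw [hlow _ (by omega), h₁ j hj])]
      have hiff : (∀ k < l, (if x < m then xorFrom (l + l + 1) (E x) s else s) k = m.testBit k) ↔
          x = m := by
        constructor
        · intro h
          refine eq_of_testBit_lt hx (by omega) fun k hk => ?_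
          rw [← h k hk, hlow k (by omega), hs k hk]
        · rintro rfl k hk
          rw [hlow k (by omega), hs k hk]
      simp only [hiff]
      by_cases hxm : x = m
      · subst hxm; simp
      · simp [hxm, show x < m + 1 ↔ x < m by omega]
  rw [key _ le_rfl, if_pos hx]

/-! ## Hadamard gates -/

theorem hadamard_false_right (a : Bool) : hadamard a false = 1 / (√2 : ℂ) := by
  cases a <;> simp [hadamard]

theorem hadamard_false_left (a : Bool) : hadamard false a = 1 / (√2 : ℂ) := by
  cases a <;> simp [hadamard]

theorem act_H (t : ℕ) (ψ : Amp) (s : Cfg) :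
    (Gate.H t).act ψ s = ∑ b : Bool, hadamard (s t) b * ψ (Function.update s t b) := by
  simp [Gate.act, Gate.target, Gate.ctrls, Gate.mat]

theorem runAmp_hadamards (m : ℕ) (s : Cfg) :
    runAmp ((List.range m).map Gate.H) zeroAmp s =
      open Classical in if ∀ k, m ≤ k → s k = false then (1 / (√2 : ℂ)) ^ m else 0 := by
  induction m generalizing s with
  | zero =>
    by_cases h : ∀ k, s k = false
    · rw [if_pos fun k _ => h k]
      exact zeroAmp_of_forall h
    · rw [if_neg fun h' => h fun k => h' k (Nat.zero_le k)]
      exact if_neg h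
  | succ m ih =>
    rw [List.range_succ, List.map_append, runAmp_append, List.map_singleton, runAmp_cons,
      runAmp_nil, act_H, Fintype.sum_bool, ih, ih, if_neg, mul_zero, zero_add,
      hadamard_false_right]
    · have hiff : (∀ k, m ≤ k → Function.update s m false k = false) ↔
          ∀ k, m + 1 ≤ k → s k = false := by
        constructor
        · intro h k hk
          have := h k (by omega)
          rwa [Function.update_of_ne (by omega)] at this
        · intro h k hk
          by_cases hkm : k = m
          · subst hkm; simp
          · rw [Function.update_of_ne hkm, h k (by omega)]
      by_cases h : ∀ k, m + 1 ≤ k → s k = false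
      · rw [if_pos (hiff.2 h), if_pos h, pow_succ']
      · rw [if_neg (fun h' => h (hiff.1 h')), if_neg h, mul_zero]
    · intro h
      simpa using h m le_rfl

/-- Replace the first `m` bits by those of `x`. -/
def setBits (m x : ℕ) (s : Cfg) : Cfg := fun k => if k < m then x.testBit k else s k

/-- All entries in the zero row of a tensor power of the Hadamard matrix are equal, so amplitudes at
a zero index are normalised sums over all indices. -/
theorem runAmp_hadamards_reverse (m : ℕ) (φ : Amp) (s : Cfg) (hs : ∀ k < m, s k = false) :
    runAmp ((List.range m).map Gate.H).reverse φ s =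
      (1 / (√2 : ℂ)) ^ m * ∑ x ∈ Finset.range (2 ^ m), φ (setBits m x s) := by
  induction m generalizing φ with
  | zero =>
    have : setBits 0 0 s = s := by funext k; simp [setBits]
    simp [this]
  | succ m ih =>
    rw [List.range_succ, List.map_append, List.reverse_append, List.map_singleton,
      List.reverse_singleton, List.singleton_append, runAmp_cons, ih _ fun k hk => hs k (by omega)]
    have h₁ : ∀ x ∈ Finset.range (2 ^ m), (Gate.H m).act φ (setBits m x s) =
        1 / (√2 : ℂ) * (φ (setBits (m + 1) x s) + φ (setBits (m + 1) (2 ^ m + x) s)) := by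
      intro x hx
      have hx := Finset.mem_range.1 hx
      have e₀ : setBits m x s m = false := by simp [setBits, hs]
      have e₁ : Function.update (setBits m x s) m false = setBits (m + 1) x s := by
        funext k
        by_cases hk : k = m
        · subst hk; simp [setBits, Nat.testBit_lt_two_pow hx]
        · rw [Function.update_of_ne hk]
          simp [setBits, show k < m + 1 ↔ k < m by omega]
      have e₂ : Function.update (setBits m x s) m true = setBits (m + 1) (2 ^ m + x) s := by
        funext k
        by_cases hk : k = m
        · subst hk; simp [setBits, Nat.testBit_two_pow_add_eq, Nat.testBit_lt_two_pow hx]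
        · rw [Function.update_of_ne hk]
          simp only [setBits, show k < m + 1 ↔ k < m by omega]
          split_ifs with h
          · rw [Nat.testBit_two_pow_add_gt h]
          · rfl
      rw [act_H, Fintype.sum_bool, e₀, hadamard_false_left, hadamard_false_left, e₁, e₂]
      ring
    rw [Finset.sum_congr rfl h₁, ← Finset.mul_sum, Finset.sum_add_distrib, pow_succ 2 m, mul_two,
      Finset.sum_range_add, pow_succ]
    ring

theorem inv_sqrt_two_pow_mul (m : ℕ) :
    (1 / (√2 : ℂ)) ^ m * (1 / (√2 : ℂ)) ^ m = 1 / 2 ^ m := by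
  rw [← mul_pow, div_mul_div_comm, ← Complex.ofReal_mul, Real.mul_self_sqrt (by norm_num)]
  simp

/-! ## Overlap of two table states -/

theorem mat_table (l N : ℕ) (E : ℕ → ℕ) : ∀ g ∈ tableCircuit l N E, g.mat = pauliX := by
  have h₁ : ∀ i, ∀ g ∈ selectCircuit l i ++ ladderCircuit l, g.mat = pauliX := by
    intro i g hg
    simp only [selectCircuit, ladderCircuit, List.mem_append, List.mem_flatMap, List.mem_map] at hg
    rcases hg with ⟨j, -, hg⟩ | ⟨j, -, rfl⟩
    · split_ifs at hg
      · simp at hg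
      · obtain rfl := List.mem_singleton.1 hg
        rfl
    · rfl
  intro g hg
  simp only [tableCircuit, List.mem_flatMap, entryCircuit, List.mem_append (s := _ ++ _),
    List.mem_reverse] at hg
  obtain ⟨i, -, (hg | hg) | hg⟩ := hg
  · exact h₁ i g hg
  · simp only [writeCircuit, List.mem_flatMap] at hg
    obtain ⟨j, -, hg⟩ := hg
    split_ifs at hg
    · obtain rfl := List.mem_singleton.1 hg
      rfl
    · simp at hg
  · exact h₁ i g hg

theorem circuitWidth_prep (l N : ℕ) (E : ℕ → ℕ) :
    circuitWidth (prepCircuit l N E) ≤ 3 * l + 2 := by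
  rw [circuitWidth_le_iff]
  intro g hg
  have h₁ : ∀ i, ∀ g ∈ selectCircuit l i ++ ladderCircuit l, g.width ≤ 3 * l + 2 := fun i g hg =>
    ((circuitWidth_le_iff _ _).1 (circuitWidth_select_ladder l i) g hg).trans (by omega)
  simp only [prepCircuit, List.mem_append (t := _ :: _), List.mem_cons, tableCircuit,
    List.mem_flatMap, entryCircuit, List.mem_append (s := _ ++ _), List.mem_reverse, List.mem_map,
    List.mem_range] at hg
  rcases hg with ⟨j, hj, rfl⟩ | rfl | ⟨i, -, (hg | hg) | hg⟩
  · simp [Gate.width]; omega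
  · simp [Gate.width]; omega
  · exact h₁ i g hg
  · simp only [writeCircuit, List.mem_flatMap, List.mem_range] at hg
    obtain ⟨j, hj, hg⟩ := hg
    split_ifs at hg
    · obtain rfl := List.mem_singleton.1 hg
      simp [Gate.width]; omega
    · simp at hg
  · exact h₁ i g hg

/-- The all-zero amplitude after preparing `E` and unpreparing `E'` is the inner product of the two
table states. The final Hadamard gates turn it into a sum over `x`. The table lookups only permute
configurations, so the term of `x` survives exactly when the two lookups cancel on the value wires.
-/
theorem overlap_prep (l : ℕ) (E E' : ℕ → ℕ) (hE : ∀ i < 2 ^ l, E i < 2 ^ (l + 1))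
    (hE' : ∀ i < 2 ^ l, E' i < 2 ^ (l + 1)) :
    runAmp (prepCircuit l (2 ^ l) E ++ (prepCircuit l (2 ^ l) E').reverse) zeroAmp
        (fun _ => false) =
      (((Finset.range (2 ^ l)).filter fun x => E x = E' x).card : ℂ) / 2 ^ l := by
  have e : prepCircuit l (2 ^ l) E ++ (prepCircuit l (2 ^ l) E').reverse =
      (List.range l).map Gate.H ++ ((Gate.X l :: tableCircuit l (2 ^ l) E) ++
        (Gate.X l :: tableCircuit l (2 ^ l) E').reverse) ++ ((List.range l).map Gate.H).reverse := by
    simp [prepCircuit]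
  rw [e, runAmp_append, runAmp_append, runAmp_hadamards_reverse _ _ _ fun _ _ => rfl]
  have hmat : ∀ E, ∀ g ∈ Gate.X l :: tableCircuit l (2 ^ l) E, g.mat = pauliX := by
    intro E g hg
    rcases List.mem_cons.1 hg with rfl | hg
    · rfl
    · exact mat_table _ _ _ g hg
  have hval : ∀ x ∈ Finset.range (2 ^ l),
      runAmp ((Gate.X l :: tableCircuit l (2 ^ l) E) ++
        (Gate.X l :: tableCircuit l (2 ^ l) E').reverse)
        (runAmp ((List.range l).map Gate.H) zeroAmp) (setBits l x fun _ => false) =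
      if E x = E' x then (1 / (√2 : ℂ)) ^ l else 0 := by
    intro x hx
    have hx := Finset.mem_range.1 hx
    rw [runAmp_eq_runCfg]
    swap
    · intro g hg
      rcases List.mem_append.1 hg with hg | hg
      · exact hmat E g hg
      · exact hmat E' g (List.mem_reverse.1 hg)
    rw [List.reverse_append, List.reverse_reverse, runCfg_append]
    set b : Cfg := (Gate.X l).flip (setBits l x fun _ => false) with hb
    have hbk : ∀ k, b k = if k < l then x.testBit k else decide (k = l) := by
      intro k
      rw [hb, flip_X]
      by_cases hk : k = l
      · subst hk; simp [setBits]
      · simp [setBits, hk]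
    have h₀ : b l = true := by simp [hbk]
    have h₁ : ∀ j < l, b (l + j + 1) = false := by
      intro j hj
      rw [hbk, if_neg (by omega)]
      simp; omega
    have h₂ : ∀ k < l, b k = x.testBit k := fun k hk => by rw [hbk, if_pos hk]
    rw [runCfg_cons, ← hb, runCfg_table hx E' hE' b h₀ h₁ h₂]
    set d := xorFrom (l + l + 1) (E' x) b with hd
    have hd' : ∀ k < l + l + 1, d k = b k := fun k hk => xorFrom_of_lt hk b
    -- At a fixed index the lookup adds a fixed string modulo 2, hence its inverse acts in the same
    -- way.
    have hinv : runCfg (tableCircuit l (2 ^ l) E).reverse d = xorFrom (l + l + 1) (E x) d := by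
      have h := runCfg_table hx E hE (xorFrom (l + l + 1) (E x) d)
        (by rw [xorFrom_of_lt (by omega), hd' _ (by omega), h₀])
        (by intro j hj; rw [xorFrom_of_lt (by omega), hd' _ (by omega), h₁ j hj])
        (by intro k hk; rw [xorFrom_of_lt (by omega), hd' _ (by omega), h₂ k hk])
      rw [xorFrom_xorFrom] at h
      rw [← runCfg_reverse (tableCircuit l (2 ^ l) E) (xorFrom (l + l + 1) (E x) d), h]
    rw [List.reverse_cons, runCfg_append, hinv, runAmp_hadamards, runCfg_cons, runCfg_nil]
    have hfin : ∀ k, l ≤ k → (Gate.X l).flip (xorFrom (l + l + 1) (E x) d) k =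
        (decide (l + l + 1 ≤ k) && ((E' x).testBit (k - (l + l + 1)) ^^
          (E x).testBit (k - (l + l + 1)))) := by
      intro k hk
      rw [flip_X]
      by_cases hkl : k = l
      · subst hkl
        rw [Function.update_self, xorFrom_of_lt (by omega), hd' _ (by omega), h₀]
        simp
      · rw [Function.update_of_ne hkl]
        simp only [xorFrom, hd, hbk, if_neg (show ¬ k < l by omega), hkl, decide_false]
        cases decide (l + l + 1 ≤ k) <;> simp
    have hiff : (∀ k, l ≤ k → (Gate.X l).flip (xorFrom (l + l + 1) (E x) d) k = false) ↔
        E x = E' x := by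
      constructor
      · intro h
        refine Nat.eq_of_testBit_eq fun k => ?_
        have h₃ := h (k + (l + l + 1)) (by omega)
        rw [hfin _ (by omega)] at h₃
        simp only [le_add_iff_nonneg_left, zero_le, decide_true, Bool.true_and,
          Nat.add_sub_cancel] at h₃
        revert h₃
        cases (E x).testBit k <;> cases (E' x).testBit k <;> simp
      · intro h k hk
        rw [hfin k hk, h]
        simp
    by_cases h : E x = E' x
    · rw [if_pos (hiff.2 h), if_pos h]
    · rw [if_neg (fun h' => h (hiff.1 h')), if_neg h]
  rw [Finset.sum_congr rfl hval, ← Finset.sum_filter, Finset.sum_const, nsmul_eq_mul]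
  -- One factor `2^(-l/2)` comes from each of the two layers of Hadamard gates.
  rw [mul_comm, mul_assoc, inv_sqrt_two_pow_mul, mul_one_div]

/-! ## Reed–Solomon codes -/

/-- Evaluation modulo `p` at `i` of the monic polynomial with coefficients `y`. -/
def rsEval (p i : ℕ) (y : List Bool) : ℕ := y.foldl (fun acc b => (acc * i + b.toNat) % p) 1

open Polynomial in
/-- The monic polynomial with the coefficients `y`, leading coefficients first. -/
noncomputable def rsPoly (p : ℕ) (y : List Bool) : (ZMod p)[X] :=
  y.foldl (fun acc b => X * acc + C (b.toNat : ZMod p)) 1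

theorem rsPoly_concat (p : ℕ) (y : List Bool) (b : Bool) :
    rsPoly p (y ++ [b]) = Polynomial.X * rsPoly p y + Polynomial.C (b.toNat : ZMod p) := by
  simp [rsPoly]

theorem rsEval_cast (p i : ℕ) (y : List Bool) :
    (rsEval p i y : ZMod p) = (rsPoly p y).eval (i : ZMod p) := by
  induction y using List.reverseRecOn with
  | nil => simp [rsEval, rsPoly]
  | append_singleton y b ih =>
    have : rsEval p i (y ++ [b]) = (rsEval p i y * i + b.toNat) % p := by simp [rsEval]
    rw [this, rsPoly_concat, ZMod.natCast_mod]
    push_cast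
    rw [ih]
    simp [mul_comm]

theorem rsEval_lt {p : ℕ} (hp : 1 < p) (i : ℕ) (y : List Bool) : rsEval p i y < p := by
  induction y using List.reverseRecOn with
  | nil => simpa [rsEval] using hp
  | append_singleton y b ih =>
    have : rsEval p i (y ++ [b]) = (rsEval p i y * i + b.toNat) % p := by simp [rsEval]
    rw [this]
    exact Nat.mod_lt _ (by omega)

theorem rsPoly_monic (p : ℕ) [Fact p.Prime] (y : List Bool) :
    (rsPoly p y).Monic ∧ (rsPoly p y).natDegree = y.length := by
  induction y using List.reverseRecOn with
  | nil => simp [rsPoly]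
  | append_singleton y b ih =>
    rw [rsPoly_concat, mul_comm]
    have hm : (rsPoly p y * Polynomial.X).Monic := ih.1.mul Polynomial.monic_X
    have hd : (rsPoly p y * Polynomial.X).natDegree = y.length + 1 := by
      rw [Polynomial.natDegree_mul_X ih.1.ne_zero, ih.2]
    have hlt : (Polynomial.C (b.toNat : ZMod p)).degree < (rsPoly p y * Polynomial.X).degree := by
      rw [Polynomial.degree_eq_natDegree hm.ne_zero, hd]
      exact Polynomial.degree_C_le.trans_lt (by exact_mod_cast Nat.succ_pos _)
    refine ⟨hm.add_of_left hlt, ?_⟩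
    rw [Polynomial.natDegree_add_C, hd]
    simp

/-- The leading coefficient `1` records the length, so strings that differ only in leading zeros are
separated. The last bit is the value at `0`, and `0 ≠ 1` modulo `p`. -/
theorem rsPoly_injective (p : ℕ) [hp : Fact p.Prime] : Function.Injective (rsPoly p) := by
  intro y
  induction y using List.reverseRecOn with
  | nil =>
    intro y' h
    have h₂ := congrArg Polynomial.natDegree h
    rw [(rsPoly_monic p _).2, (rsPoly_monic p _).2] at h₂
    exact (List.length_eq_zero_iff.1 h₂.symm).symm
  | append_singleton y b ih =>
    intro y' h
    rcases List.eq_nil_or_concat y' with rfl | ⟨z, c, rfl⟩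
    · have h₂ := congrArg Polynomial.natDegree h
      rw [(rsPoly_monic p _).2, (rsPoly_monic p _).2] at h₂
      simp at h₂
    · rw [List.concat_eq_append, rsPoly_concat, rsPoly_concat] at h
      have h₀ := congrArg (Polynomial.eval 0) h
      simp only [Polynomial.eval_add, Polynomial.eval_mul, Polynomial.eval_X, zero_mul,
        Polynomial.eval_C, zero_add] at h₀
      have hbc : b = c := by
        cases b <;> cases c <;> simp at h₀ ⊢
      subst hbc
      have h₁ := ih (mul_left_cancel₀ Polynomial.X_ne_zero (add_right_cancel h))
      rw [List.concat_eq_append, h₁]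

/-- Agreement points are roots of a nonzero polynomial of degree at most `L`. The points below `N ≤
p` are distinct modulo `p`. -/
theorem rs_agreement {p N L : ℕ} (hp : p.Prime) (hN : N ≤ p) {y y' : List Bool} (hne : y ≠ y')
    (hy : y.length ≤ L) (hy' : y'.length ≤ L) :
    ((Finset.range N).filter fun x => rsEval p x y = rsEval p x y').card ≤ L := by
  have := Fact.mk hp
  have hd : rsPoly p y - rsPoly p y' ≠ 0 := sub_ne_zero.2 fun h => hne (rsPoly_injective p h)
  have hcard : (rsPoly p y - rsPoly p y').roots.toFinset.card ≤ L := by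
    refine (Multiset.toFinset_card_le _).trans ((Polynomial.card_roots' _).trans ?_)
    refine (Polynomial.natDegree_sub_le _ _).trans ?_
    rw [(rsPoly_monic p y).2, (rsPoly_monic p y').2]
    exact max_le hy hy'
  refine le_trans (Finset.card_le_card_of_injOn (fun x : ℕ => (x : ZMod p)) ?_ ?_) hcard
  · intro x hx
    simp only [Finset.mem_coe, Finset.mem_filter, Finset.mem_range] at hx
    simp only [Finset.mem_coe, Multiset.mem_toFinset, Polynomial.mem_roots hd, Polynomial.IsRoot,
      Polynomial.eval_sub, ← rsEval_cast, hx.2, sub_self]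
  · intro x hx x' hx' h
    simp only [Finset.mem_coe, Finset.mem_filter, Finset.mem_range] at hx hx'
    have h₂ := (ZMod.natCast_eq_natCast_iff' x x' p).1 h
    rwa [Nat.mod_eq_of_lt (by omega), Nat.mod_eq_of_lt (by omega)] at h₂

end QCrypto

namespace QCrypto
open Enc (enc size)

/-! ## The state generator -/

/-- Number of index qubits for keys of length `n`. -/
def idxBits (D c n : ℕ) : ℕ := D * n.size + c

/-- The number of evaluation points is polynomial in `n`: its degree `D` is chosen to match the
length of the values of `f`, and the factor `2 ^ c` to make the error small. -/
theorem two_pow_idxBits (D c n : ℕ) : 2 ^ idxBits D c n = (2 ^ n.size) ^ D * 2 ^ c := by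
  rw [idxBits, pow_add, mul_comm D, pow_mul]

/-- The largest prime number between `N` and `2 * N`. -/
def primeAbove (N : ℕ) : ℕ := natLoop N 2 fun i r => if (N + i + 1).Prime then N + i + 1 else r

theorem primeAbove_spec {N : ℕ} (hN : N ≠ 0) :
    (primeAbove N).Prime ∧ N < primeAbove N ∧ primeAbove N ≤ 2 * N := by
  have key : ∀ m, (∃ i < m, (N + i + 1).Prime) →
      (natLoop m 2 fun i r => if (N + i + 1).Prime then N + i + 1 else r).Prime ∧
      N < (natLoop m 2 fun i r => if (N + i + 1).Prime then N + i + 1 else r) ∧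
      (natLoop m 2 fun i r => if (N + i + 1).Prime then N + i + 1 else r) ≤ N + m := by
    intro m
    induction m with
    | zero => rintro ⟨i, hi, -⟩; omega
    | succ m ih =>
      rintro ⟨i, hi, hp⟩
      rw [natLoop_succ]
      split_ifs with h
      · exact ⟨h, by omega, by omega⟩
      · have him : i ≠ m := by rintro rfl; exact h hp
        obtain ⟨h₁, h₂, h₃⟩ := ih ⟨i, by omega, hp⟩
        exact ⟨h₁, h₂, by omega⟩
  -- Bertrand's postulate ensures that the default value `2` of the search is replaced.
  obtain ⟨p, hp, hlt, hle⟩ := Nat.exists_prime_lt_and_le_two_mul N hN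
  have h := key N ⟨p - N - 1, by omega, by rwa [show N + (p - N - 1) + 1 = p by omega]⟩
  rwa [← two_mul] at h

theorem primeAbove_le (N m : ℕ) :
    (natLoop m 2 fun i r => if (N + i + 1).Prime then N + i + 1 else r) ≤ N + m + 2 := by
  induction m with
  | zero => simp
  | succ m ih =>
    rw [natLoop_succ]
    split_ifs <;> omega

/-- Circuit for the fingerprint of the string `y`, for security parameter `n`. -/
def fingerprint (D c n : ℕ) (y : List Bool) : List Gate :=
  prepCircuit (idxBits D c n) (2 ^ idxBits D c n)
    fun i => rsEval (primeAbove (2 ^ idxBits D c n)) i y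

/-- The modulus is at most twice the number of points, so one value wire more than index wires
suffices. -/
theorem fingerprint_value_lt (D c n : ℕ) (y : List Bool) (i : ℕ) :
    rsEval (primeAbove (2 ^ idxBits D c n)) i y < 2 ^ (idxBits D c n + 1) := by
  obtain ⟨h₁, -, h₂⟩ := primeAbove_spec (N := 2 ^ idxBits D c n) (by positivity)
  rw [pow_succ']
  exact (rsEval_lt h₁.one_lt _ _).trans_le h₂

/-- Length of the keys. -/
def keyLen (K n : ℕ) : ℕ := n.size ^ K

/-! ### The fingerprint circuit is computable in polynomial time -/

namespace FP

variable {α β : Type} [Enc α] [Enc β]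

@[fun_prop] theorem idxBits {n : α → ℕ} (hn : FP n) (D c : ℕ) :
    FP fun a => idxBits D c (n a) := by
  unfold QCrypto.idxBits
  fun_prop

@[fun_prop] theorem two_pow_idxBits {n : α → ℕ} (hn : FP n) (D c : ℕ) :
    FP fun a => 2 ^ QCrypto.idxBits D c (n a) := by
  simp only [QCrypto.two_pow_idxBits]
  fun_prop

@[fun_prop] theorem primeAbove {N : α → ℕ} (hN : FP N) : FP fun a => primeAbove (N a) :=
  natLoop (step := fun a i r => if (N a + i + 1).Prime then N a + i + 1 else r) hN (.const 2)
    (by fun_prop) ((hN.size_bd.add hN.size_bd).add (.const 2)) (by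
      intro a i hi
      have := primeAbove_le (N a) i
      simp only [size_nat]
      omega)

@[fun_prop] theorem toNat {b : α → Bool} (hb : FP b) : FP fun a => (b a).toNat := by
  have h : FP fun a => bif b a then 1 else 0 := by fun_prop
  exact h.of_eq fun a => by cases b a <;> rfl

theorem rsEval {p i : α → ℕ} {y : α → List Bool} (hp : FP p) (hi : FP i) (hy : FP y)
    (h₀ : ∀ a, 0 < p a) : FP fun a => rsEval (p a) (i a) (y a) :=
  foldl (step := fun a acc b => (acc * i a + b.toNat) % p a) (init := fun _ => 1) hy (.const 1)
    -- Reduction modulo `p` after each step keeps the accumulator below `p`; the extra `1` accounts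
    -- for its initial value.
    (by fun_prop) (hp.size_bd.add (.const 1)) (by
      intro a l₁ l₂ h
      rcases List.eq_nil_or_concat l₁ with rfl | ⟨l, b, rfl⟩
      · simp
      · rw [List.concat_eq_append, List.foldl_append]
        have := Nat.mod_lt ((l.foldl (fun acc b => (acc * i a + b.toNat) % p a) 1) * i a + b.toNat)
          (h₀ a)
        simp only [List.foldl_cons, List.foldl_nil, size_nat]
        omega)

@[fun_prop] theorem prepCircuit {l N : α → ℕ} {E : α → ℕ → ℕ} (hl : FP l) (hN : FP N)
    (hE : FP fun x : α × ℕ => E x.1 x.2) : FP fun a => prepCircuit (l a) (N a) (E a) := by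
  have hsel : FP fun x : α × ℕ => selectCircuit (l x.1) x.2 := by
    have h : FP fun x : α × ℕ => (List.range (l x.1)).flatMap fun j =>
        bif x.2.testBit j then [] else [Gate.X j] := by fun_prop
    exact h.of_eq fun x => by simp [selectCircuit, Bool.cond_eq_ite]
  have hlad : FP fun x : α × ℕ => ladderCircuit (l x.1) := by
    unfold ladderCircuit
    fun_prop
  have hwr : FP fun x : α × ℕ => writeCircuit (l x.1) (E x.1 x.2) := by
    have h : FP fun x : α × ℕ => (List.range (l x.1 + 1)).flatMap fun j =>
        bif (E x.1 x.2).testBit j then [Gate.cnot (l x.1 + l x.1) (l x.1 + l x.1 + 1 + j)]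
        else [] := by
      have h₂ : FP fun y : (α × ℕ) × ℕ => E y.1.1 y.1.2 :=
        hE.comp (f := fun y : (α × ℕ) × ℕ => y.1) (by fun_prop)
      fun_prop
    exact h.of_eq fun x => by simp [writeCircuit, Bool.cond_eq_ite]
  unfold QCrypto.prepCircuit tableCircuit entryCircuit
  fun_prop

@[fun_prop] theorem fingerprint {n : α → ℕ} {y : α → List Bool} (hn : FP n) (hy : FP y)
    (D c : ℕ) : FP fun a => fingerprint D c (n a) (y a) := by
  have h : FP fun x : α × ℕ => QCrypto.rsEval
      (QCrypto.primeAbove (2 ^ QCrypto.idxBits D c (n x.1))) x.2 (y x.1) :=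
    rsEval (by fun_prop) (by fun_prop) (by fun_prop) fun x =>
      (primeAbove_spec (by positivity)).1.pos
  unfold QCrypto.fingerprint
  fun_prop

@[fun_prop] theorem keyLen {n : α → ℕ} (hn : FP n) (K : ℕ) : FP fun a => keyLen K (n a) := by
  unfold QCrypto.keyLen
  fun_prop

@[fun_prop] theorem listAll {l : α → List Bool} (hl : FP l) :
    FP fun a => decide (∀ i < (l a).length, (l a).getD i false = false) := by
  have h : FP fun a => decide (∀ i < (l a).length, (!(l a).getD i false) = true) := by fun_prop
  simpa using h

end FP

/-! ## Algorithms from computable functions -/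

theorem FP.exists_output {α : Type} [Enc α] {f : α → List Bool} (hf : FP f) :
    ∃ (p : Prog) (τ : α → ℕ), PolyBd size τ ∧ (∀ a, ∃ t ≤ τ a, p.HaltsIn (enc a) t) ∧
      ∀ a, p.output (enc a) 0 = f a := by
  obtain ⟨p, τ, hτ, hp⟩ := hf.exists_prog
  refine ⟨p, τ, hτ, fun a => ?_, fun a => ?_⟩
  · obtain ⟨t, ht, h⟩ := hp a
    exact ⟨t, ht, _, h⟩
  · obtain ⟨t, ht, h⟩ := hp a
    rw [p.output_eq h]
    rfl

theorem wires_le {A : QAlg} {xs : List (List Bool)} {q : ℕ} {C : List Gate}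
    (h : A.gen.output (xs ++ [unary q]) 0 = encGates C) : A.wires xs q ≤ q + (encGates C).length := by
  have h₁ : A.circuit xs q = C := by rw [QAlg.circuit, h, decodeCircuit_encGates]
  have h₂ := circuitWidth_le C
  rw [QAlg.wires, h₁]
  omega

/-- Turns a pair of computable functions into a quantum algorithm. The measurement outcome is no
longer than the input register plus the circuit description, so the postprocessing stays polynomial
too. -/
theorem exists_qalg {g : List Bool × ℕ → List Gate} {h : List Bool × ℕ × List Bool → List Bool}
    (hg : FP g) (hh : FP h) : ∃ A : QAlg, A.IsQPT 1 ∧ (∀ x q, A.circuit [x] q = g (x, q)) ∧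
      ∀ x q z, A.post.output [x, unary q, z] 0 = h (x, q, z) := by
  obtain ⟨p, τ, hτ, hp, hp'⟩ := FP.exists_output (f := fun a => encGates (g a)) (by fun_prop)
  obtain ⟨r, σ, ⟨P, hP⟩, hr, hr'⟩ := hh.exists_output
  have hc : ∀ x q, (⟨p, r⟩ : QAlg).circuit [x] q = g (x, q) := by
    intro x q
    exact (congrArg decodeCircuit (hp' (x, q))).trans (decodeCircuit_encGates _)
  refine ⟨⟨p, r⟩, ?_, hc, fun x q z => hr' (x, q, z)⟩
  obtain ⟨Q, hQ⟩ := hτ.add ((PolyBd.self.add hg.size_bd).add PolyBd.self |>.polyEval P)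
  refine ⟨Q, fun xs hxs q => ?_⟩
  obtain ⟨x, rfl⟩ := List.length_eq_one_iff.1 hxs
  obtain ⟨t, ht, hhalt⟩ := hp (x, q)
  refine ⟨t, hhalt, fun z => ?_⟩
  obtain ⟨t', ht', hhalt'⟩ := hr (x, q, List.ofFn z)
  refine ⟨t', hhalt', le_trans (add_le_add ht (ht'.trans ((hP _).trans (polynomial_eval_mono P
    ?_)))) ((hQ (x, q)).trans_eq (by simp))⟩
  have hw := wires_le (A := ⟨p, r⟩) (xs := [x]) (q := q) (C := g (x, q)) (hp' (x, q))
  have hl : (List.ofFn z).length = QAlg.wires ⟨p, r⟩ [x] q := by simp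
  simp only [size_prod, size_nat, size_gates, size_list, hl]
  omega

theorem traceOutLast_pureState {m a : ℕ} {ψ : Amp} (h : Supp m ψ) :
    traceOutLast (pureState (m + a) ψ) = pureState m ψ := by
  have h₀ : ∀ s : Basis m, ext (Fin.append s fun _ : Fin a => false) = ext s := by
    intro s
    funext i
    by_cases hi : i < m
    · rw [ext_of_lt _ (by omega), ext_of_lt _ hi]
      exact Fin.append_left s _ ⟨i, hi⟩
    · rw [ext_of_le s (by omega)]
      by_cases hi' : i < m + a
      · rw [ext_of_lt _ hi']
        have := Fin.append_right s (fun _ : Fin a => false) ⟨i - m, by omega⟩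
        refine Eq.trans (congrArg (Fin.append s fun _ : Fin a => false) (Fin.ext ?_)) this
        change i = m + (i - m)
        omega
      · rw [ext_of_le _ (by omega)]
  funext s s'
  simp only [traceOutLast, Matrix.of_apply, pureState_apply]
  rw [Finset.sum_eq_single fun _ => false]
  · rw [h₀, h₀]
  · intro e _ he
    have : ∃ j, e j = true := by
      by_contra hcon
      push Not at hcon
      exact he (funext fun j => by simpa using hcon j)
    obtain ⟨j, hj⟩ := this
    rw [h (ext (Fin.append s e)) ⟨m + j, by omega, ?_⟩, zero_mul]
    rw [ext_of_lt _ (by omega)]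
    exact (Fin.append_right s e j).trans hj
  · simp

/-- When every wire of the circuit is an output wire, nothing entangled is traced out and the state
stays pure. -/
theorem state_eq_pureState {G : QStateAlg} {k : List Bool}
    (h : circuitWidth (G.circuit k) ≤ G.numQubits k) :
    G.state k = pureState (G.numQubits k) (runAmp (G.circuit k) zeroAmp) := by
  rw [QStateAlg.state, zeroState_eq, circuitOp_conj _ (by omega),
    traceOutLast_pureState ((supp_zeroAmp _).runAmp h)]

theorem circuitWidth_hadamards (n : ℕ) : circuitWidth ((List.range n).map Gate.H) = n := by
  induction n with
  | zero => rfl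
  | succ n ih =>
    rw [List.range_succ, List.map_append, circuitWidth_append, ih]
    simp [Gate.width]

/-- Measuring a layer of Hadamard gates yields a uniformly random string; this is the key generator.
-/
theorem meas_hadamards (n : ℕ) (G : Cfg → ℝ) :
    meas n (runAmp ((List.range n).map Gate.H) zeroAmp) G = (∑ x : Basis n, G (ext x)) / 2 ^ n := by
  unfold meas
  rw [Finset.sum_div]
  refine Finset.sum_congr rfl fun x _ => ?_
  have h : ∀ k, n ≤ k → ext x k = false := fun k hk => ext_of_le _ hk
  rw [runAmp_hadamards, if_pos h, norm_pow, ← pow_mul, mul_comm n 2, pow_mul]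
  have : ‖1 / (√2 : ℂ)‖ ^ 2 = 1 / 2 := by
    rw [norm_div, Complex.norm_real, div_pow, Real.norm_eq_abs, sq_abs, Real.sq_sqrt (by norm_num)]
    simp
  rw [this, one_div, inv_pow]
  ring

/-- The properties of the scheme built from `f`. -/
structure StateGenScheme.IsFingerprintScheme (S : StateGenScheme) (f : List Bool → List Bool)
    (K D c : ℕ) : Prop where
  keyGen_qpt : S.keyGen.IsQPT 1
  stateGen_qpt : S.stateGen.IsQPT
  ver_qpt : S.ver.IsQPT 1
  keyGen_expect : ∀ (n : ℕ) (g : List Bool → ℝ), S.keyGen.expect [unary n] noQubits g =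
    (∑ x : Basis (keyLen K n), g (List.ofFn x)) / 2 ^ keyLen K n
  numQubits_eq : ∀ k, S.stateGen.numQubits k = 3 * idxBits D c k.length + 2
  circuit_eq : ∀ k, S.stateGen.circuit k = fingerprint D c k.length (f k)
  ver_circuit : ∀ k q, S.ver.circuit [k] q = (fingerprint D c k.length (f k)).reverse
  ver_output : ∀ k q z, S.ver.post.output [k, unary q, z] 0 =
    if 3 * idxBits D c k.length + 2 = q then
      (if ∀ i < z.length, z.getD i false = false then [true] else []) else []

theorem exists_fingerprintScheme {f : List Bool → List Bool} (hf : FP f) (K D c : ℕ) :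
    ∃ S : StateGenScheme, S.IsFingerprintScheme f K D c := by
  obtain ⟨A, hA, hA₁, hA₂⟩ := exists_qalg
    (g := fun x => (List.range (keyLen K x.1.length)).map Gate.H) (h := fun x => x.2.2)
    (by fun_prop) (by fun_prop)
  obtain ⟨V, hV, hV₁, hV₂⟩ := exists_qalg
    (g := fun x => (fingerprint D c x.1.length (f x.1)).reverse)
    (h := fun x => if 3 * idxBits D c x.1.length + 2 = x.2.1 then
      (if ∀ i < x.2.2.length, x.2.2.getD i false = false then [true] else []) else [])
    (by fun_prop) (by fun_prop)
  have hG : FP fun k : List Bool =>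
      (encGates (fingerprint D c k.length (f k)), 3 * idxBits D c k.length + 2) := by fun_prop
  obtain ⟨p, τ, ⟨P, hP⟩, hp⟩ := hG.exists_prog
  have hp₁ : ∀ k, p.output [k] 0 = encGates (fingerprint D c k.length (f k)) := by
    intro k
    obtain ⟨t, _, h⟩ := hp k
    exact p.output_eq h 0
  have hp₂ : ∀ k, p.output [k] 1 = unary (3 * idxBits D c k.length + 2) := by
    intro k
    obtain ⟨t, _, h⟩ := hp k
    exact p.output_eq h 1
  refine ⟨⟨A, ⟨p⟩, V⟩, hA, ⟨P, fun k => ?_⟩, hV, fun n g => ?_, fun k => ?_, fun k => ?_, fun k q => ?_,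
    fun k q z => ?_⟩
  · obtain ⟨t, ht, h⟩ := hp k
    exact ⟨t, ht.trans (hP k), _, h⟩
  · have hu : (unary n).length = n := by simp [unary]
    have hc : A.circuit [unary n] 0 = (List.range (keyLen K n)).map Gate.H := by
      rw [hA₁, hu]
    have hw : A.wires [unary n] 0 = keyLen K n := by
      rw [QAlg.wires, hc, circuitWidth_hadamards]
      omega
    rw [noQubits_eq, expect_pureState A _ (supp_zeroAmp 0), hc, hw, meas_hadamards]
    congr 1
    refine Finset.sum_congr rfl fun x _ => ?_
    rw [ofFn_eq_map_range]
    exact congrArg g (hA₂ (unary n) 0 _)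
  · change (p.output [k] 1).length = _
    rw [hp₂]
    simp [unary]
  · change decodeCircuit (p.output [k] 0) = _
    rw [hp₁, decodeCircuit_encGates]
  · exact hV₁ k q
  · exact hV₂ k q z

/-! ### Purity, output length and acceptance probability of the scheme -/

namespace StateGenScheme.IsFingerprintScheme

variable {S : StateGenScheme} {f : List Bool → List Bool} {K D c : ℕ}

theorem state_eq (hS : S.IsFingerprintScheme f K D c) (k : List Bool) :
    S.state k = pureState (S.stateGen.numQubits k)
      (runAmp (fingerprint D c k.length (f k)) zeroAmp) := by
  have h := state_eq_pureState (G := S.stateGen) (k := k)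
    (by rw [hS.circuit_eq, hS.numQubits_eq]; exact circuitWidth_prep _ _ _)
  rw [hS.circuit_eq] at h
  exact h

theorem length_of_inSupport (hS : S.IsFingerprintScheme f K D c) {n : ℕ} {k : List Bool}
    (h : S.InSupport n k) : k.length = keyLen K n := by
  by_contra hne
  have h₀ : S.keyGen.probOut [unary n] noQubits k = 0 := by
    rw [QAlg.probOut, hS.keyGen_expect, Finset.sum_eq_zero, zero_div]
    intro x _
    rw [if_neg]
    rintro rfl
    exact hne (by simp)
  exact absurd h (by rw [InSupport, h₀]; exact lt_irrefl _)

theorem hasPureOutputs (hS : S.IsFingerprintScheme f K D c) : S.HasPureOutputs := by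
  intro n k _
  refine ⟨restr _ (runAmp (fingerprint D c k.length (f k)) zeroAmp), ?_, hS.state_eq k⟩
  have hw : circuitWidth (fingerprint D c k.length (f k)) ≤ S.stateGen.numQubits k := by
    rw [hS.numQubits_eq]
    exact circuitWidth_prep _ _ _
  exact (norm_runAmp _ hw _).trans (norm_zeroAmp _)

theorem hasOutputLength (hS : S.IsFingerprintScheme f K D c) :
    S.HasOutputLength fun n => 3 * idxBits D c (keyLen K n) + 2 := by
  intro n k hk
  rw [hS.numQubits_eq, hS.length_of_inSupport hk]

/-- Only the all-zero outcome is accepted, so `overlap_prep` gives the probability. Keys with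
different numbers of index bits are rejected by comparing the number of qubits. -/
theorem acceptProb_eq (hS : S.IsFingerprintScheme f K D c) (k' k : List Bool) :
    S.acceptProb k' k = if idxBits D c k'.length = idxBits D c k.length then
      ((((Finset.range (2 ^ idxBits D c k.length)).filter fun x =>
        rsEval (primeAbove (2 ^ idxBits D c k.length)) x (f k) =
        rsEval (primeAbove (2 ^ idxBits D c k.length)) x (f k')).card : ℝ) /
          2 ^ idxBits D c k.length) ^ 2 else 0 := by
  have hsupp : Supp (S.stateGen.numQubits k)
      (runAmp (fingerprint D c k.length (f k)) zeroAmp) :=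
    (supp_zeroAmp _).runAmp (by rw [hS.numQubits_eq]; exact circuitWidth_prep _ _ _)
  rw [acceptProb, QAlg.probOut, hS.state_eq, expect_pureState _ _ hsupp]
  simp only [List.singleton_append, hS.ver_output, hS.ver_circuit, hS.numQubits_eq]
  by_cases h : idxBits D c k'.length = idxBits D c k.length
  · rw [if_pos h]
    simp only [if_pos (show 3 * idxBits D c k'.length + 2 = 3 * idxBits D c k.length + 2 by rw [h])]
    have hw : S.ver.wires [k'] (3 * idxBits D c k.length + 2) = 3 * idxBits D c k.length + 2 := by
      have := circuitWidth_prep (idxBits D c k'.length) (2 ^ idxBits D c k'.length)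
        fun i => rsEval (primeAbove (2 ^ idxBits D c k'.length)) i (f k')
      rw [QAlg.wires, hS.ver_circuit, circuitWidth_reverse, fingerprint]
      omega
    rw [hw, meas, Finset.sum_eq_single fun _ => false]
    · have h₀ : ext (N := 3 * idxBits D c k.length + 2) (fun _ => false) = fun _ => false := by
        funext i
        simp [ext]
      have hov := overlap_prep (idxBits D c k.length)
        (fun i => rsEval (primeAbove (2 ^ idxBits D c k.length)) i (f k))
        (fun i => rsEval (primeAbove (2 ^ idxBits D c k.length)) i (f k'))
        (fun i _ => fingerprint_value_lt _ _ _ _ i) (fun i _ => fingerprint_value_lt _ _ _ _ i)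
      rw [runAmp_append] at hov
      rw [h₀, fingerprint, fingerprint, h, hov]
      simp [List.getD_eq_getElem?_getD]
    · intro z _ hz
      have : ∃ i, z i = true := by
        by_contra hcon
        push Not at hcon
        exact hz (funext fun i => by simpa using hcon i)
      obtain ⟨i, hi⟩ := this
      rw [if_neg, mul_zero]
      rw [if_neg]
      · simp
      · intro hall
        have := hall i (by simp)
        rw [List.getD_eq_getElem _ _ (by simp), List.getElem_map, List.getElem_range,
          ext_of_lt _ i.2, hi] at this
        exact absurd this (by simp)
    · simp
  · simp only [if_neg h, if_neg (show ¬3 * idxBits D c k'.length + 2 =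
      3 * idxBits D c k.length + 2 by omega)]
    simp [meas]

theorem correctProb_eq (hS : S.IsFingerprintScheme f K D c) (n : ℕ) : S.correctProb n = 1 := by
  have h : ∀ k, S.acceptProb k k = 1 := by
    intro k
    rw [hS.acceptProb_eq]
    simp
  rw [correctProb, hS.keyGen_expect]
  simp only [h]
  simp

theorem acceptProb_le (hS : S.IsFingerprintScheme f K D c) {δ : ℝ} (hδ₀ : 0 ≤ δ) (hδ₁ : δ ≤ 1)
    (hδ : ∀ x : List Bool, ((f x).length : ℝ) ≤ δ * 2 ^ idxBits D c x.length) (k' k : List Bool) :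
    S.acceptProb k' k ≤ (open Classical in if f k' = f k then 1 else 0) + δ := by
  classical
  rw [hS.acceptProb_eq]
  set N := 2 ^ idxBits D c k.length with hN
  have hNpos : (0 : ℝ) < 2 ^ idxBits D c k.length := by positivity
  by_cases hff : f k' = f k
  · rw [if_pos hff]
    split_ifs
    · have hle : (((Finset.range N).filter fun x => rsEval (primeAbove N) x (f k) =
          rsEval (primeAbove N) x (f k')).card : ℝ) / 2 ^ idxBits D c k.length ≤ 1 := by
        rw [div_le_one hNpos]
        have := Finset.card_filter_le (Finset.range N) fun x => rsEval (primeAbove N) x (f k) =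
          rsEval (primeAbove N) x (f k')
        rw [Finset.card_range] at this
        have h₂ : ((N : ℕ) : ℝ) = 2 ^ idxBits D c k.length := by rw [hN]; push_cast; rfl
        rw [← h₂]
        exact_mod_cast this
      have := pow_le_one₀ (n := 2) (by positivity) hle
      linarith
    · linarith
  · rw [if_neg hff, zero_add]
    split_ifs with hidx
    · obtain ⟨hp, hlt, -⟩ := primeAbove_spec (N := N) (by positivity)
      -- The two values of `f` may have different lengths. Both are short compared with the same
      -- number of points, since `hidx` equates the numbers of index bits.
      have hag := rs_agreement hp hlt.le (fun e => hff e.symm)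
        (le_max_left (f k).length (f k').length) (le_max_right _ _)
      have hle : (((Finset.range N).filter fun x => rsEval (primeAbove N) x (f k) =
          rsEval (primeAbove N) x (f k')).card : ℝ) / 2 ^ idxBits D c k.length ≤ δ := by
        rw [div_le_iff₀ hNpos]
        refine le_trans (Nat.cast_le.2 hag) ?_
        rw [Nat.cast_max]
        refine max_le (hδ k) ?_
        rw [← hidx]
        exact hδ k'
      calc _ ≤ δ ^ 2 := pow_le_pow_left₀ (by positivity) hle 2
        _ ≤ δ := by nlinarith
    · exact hδ₀

end StateGenScheme.IsFingerprintScheme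

end QCrypto

namespace QCrypto
open Enc (enc size)

/-! ## Circuits on disjoint blocks of wires -/

/-- The circuits `block i` for `i < M` on consecutive blocks of `w i` wires. -/
def layout (block : ℕ → List Gate) (w : ℕ → ℕ) (M : ℕ) : List Gate :=
  (List.range M).flatMap fun i => (block i).map (Gate.shift (∑ j ∈ Finset.range i, w j))

theorem layout_succ (block : ℕ → List Gate) (w : ℕ → ℕ) (M : ℕ) : layout block w (M + 1) =
    layout block w M ++ (block M).map (Gate.shift (∑ j ∈ Finset.range M, w j)) := by
  simp [layout, List.range_succ]

theorem Gate.width_shift (o : ℕ) (g : Gate) : (g.shift o).width = g.width + o := by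
  cases g <;> simp [Gate.shift, Gate.width] <;> omega

theorem circuitWidth_shift_le (o : ℕ) {C : List Gate} {N : ℕ} (h : circuitWidth C ≤ N) :
    circuitWidth (C.map (Gate.shift o)) ≤ o + N := by
  rw [circuitWidth_le_iff] at h ⊢
  intro g hg
  obtain ⟨g', hg', rfl⟩ := List.mem_map.1 hg
  have := h g' hg'
  rw [Gate.width_shift]
  omega

section layout

variable {block : ℕ → List Gate} {w : ℕ → ℕ}

theorem circuitWidth_layout_le (h : ∀ i, circuitWidth (block i) ≤ w i) (M : ℕ) :
    circuitWidth (layout block w M) ≤ ∑ j ∈ Finset.range M, w j := by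
  induction M with
  | zero => simp [layout, circuitWidth]
  | succ M ih =>
    rw [layout_succ, circuitWidth_append, Finset.sum_range_succ]
    exact max_le (ih.trans (Nat.le_add_right _ _)) (circuitWidth_shift_le _ (h M))

/-- The widths `w i` may exceed what a block needs; only disjointness matters for the product form.
-/
theorem runAmp_layout_succ (h : ∀ i, circuitWidth (block i) ≤ w i) (M : ℕ) :
    runAmp (layout block w (M + 1)) zeroAmp = tens (∑ j ∈ Finset.range M, w j)
      (runAmp (layout block w M) zeroAmp) (runAmp (block M) zeroAmp) := by
  rw [layout_succ, runAmp_append_shift _ _ (circuitWidth_layout_le h M)]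

/-- The measurement outcome of one block. -/
theorem meas_layout (h : ∀ i, circuitWidth (block i) ≤ w i) {i M : ℕ} (hi : i < M) {G : Cfg → ℝ}
    (hG : ∀ s, G (cut (w i) s) = G s) :
    (meas (∑ j ∈ Finset.range M, w j) (runAmp (layout block w M) zeroAmp) fun s =>
      G (skip (∑ j ∈ Finset.range i, w j) s)) = meas (w i) (runAmp (block i) zeroAmp) G := by
  induction M with
  | zero => omega
  | succ M ih =>
    rw [runAmp_layout_succ h, Finset.sum_range_succ]
    rcases Nat.lt_succ_iff_lt_or_eq.1 hi with hlt | rfl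
    · rw [← ih hlt]
      have hle : ∑ j ∈ Finset.range i, w j + w i ≤ ∑ j ∈ Finset.range M, w j := by
        rw [← Finset.sum_range_succ]
        exact Finset.sum_le_sum_of_subset (Finset.range_mono hlt)
      have := meas_tens (∑ j ∈ Finset.range M, w j) (w M) (runAmp (layout block w M) zeroAmp)
        (runAmp (block M) zeroAmp) (fun s => G (skip (∑ j ∈ Finset.range i, w j) s)) fun _ => 1
      -- The last block is independent of block `i`, and its total probability is one.
      rw [meas_one (h M), mul_one] at this
      rw [← this]
      congr 1
      funext s
      rw [mul_one, ← hG (skip _ s), ← hG (skip _ (cut _ s))]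
      congr 1
      funext j
      simp only [cut, skip]
      split_ifs <;> first | rfl | omega
    · have := meas_tens (∑ j ∈ Finset.range i, w j) (w i) (runAmp (layout block w i) zeroAmp)
        (runAmp (block i) zeroAmp) (fun _ => 1) G
      rw [meas_one (circuitWidth_layout_le h i), one_mul] at this
      simp only [one_mul] at this
      exact this

end layout

theorem cut_ext {N : ℕ} (z : Basis N) : cut N (ext z) = ext z := by
  funext i
  unfold cut
  split_ifs with h
  · rfl
  · exact (ext_of_le z (by omega)).symm

theorem runAmp_copies {C : List Gate} {m : ℕ} (h : circuitWidth C ≤ m) (t : ℕ) (s : Cfg) :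
    runAmp (layout (fun _ => C) (fun _ => m) t) zeroAmp (cut (t * m) s) =
      ∏ i ∈ Finset.range t, runAmp C zeroAmp (cut m (skip (i * m) s)) := by
  induction t with
  | zero =>
    simp only [layout, List.range_zero, List.flatMap_nil, runAmp_nil, Finset.range_zero,
      Finset.prod_empty]
    exact zeroAmp_of_forall fun i => if_neg (by omega)
  | succ t ih =>
    rw [runAmp_layout_succ fun _ => h, Finset.prod_range_succ, ← ih, tens]
    simp only [Finset.sum_const, Finset.card_range, smul_eq_mul]
    congr 2
    · funext i
      simp only [cut, add_mul]
      split_ifs <;> first | rfl | omega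
    · funext i
      simp only [cut, skip, add_mul]
      split_ifs <;> first | rfl | omega

/-- `finProdFinEquiv` places copy `i` on the consecutive wires from `i * m` on, so copies of the
state come from copies of the circuit. The inverter can thus prepare the adversary's input itself.
-/
theorem tensorPow_pureState {C : List Gate} {m : ℕ} (h : circuitWidth C ≤ m) (t : ℕ) :
    tensorPow (pureState m (runAmp C zeroAmp)) t =
      pureState (t * m) (runAmp (layout (fun _ => C) (fun _ => m) t) zeroAmp) := by
  have key : ∀ z : Basis (t * m), runAmp (layout (fun _ => C) (fun _ => m) t) zeroAmp (ext z) =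
      ∏ i : Fin t, runAmp C zeroAmp (ext fun j => z (finProdFinEquiv (i, j))) := by
    intro z
    rw [← cut_ext z, runAmp_copies h, Finset.prod_range]
    refine Finset.prod_congr rfl fun i _ => congrArg _ (funext fun j => ?_)
    unfold cut skip
    by_cases hj : j < m
    · have hlt : j + i * m < t * m := by
        have := Nat.mul_le_mul_right m i.2
        rw [Nat.succ_mul] at this
        omega
      rw [if_pos hj, ext_of_lt _ hj, ext_of_lt _ hlt]
      congr 1
      refine Fin.ext ?_
      simp [finProdFinEquiv, mul_comm]
    · rw [if_neg hj, ext_of_le _ (by omega)]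
  funext z z'
  rw [pureState_apply, key, key]
  simp only [tensorPow, Matrix.of_apply, pureState_apply, Finset.prod_mul_distrib, star_prod]

theorem expect_tensorPow (A : QAlg) (xs : List (List Bool)) {C : List Gate} {m : ℕ}
    (h : circuitWidth C ≤ m) (t : ℕ) (g : List Bool → ℝ) :
    A.expect xs (tensorPow (pureState m (runAmp C zeroAmp)) t) g =
      meas (A.wires xs (t * m))
        (runAmp (layout (fun _ => C) (fun _ => m) t ++ A.circuit xs (t * m)) zeroAmp) fun s =>
        g (A.post.output (xs ++ [unary (t * m), (List.range (A.wires xs (t * m))).map s]) 0) := by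
  have hw := circuitWidth_layout_le (block := fun _ => C) (w := fun _ => m) (fun _ => h) t
  simp only [Finset.sum_const, Finset.card_range, smul_eq_mul] at hw
  rw [tensorPow_pureState h, expect_pureState _ _ ((supp_zeroAmp _).runAmp hw), runAmp_append]

theorem meas_mono_of_supp {N : ℕ} {ψ : Amp} {G G' : Cfg → ℝ}
    (hG : ∀ s, (∀ i, N ≤ i → s i = false) → G s ≤ G' s) : meas N ψ G ≤ meas N ψ G' :=
  Finset.sum_le_sum fun _ _ => mul_le_mul_of_nonneg_left (hG _ fun _ => ext_of_le _) (by positivity)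

end QCrypto

namespace QCrypto
open Enc (enc size)

/-! ## Computations with a larger time bound -/

/-- Bit strings `x` whose size is `|x| + μ x`. -/
def Blow (_μ : List Bool → ℕ) : Type := List Bool

/-- The underlying bit string. -/
def Blow.val {μ : List Bool → ℕ} (x : Blow μ) : List Bool := x

instance (μ : List Bool → ℕ) : Enc (Blow μ) where
  width := 1
  enc x := [x.val]
  length_enc _ := rfl
  size x := x.val.length + μ x.val
  totalLength_le x := (Enc.totalLength_le x.val).trans (Nat.le_add_right _ _)

theorem size_blow {μ : List Bool → ℕ} (x : Blow μ) : size x = x.val.length + μ x.val := rfl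

/-- The largest `r` with `r ^ K ≤ n`. -/
def root (K n : ℕ) : ℕ := natLoop n 0 fun i r => if (i + 1) ^ K ≤ n then i + 1 else r

theorem root_pow_le {K : ℕ} (hK : K ≠ 0) (n : ℕ) : root K n ^ K ≤ n := by
  have h : ∀ m, (natLoop m 0 fun i r => if (i + 1) ^ K ≤ n then i + 1 else r) ^ K ≤ n := by
    intro m
    induction m with
    | zero => simp [hK]
    | succ m ih =>
      rw [natLoop_succ]
      split_ifs with h
      · exact h
      · exact ih
  exact h n

/-- Recovers the bit length of the security parameter from the key length. -/
theorem root_pow {K : ℕ} (hK : K ≠ 0) (s : ℕ) : root K (s ^ K) = s := by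
  have h : ∀ m, (natLoop m 0 fun i r => if (i + 1) ^ K ≤ s ^ K then i + 1 else r) = min m s := by
    intro m
    induction m with
    | zero => simp
    | succ m ih =>
      rw [natLoop_succ, ih]
      simp only [Nat.pow_le_pow_iff_left hK]
      split_ifs <;> omega
  rw [root, h]
  exact min_eq_right (Nat.le_self_pow hK s)

namespace FP

variable {α : Type} [Enc α]

@[fun_prop] theorem blow_val {μ : List Bool → ℕ} {x : α → Blow μ} (hx : FP x) :
    FP fun a => (x a).val :=
  (of_enc_eq (fun _ => rfl) (PolyBd.self.mono fun x => by simp [size_blow]) :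
    FP (Blow.val : Blow μ → List Bool)).comp hx

theorem natLoop_le (n K m : ℕ) :
    (QCrypto.natLoop m 0 fun i r => if (i + 1) ^ K ≤ n then i + 1 else r) ≤ m := by
  induction m with
  | zero => simp
  | succ m ih =>
    rw [natLoop_succ]
    split_ifs <;> omega

@[fun_prop] theorem root {n : α → ℕ} (hn : FP n) (K : ℕ) : FP fun a => root K (n a) :=
  natLoop (step := fun a i r => if (i + 1) ^ K ≤ n a then i + 1 else r) hn (.const 0)
    (by fun_prop) hn.size_bd fun a i hi => (natLoop_le (n a) K i).trans hi

theorem two_pow {n : α → ℕ} (hn : FP n) {B : α → ℕ} (hB : PolyBd size B)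
    (h : ∀ a, 2 ^ n a ≤ B a) : FP fun a => 2 ^ n a := by
  have e : ∀ i, QCrypto.natLoop i 1 (fun _ r => r + r) = 2 ^ i := by
    intro i
    induction i with
    | zero => rfl
    | succ i ih => rw [natLoop_succ, ih, pow_succ, mul_two]
  have h' : FP fun a => QCrypto.natLoop (n a) 1 fun _ r => r + r :=
    natLoop (step := fun _ _ r => r + r) hn (.const 1) (by fun_prop) hB fun a i hi => by
      rw [e, size_nat]
      exact (Nat.pow_le_pow_right two_pos hi).trans (h a)
  exact h'.of_eq fun a => e _

theorem layout {M : α → ℕ} {block : α → ℕ → List Gate} {w : α → ℕ → ℕ} (hM : FP M)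
    (hb : FP fun x : α × ℕ => block x.1 x.2) (hw : FP fun x : α × ℕ => w x.1 x.2) :
    FP fun a => layout (block a) (w a) (M a) := by
  have h : FP fun y : (α × ℕ) × ℕ => w y.1.1 y.2 :=
    hw.comp (f := fun y : (α × ℕ) × ℕ => (y.1.1, y.2)) (by fun_prop)
  unfold QCrypto.layout
  fun_prop

end FP

/-- Counting `μ x` as part of the input size turns superpolynomial running times into polynomial
ones, so all closure properties of `FP` remain available for the inverter. -/
theorem exists_qalg_two {μ : List Bool → ℕ} {g : Blow μ × List Bool × ℕ → List Gate}
    {h : Blow μ × List Bool × ℕ × List Bool → List Bool} (hg : FP g) (hh : FP h) :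
    ∃ A : QAlg, (∃ P : Polynomial ℕ, ∀ x y q,
        A.HaltsWithin [x, y] q (P.eval (x.length + μ x + (y.length + q)))) ∧
      (∀ (x : List Bool) y q, A.circuit [x, y] q = g (x, y, q)) ∧
      ∀ (x : List Bool) y q z, A.post.output [x, y, unary q, z] 0 = h (x, y, q, z) := by
  obtain ⟨p, τ, hτ, hp, hp'⟩ := FP.exists_output (f := fun a => encGates (g a)) (by fun_prop)
  obtain ⟨r, σ, ⟨P, hP⟩, hr, hr'⟩ := hh.exists_output
  have hc : ∀ (x : List Bool) y q, (⟨p, r⟩ : QAlg).circuit [x, y] q = g (x, y, q) := by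
    intro x y q
    exact (congrArg decodeCircuit (hp' (x, y, q))).trans (decodeCircuit_encGates _)
  refine ⟨⟨p, r⟩, ?_, hc, fun x y q z => hr' (x, y, q, z)⟩
  obtain ⟨Q, hQ⟩ := hτ.add ((PolyBd.self.add hg.size_bd).add PolyBd.self |>.polyEval P)
  refine ⟨Q, fun x y q => ?_⟩
  obtain ⟨t, ht, hhalt⟩ := hp (x, y, q)
  refine ⟨t, hhalt, fun z => ?_⟩
  obtain ⟨t', ht', hhalt'⟩ := hr (x, y, q, List.ofFn z)
  refine ⟨t', hhalt', le_trans (add_le_add ht (ht'.trans ((hP _).trans (polynomial_eval_mono P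
    ?_)))) (hQ (x, y, q))⟩
  have hw := wires_le (A := ⟨p, r⟩) (xs := [x, y]) (q := q) (C := g (x, y, q)) (hp' (x, y, q))
  have hl : (List.ofFn z).length = QAlg.wires ⟨p, r⟩ [x, y] q := by simp
  simp only [size_prod, size_nat, size_gates, size_list, hl]
  omega

/-! ## The reduction -/

section

variable {α : Type} [Enc α] {A : QAlg}

theorem FP.qalg_gen (hA : A.IsQPT 1) {x : α → List Bool} {q : α → ℕ} (hx : FP x) (hq : FP q) :
    FP fun a => A.gen.output [x a, QCrypto.unary (q a)] 0 := by
  obtain ⟨P, hP⟩ := hA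
  refine FP.run A.gen 0 (f := fun a => (x a, q a)) (by fun_prop)
    ((hx.size_bd.add hq.size_bd).polyEval P) fun a => ?_
  obtain ⟨t₁, h₁, h₂⟩ := hP [x a] rfl (q a)
  obtain ⟨t₂, -, h₃⟩ := h₂ fun _ => false
  refine ⟨t₁, le_trans (Nat.le_of_add_right_le h₃) (le_of_eq ?_), h₁⟩
  simp

theorem FP.qalg_circuit (hA : A.IsQPT 1) {x : α → List Bool} {q : α → ℕ} (hx : FP x)
    (hq : FP q) : FP fun a => A.circuit [x a] (q a) := by
  have h := FP.qalg_gen hA hx hq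
  unfold QAlg.circuit
  simp only [List.singleton_append]
  fun_prop

theorem FP.qalg_wires (hA : A.IsQPT 1) {x : α → List Bool} {q : α → ℕ} (hx : FP x)
    (hq : FP q) : FP fun a => A.wires [x a] (q a) := by
  have h := FP.qalg_circuit hA hx hq
  unfold QAlg.wires
  fun_prop

/-- The time bound of a quantum algorithm holds for every measurement outcome, so its postprocessing
can be called on any string of the right length. -/
theorem FP.qalg_post (hA : A.IsQPT 1) {x : α → List Bool} {q : α → ℕ} {s : α → Cfg}
    (hx : FP x) (hq : FP q) (hs : FP fun b : α × ℕ => s b.1 b.2) :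
    FP fun a => A.post.output
      [x a, QCrypto.unary (q a), (List.range (A.wires [x a] (q a))).map (s a)] 0 := by
  have hw := FP.qalg_wires hA hx hq
  obtain ⟨P, hP⟩ := hA
  refine FP.run A.post 0
    (f := fun a => (x a, q a, (List.range (A.wires [x a] (q a))).map (s a))) (by fun_prop)
    ((hx.size_bd.add hq.size_bd).polyEval P) fun a => ?_
  obtain ⟨t₁, h₁, h₂⟩ := hP [x a] rfl (q a)
  obtain ⟨t₂, h₃, h₄⟩ := h₂ fun i => s a i
  refine ⟨t₂, le_trans (Nat.le_of_add_left_le h₄) (le_of_eq (by simp)), ?_⟩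
  have e : List.ofFn (fun i : Fin (A.wires [x a] (q a)) => s a i) =
      (List.range (A.wires [x a] (q a))).map (s a) :=
    List.ext_getElem (by simp) fun i h₁ h₂ => by simp
  rw [e] at h₃
  exact h₃

end

/-- Parameters of the reduction: the function, the adversary against the state generator, the
number of copies it gets, and the parameters of the fingerprints. -/
structure Attack where
  f : List Bool → List Bool
  A : QAlg
  t : Polynomial ℕ
  D : ℕ
  c : ℕ

namespace Attack

variable (R : Attack)

/-- Number of qubits of the state for keys of length `n`. -/
def qubits (n : ℕ) : ℕ := 3 * idxBits R.D R.c n + 2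

/-- Number of input qubits of the adversary for security parameter `i`. -/
def inputs (n i : ℕ) : ℕ := R.t.eval i * R.qubits n

/-- The copies of the state, followed by the adversary for security parameter `i`. -/
noncomputable def block (n : ℕ) (y : List Bool) (i : ℕ) : List Gate :=
  layout (fun _ => fingerprint R.D R.c n y) (fun _ => R.qubits n) (R.t.eval i) ++
    R.A.circuit [unary i] (R.inputs n i)

/-- Number of wires of `block`. -/
noncomputable def wires (n i : ℕ) : ℕ := R.A.wires [unary i] (R.inputs n i)

/-- The first wire of the block for security parameter `i`. -/
noncomputable def offset (n i : ℕ) : ℕ := ∑ j ∈ Finset.range i, R.wires n j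

/-- The output of the adversary for security parameter `i`. -/
noncomputable def candidate (n i : ℕ) (s : Cfg) : List Bool :=
  R.A.post.output [unary i, unary (R.inputs n i), (List.range (R.wires n i)).map s] 0

/-- The last preimage of `y` among the candidates for security parameters less than `M`. -/
noncomputable def search (n : ℕ) (y z : List Bool) (M : ℕ) : List Bool :=
  natLoop M [] fun i r =>
    if R.f (R.candidate n i fun j => z.getD (j + R.offset n i) false) = y then
      R.candidate n i fun j => z.getD (j + R.offset n i) false
    else r

/-- Candidates can be tested by evaluating `f`, so one success among all security parameters
suffices and the right one need not be known. -/
theorem search_spec {n : ℕ} {y z : List Bool} {M i : ℕ} (hi : i < M)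
    (h : R.f (R.candidate n i fun j => z.getD (j + R.offset n i) false) = y) :
    R.f (R.search n y z M) = y := by
  induction M with
  | zero => omega
  | succ M ih =>
    rw [search, natLoop_succ]
    split_ifs with hM
    · exact hM
    · rcases Nat.lt_succ_iff_lt_or_eq.1 hi with hlt | rfl
      · exact ih hlt
      · exact absurd h hM

theorem circuitWidth_block_le (n : ℕ) (y : List Bool) (i : ℕ) :
    circuitWidth (R.block n y i) ≤ R.wires n i := by
  have h := circuitWidth_layout_le (block := fun _ => fingerprint R.D R.c n y)
    (w := fun _ => R.qubits n) (fun _ => circuitWidth_prep _ _ _) (R.t.eval i)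
  simp only [Finset.sum_const, Finset.card_range, smul_eq_mul] at h
  rw [block, circuitWidth_append, wires, QAlg.wires]
  unfold inputs at *
  omega

section

variable {R} {α : Type} [Enc α]

theorem fp_inputs {n i : α → ℕ} (hn : FP n) (hi : FP i) : FP fun a => R.inputs (n a) (i a) := by
  unfold inputs qubits
  fun_prop

theorem fp_wires (hA : R.A.IsQPT 1) {n i : α → ℕ} (hn : FP n) (hi : FP i) :
    FP fun a => R.wires (n a) (i a) :=
  FP.qalg_wires hA (by fun_prop) (fp_inputs hn hi)

theorem fp_offset (hA : R.A.IsQPT 1) {n i : α → ℕ} (hn : FP n) (hi : FP i) :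
    FP fun a => R.offset (n a) (i a) := by
  have h : FP fun b : α × ℕ => R.wires (n b.1) b.2 := fp_wires hA (by fun_prop) (by fun_prop)
  unfold offset
  fun_prop

theorem fp_block (hA : R.A.IsQPT 1) {n i : α → ℕ} {y : α → List Bool} (hn : FP n) (hy : FP y)
    (hi : FP i) : FP fun a => R.block (n a) (y a) (i a) := by
  have h₁ : FP fun a => R.A.circuit [unary (i a)] (R.inputs (n a) (i a)) :=
    FP.qalg_circuit hA (by fun_prop) (fp_inputs hn hi)
  have h₂ : FP fun a => layout (fun _ => fingerprint R.D R.c (n a) (y a))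
      (fun _ => R.qubits (n a)) (R.t.eval (i a)) := by
    refine FP.layout (by fun_prop) (by fun_prop) ?_
    unfold qubits
    fun_prop
  exact h₂.gates_append h₁

theorem fp_candidate (hA : R.A.IsQPT 1) {n i : α → ℕ} {z : α → List Bool} (hn : FP n)
    (hi : FP i) (hz : FP z) :
    FP fun a => R.candidate (n a) (i a) fun j => (z a).getD (j + R.offset (n a) (i a)) false := by
  have h : FP fun b : α × ℕ => R.offset (n b.1) (i b.1) :=
    fp_offset hA (by fun_prop) (by fun_prop)
  exact FP.qalg_post hA (s := fun a j => (z a).getD (j + R.offset (n a) (i a)) false)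
    (by fun_prop) (fp_inputs hn hi) (by fun_prop)

theorem fp_search (hf : FP R.f) (hA : R.A.IsQPT 1) {n M : α → ℕ} {y z : α → List Bool}
    (hn : FP n) (hM : FP M) (hy : FP y) (hz : FP z) :
    FP fun a => R.search (n a) (y a) (z a) (M a) := by
  have hc : FP fun b : α × ℕ => R.candidate (n b.1) b.2 fun j =>
      (z b.1).getD (j + R.offset (n b.1) b.2) false :=
    fp_candidate hA (by fun_prop) (by fun_prop) (by fun_prop)
  have hc' : FP fun b : α × ℕ × List Bool => R.candidate (n b.1) b.2.1 fun j =>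
      (z b.1).getD (j + R.offset (n b.1) b.2.1) false :=
    fp_candidate hA (by fun_prop) (by fun_prop) (by fun_prop)
  obtain ⟨P, hP⟩ := hc.size_bd
  refine FP.natLoop (step := fun a i r =>
    if R.f (R.candidate (n a) i fun j => (z a).getD (j + R.offset (n a) i) false) = y a then
      R.candidate (n a) i fun j => (z a).getD (j + R.offset (n a) i) false
    else r) hM (.const []) ?_ ((PolyBd.self.add hM.size_bd).polyEval P) ?_
  · have := hf.comp hc'
    fun_prop
  · intro a i hi
    induction i with
    | zero => simp
    | succ i ih =>
      rw [natLoop_succ]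
      split_ifs
      · refine (hP (a, i)).trans (polynomial_eval_mono P ?_)
        simp only [size_prod, size_nat]
        omega
      · exact ih (by omega)

/-- The inverter built from the adversary. -/
theorem exists_inverter (hf : FP R.f) (hA : R.A.IsQPT 1) (K : ℕ) :
    ∃ B : QAlg, (∃ P : Polynomial ℕ, ∀ n y,
        B.HaltsWithin [unary n, y] 0 (P.eval (n + 2 ^ root K n + y.length))) ∧
      (∀ n y, B.circuit [unary n, y] 0 =
        layout (R.block n y) (R.wires n) (2 ^ root K n)) ∧
      ∀ n y z, B.post.output [unary n, y, unary 0, z] 0 = R.search n y z (2 ^ root K n) := by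
  have hM : FP fun x : Blow (fun l => 2 ^ root K l.length) => 2 ^ root K x.val.length :=
    -- The size of `x` contains this very power of two, so it counts as polynomial.
    FP.two_pow (by fun_prop) PolyBd.self fun x => by rw [size_blow]; exact Nat.le_add_left _ _
  obtain ⟨B, ⟨P, hP⟩, hB₁, hB₂⟩ := exists_qalg_two (μ := fun l => 2 ^ root K l.length)
    (g := fun a => layout (R.block a.1.val.length a.2.1) (R.wires a.1.val.length)
      (2 ^ root K a.1.val.length))
    (h := fun a => R.search a.1.val.length a.2.1 a.2.2.2 (2 ^ root K a.1.val.length))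
    (FP.layout (hM.comp (by fun_prop)) (fp_block hA (by fun_prop) (by fun_prop) (by fun_prop))
      (fp_wires hA (by fun_prop) (by fun_prop)))
    (fp_search hf hA (by fun_prop) (hM.comp (by fun_prop)) (by fun_prop) (by fun_prop))
  have hu : ∀ n, (unary n).length = n := fun n => by simp [unary]
  refine ⟨B, ⟨P, fun n y => ?_⟩, fun n y => ?_, fun n y z => ?_⟩
  · have := hP (unary n) y 0
    rwa [hu, add_zero] at this
  · rw [hB₁]
    simp only [Blow.val, hu]
  · rw [hB₂]
    simp only [Blow.val, hu]

end

open Classical in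
/-- The inverter succeeds whenever the adversary does. -/
theorem expect_le {S : StateGenScheme} {K : ℕ} (hS : S.IsFingerprintScheme R.f K R.D R.c)
    {B : QAlg} {M : ℕ} {k : List Bool}
    (hB₁ : B.circuit [unary k.length, R.f k] 0 =
      layout (R.block k.length (R.f k)) (R.wires k.length) M)
    (hB₂ : ∀ z, B.post.output [unary k.length, R.f k, unary 0, z] 0 =
      R.search k.length (R.f k) z M) {i : ℕ} (hi : i < M) :
    (R.A.expect [unary i] (tensorPow (S.state k) (R.t.eval i))
      fun k' => if R.f k' = R.f k then 1 else 0) ≤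
    B.expect [unary k.length, R.f k] noQubits fun x => if R.f x = R.f k then 1 else 0 := by
  have hw : circuitWidth (fingerprint R.D R.c k.length (R.f k)) ≤ S.stateGen.numQubits k := by
    rw [hS.numQubits_eq]
    exact circuitWidth_prep _ _ _
  have hb := R.circuitWidth_block_le k.length (R.f k)
  have hq : S.stateGen.numQubits k = R.qubits k.length := hS.numQubits_eq k
  rw [hS.state_eq, expect_tensorPow _ _ hw, hq]
  change meas (R.wires k.length i) (runAmp (R.block k.length (R.f k) i) zeroAmp)
    (fun s => if R.f (R.candidate k.length i s) = R.f k then 1 else 0) ≤ _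
  have hcut : ∀ s s' : Cfg, (∀ j < R.wires k.length i, s j = s' j) →
      R.candidate k.length i s = R.candidate k.length i s' := by
    intro s s' h
    unfold candidate
    rw [List.map_congr_left fun j hj => h j (List.mem_range.1 hj)]
  -- Embeds the adversary for parameter `i` as one block of the joint circuit; its candidate depends
  -- only on the wires of this block.
  rw [← meas_layout hb hi (G := fun s => if R.f (R.candidate k.length i s) = R.f k then 1 else 0)
    fun s => by rw [hcut (cut _ s) s fun j hj => if_pos hj]]
  have hW : B.wires [unary k.length, R.f k] 0 =
      circuitWidth (layout (R.block k.length (R.f k)) (R.wires k.length) M) := by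
    rw [QAlg.wires, hB₁]
    omega
  have hle := circuitWidth_layout_le hb M
  rw [noQubits_eq, expect_pureState _ _ (supp_zeroAmp 0), hB₁, hW,
    meas_of_supp hle ((supp_zeroAmp _).runAmp le_rfl)]
  refine meas_mono_of_supp fun s hs => ?_
  simp only [List.cons_append, List.nil_append, hB₂]
  split_ifs with h₁ h₂
  · exact le_rfl
  · refine absurd (R.search_spec hi (Eq.trans (congrArg R.f ?_) h₁)) h₂
    refine hcut _ _ fun j _ => ?_
    change _ = s (j + R.offset k.length i)
    by_cases hj : j + R.offset k.length i <
        circuitWidth (layout (R.block k.length (R.f k)) (R.wires k.length) M)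
    · simp [List.getD_eq_getElem?_getD, hj]
    -- The measured string stops at the actual circuit width, which may cut off unused wires of a
    -- block. These are zero, in agreement with the default value `false`.
    · rw [hs _ (by omega), List.getD_eq_default _ _ (by simpa using hj)]
  · exact zero_le_one
  · exact le_rfl

end Attack

end QCrypto

namespace QCrypto
open Enc (enc size)
open Filter Topology

/-! ## Asymptotics -/

theorem exists_polynomial_eval_le (Q : Polynomial ℕ) :
    ∃ a d : ℕ, ∀ n : ℕ, Q.eval n ≤ a * (n + 1) ^ d := by
  induction Q using Polynomial.induction_on' with
  | add p q hp hq =>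
    obtain ⟨a, d, h⟩ := hp
    obtain ⟨a', d', h'⟩ := hq
    refine ⟨a + a', d + d', fun n => ?_⟩
    have h₁ : (n + 1) ^ d ≤ (n + 1) ^ (d + d') := Nat.pow_le_pow_right (by omega) (by omega)
    have h₂ : (n + 1) ^ d' ≤ (n + 1) ^ (d + d') := Nat.pow_le_pow_right (by omega) (by omega)
    rw [Polynomial.eval_add, add_mul]
    exact add_le_add ((h n).trans (Nat.mul_le_mul_left a h₁))
      ((h' n).trans (Nat.mul_le_mul_left a' h₂))
  | monomial k a =>
    refine ⟨a, k, fun n => ?_⟩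
    rw [Polynomial.eval_monomial]
    exact Nat.mul_le_mul_left a (Nat.pow_le_pow_left (by omega) k)

theorem PolyTimeComputable.fp {f : List Bool → List Bool} (h : PolyTimeComputable f) : FP f := by
  obtain ⟨p, P, hP⟩ := h
  exact (FP.run p 0 (f := fun x : List Bool => x) (T := fun x => P.eval x.length) (by fun_prop)
    (PolyBd.self.polyEval P) fun x => (hP x).1).of_eq fun x => (hP x).2

theorem tendsto_natSize : Tendsto Nat.size atTop atTop :=
  tendsto_atTop.2 fun b => eventually_atTop.2 ⟨2 ^ b, fun _ hn => (Nat.lt_size.2 hn).le⟩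

theorem tendsto_keyLen {K : ℕ} (hK : K ≠ 0) : Tendsto (keyLen K) atTop atTop :=
  tendsto_atTop_mono (fun n => Nat.le_self_pow hK n.size) tendsto_natSize

theorem natSize_le_log {n : ℕ} (hn : n ≠ 0) : (n.size : ℝ) ≤ 2 * Real.log n + 1 := by
  have hs : 0 < n.size := Nat.size_pos.2 (Nat.pos_of_ne_zero hn)
  have h : 2 ^ (n.size - 1) ≤ n := Nat.lt_size.1 (by omega)
  have h' : ((2 : ℝ)) ^ (n.size - 1) ≤ n := by exact_mod_cast h
  have h₂ := Real.log_le_log (by positivity) h'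
  rw [Real.log_pow, Nat.cast_sub (by omega), Nat.cast_one] at h₂
  have h₃ : (1 : ℝ) ≤ n.size := by exact_mod_cast hs
  nlinarith [Real.log_two_gt_d9]

/-- Bit lengths are logarithms up to constants: the key length is a power of `log n`, and the number
of qubits is linear in the bit length of the key length. -/
theorem outputLength_isBigO (K D c : ℕ) :
    (fun n : ℕ => ((3 * idxBits D c (keyLen K n) + 2 : ℕ) : ℝ)) =O[atTop]
      fun n : ℕ => Real.log (Real.log n) := by
  have hlog : Tendsto (fun n : ℕ => Real.log n) atTop atTop :=
    Real.tendsto_log_atTop.comp tendsto_natCast_atTop_atTop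
  have hll := Real.tendsto_log_atTop.comp hlog
  refine Asymptotics.IsBigO.of_bound (3 * (D * (2 * K * 3 + 1) + c) + 2) ?_
  filter_upwards [hlog.eventually_ge_atTop 1, hll.eventually_ge_atTop 1, eventually_gt_atTop 0]
    with n h₁ h₂ hn
  simp only [Function.comp_apply] at h₂
  have hs : 0 < n.size := Nat.size_pos.2 hn
  have hs' : (0 : ℝ) < n.size := by exact_mod_cast hs
  have h₃ := natSize_le_log hn.ne'
  have h₄ : Real.log n.size ≤ 3 * Real.log (Real.log n) := by
    have : (n.size : ℝ) ≤ 3 * Real.log n := by linarith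
    have h := Real.log_le_log hs' this
    rw [Real.log_mul (by norm_num) (by linarith)] at h
    have := Real.log_le_sub_one_of_pos (show (0 : ℝ) < 3 by norm_num)
    linarith
  have h₅ := natSize_le_log (n := n.size ^ K) (by positivity)
  rw [Nat.cast_pow, Real.log_pow] at h₅
  rw [Real.norm_of_nonneg (by positivity), Real.norm_of_nonneg (by linarith)]
  unfold idxBits keyLen
  push_cast
  have h₆ : ((n.size ^ K).size : ℝ) ≤ (2 * K * 3 + 1) * Real.log (Real.log n) := by
    have : (K : ℝ) * Real.log n.size ≤ K * (3 * Real.log (Real.log n)) :=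
      mul_le_mul_of_nonneg_left h₄ (by positivity)
    linarith
  have h₇ : (D : ℝ) * ((n.size ^ K).size : ℝ) ≤ D * ((2 * K * 3 + 1) * Real.log (Real.log n)) :=
    mul_le_mul_of_nonneg_left h₆ (by positivity)
  have h₈ : (c : ℝ) ≤ c * Real.log (Real.log n) := le_mul_of_one_le_right (by positivity) h₂
  linarith

theorem root_le_rpow {K : ℕ} (hK : K ≠ 0) {c : ℝ} (hc : 2 / c ≤ K) (hc₀ : 0 < c) {n : ℕ}
    (hn : n ≠ 0) : (root K n : ℝ) ≤ (n : ℝ) ^ (c / 2) := by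
  have hn' : (1 : ℝ) ≤ n := by exact_mod_cast Nat.one_le_iff_ne_zero.2 hn
  have hK' : (0 : ℝ) < K := by exact_mod_cast Nat.pos_of_ne_zero hK
  have h : ((root K n : ℝ)) ^ K ≤ n := by exact_mod_cast root_pow_le hK n
  calc (root K n : ℝ) = ((root K n : ℝ) ^ K) ^ ((K : ℝ)⁻¹) :=
        (Real.pow_rpow_inv_natCast (by positivity) hK).symm
    _ ≤ (n : ℝ) ^ ((K : ℝ)⁻¹) := Real.rpow_le_rpow (by positivity) h (by positivity)
    _ ≤ (n : ℝ) ^ (c / 2) := by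
        refine Real.rpow_le_rpow_of_exponent_le hn' ?_
        rw [inv_le_comm₀ hK' (by positivity), inv_div]
        exact hc

theorem tendsto_natCast_rpow {c : ℝ} (hc : 0 < c) :
    Tendsto (fun n : ℕ => (n : ℝ) ^ c) atTop atTop :=
  (tendsto_rpow_atTop hc).comp tendsto_natCast_atTop_atTop

theorem eventually_succ_le_two_rpow {c : ℝ} (hc : 0 < c) :
    ∀ᶠ n : ℕ in atTop, (n : ℝ) + 1 ≤ (2 : ℝ) ^ ((n : ℝ) ^ c) := by
  have h := tendsto_natCast_atTop_atTop.eventually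
    -- With `log n ≤ n^c / 4` and `1 ≤ n^c / 4` the exponent `1 + log n` is at most `n^c / 2`, which
    -- is below `n^c * log 2`.
    ((isLittleO_log_rpow_atTop hc).bound (show (0 : ℝ) < 1 / 4 by norm_num))
  filter_upwards [h, (tendsto_natCast_rpow hc).eventually_ge_atTop 4, eventually_ge_atTop 1]
    with n h₁ h₂ hn
  have hn' : (1 : ℝ) ≤ n := by exact_mod_cast hn
  rw [Real.norm_of_nonneg (Real.log_nonneg hn'), Real.norm_of_nonneg (by positivity)] at h₁
  have h₃ : (n : ℝ) + 1 ≤ Real.exp (1 + Real.log n) := by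
    rw [Real.exp_add, Real.exp_log (by linarith)]
    nlinarith [Real.add_one_le_exp 1]
  refine h₃.trans ?_
  rw [Real.rpow_def_of_pos two_pos]
  refine Real.exp_le_exp.2 ?_
  nlinarith [Real.log_two_gt_d9]

/-- Since `root K n ≤ n^(c/2)`, a fixed polynomial in `2 ^ root K n` is `2` to the power
`O(n^(c/2))`, and `n^c` is the square of `n^(c/2)`. Halving the exponent leaves room for any
polynomial. -/
theorem eventually_polynomial_le {K : ℕ} (hK : K ≠ 0) {c : ℝ} (hc : 2 / c ≤ K) (hc₀ : 0 < c)
    (P : Polynomial ℕ) :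
    ∀ᶠ n : ℕ in atTop, ((P.eval (n + 2 ^ root K n) : ℕ) : ℝ) ≤ (2 : ℝ) ^ ((n : ℝ) ^ c) := by
  obtain ⟨a, d, hP⟩ := exists_polynomial_eval_le P
  filter_upwards [eventually_succ_le_two_rpow (half_pos hc₀), eventually_gt_atTop 0,
    -- For `v ≥ a + 2 * d + 1` one has `a + (v + 1) * d ≤ (a + 2 * d) * v ≤ v * v`.
    (tendsto_natCast_rpow (half_pos hc₀)).eventually_ge_atTop (a + 2 * d + 1)] with n h₁ hn h₂
  have hr := root_le_rpow hK hc hc₀ hn.ne'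
  set v := (n : ℝ) ^ (c / 2) with hv
  have hv₁ : 1 ≤ v := by
    have : (0 : ℝ) ≤ a + 2 * d := by positivity
    linarith
  have hvv : (n : ℝ) ^ c = v * v := by
    rw [hv, ← Real.rpow_add (by exact_mod_cast hn), add_halves]
  have h₃ : (2 : ℝ) ^ root K n ≤ (2 : ℝ) ^ v := by
    rw [← Real.rpow_natCast]
    exact Real.rpow_le_rpow_of_exponent_le one_le_two hr
  have h₄ : (n : ℝ) + 2 ^ root K n + 1 ≤ (2 : ℝ) ^ (v + 1) := by
    rw [Real.rpow_add two_pos, Real.rpow_one]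
    linarith
  have h₅ : (a : ℝ) ≤ (2 : ℝ) ^ (a : ℝ) := by
    rw [Real.rpow_natCast]
    exact_mod_cast a.lt_two_pow_self.le
  calc ((P.eval (n + 2 ^ root K n) : ℕ) : ℝ)
      ≤ ((a * (n + 2 ^ root K n + 1) ^ d : ℕ) : ℝ) := Nat.cast_le.2 (hP _)
    _ = a * ((n : ℝ) + 2 ^ root K n + 1) ^ d := by push_cast; rfl
    _ ≤ (2 : ℝ) ^ (a : ℝ) * ((2 : ℝ) ^ (v + 1)) ^ d :=
        mul_le_mul h₅ (pow_le_pow_left₀ (by positivity) h₄ d) (by positivity) (by positivity)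
    _ = (2 : ℝ) ^ (a + (v + 1) * d) := by
        rw [← Real.rpow_natCast ((2 : ℝ) ^ (v + 1)), ← Real.rpow_mul two_pos.le,
          Real.rpow_add two_pos]
    _ ≤ (2 : ℝ) ^ ((n : ℝ) ^ c) := by
        refine Real.rpow_le_rpow_of_exponent_le one_le_two ?_
        rw [hvv]
        have ha : (0 : ℝ) ≤ a := by positivity
        have hd : (0 : ℝ) ≤ d := by positivity
        nlinarith [mul_le_mul_of_nonneg_left hv₁ ha, mul_le_mul_of_nonneg_left hv₁ hd]

theorem eventually_two_rpow_neg_le {c : ℝ} (hc : 0 < c) {ε : ℝ} (hε : 0 < ε) :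
    ∀ᶠ n : ℕ in atTop, (2 : ℝ) ^ (-(n : ℝ) ^ c) ≤ ε := by
  have h : Tendsto (fun n : ℕ => (2 : ℝ) ^ (-(n : ℝ) ^ c)) atTop (𝓝 0) :=
    (tendsto_rpow_atBot_of_base_gt_one 2 one_lt_two).comp
      (tendsto_neg_atTop_atBot.comp (tendsto_natCast_rpow hc))
  exact (h.eventually (gt_mem_nhds hε)).mono fun _ h => h.le

/-! ## Security -/

theorem meas_add_const {N : ℕ} {C : List Gate} (hC : circuitWidth C ≤ N) (G : Cfg → ℝ) (δ : ℝ) :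
    (meas N (runAmp C zeroAmp) fun s => G s + δ) = meas N (runAmp C zeroAmp) G + δ := by
  have h := meas_one hC
  simp only [meas, mul_one] at h
  simp only [meas, mul_add, Finset.sum_add_distrib, ← Finset.sum_mul]
  rw [h, one_mul]

theorem expect_tensorPow_le (A : QAlg) (xs : List (List Bool)) {C : List Gate} {m : ℕ}
    (h : circuitWidth C ≤ m) (t : ℕ) {g g' : List Bool → ℝ} {δ : ℝ} (hg : ∀ k, g k ≤ g' k + δ) :
    A.expect xs (tensorPow (pureState m (runAmp C zeroAmp)) t) g ≤
      A.expect xs (tensorPow (pureState m (runAmp C zeroAmp)) t) g' + δ := by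
  have hw := circuitWidth_layout_le (block := fun _ => C) (w := fun _ => m) (fun _ => h) t
  simp only [Finset.sum_const, Finset.card_range, smul_eq_mul] at hw
  rw [expect_tensorPow _ _ h, expect_tensorPow _ _ h, ← meas_add_const]
  · exact meas_mono fun s => hg _
  · rw [circuitWidth_append, QAlg.wires]
    omega

theorem runsInSubexpTime {f : List Bool → List Bool} (hf : FP f) {B : QAlg} {K : ℕ} (hK : K ≠ 0)
    {c : ℝ} (hc : 2 / c ≤ K) (hc₀ : 0 < c) {P : Polynomial ℕ}
    (hB : ∀ n y, B.HaltsWithin [unary n, y] 0 (P.eval (n + 2 ^ root K n + y.length))) :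
    RunsInSubexpTime f B c := by
  obtain ⟨Q, hQ⟩ := hf.size_bd
  filter_upwards [eventually_polynomial_le hK hc hc₀ (P.comp (Polynomial.X + Q))] with n hn x
  refine ⟨_, le_trans (Nat.cast_le.2 ?_) hn, hB n _⟩
  rw [Polynomial.eval_comp, Polynomial.eval_add, Polynomial.eval_X]
  -- The challenge has length polynomial in `n`, so the bound depends on `n` and `2 ^ root K n`
  -- only.
  refine polynomial_eval_mono P (Nat.add_le_add_left ((hQ (List.ofFn x)).trans ?_) _)
  simp only [size_list, List.length_ofFn]
  exact polynomial_eval_mono Q (Nat.le_add_right _ _)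

theorem StateGenScheme.IsFingerprintScheme.winProb_le {S : StateGenScheme} {R : Attack} {K : ℕ}
    (hS : S.IsFingerprintScheme R.f K R.D R.c) (hK : K ≠ 0) {δ : ℝ} (hδ₀ : 0 ≤ δ) (hδ₁ : δ ≤ 1)
    (hδ : ∀ x : List Bool, ((R.f x).length : ℝ) ≤ δ * 2 ^ idxBits R.D R.c x.length) {B : QAlg}
    (hB₁ : ∀ n y, B.circuit [unary n, y] 0 = layout (R.block n y) (R.wires n) (2 ^ root K n))
    (hB₂ : ∀ n y z, B.post.output [unary n, y, unary 0, z] 0 = R.search n y z (2 ^ root K n))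
    (i : ℕ) : S.winProb R.A (R.t.eval i) i ≤ invertProb R.f B (keyLen K i) + δ := by
  rw [StateGenScheme.winProb, hS.keyGen_expect, invertProb, ← sub_le_iff_le_add]
  have hpos : (0 : ℝ) < 2 ^ keyLen K i := by positivity
  rw [le_div_iff₀ hpos, sub_mul, div_mul_cancel₀ _ hpos.ne', sub_le_iff_le_add]
  have hcard : δ * 2 ^ keyLen K i = ∑ _x : Basis (keyLen K i), δ := by simp [mul_comm]
  rw [hcard, ← Finset.sum_add_distrib]
  refine Finset.sum_le_sum fun x _ => ?_
  have hlen : (List.ofFn x).length = keyLen K i := List.length_ofFn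
  -- The actual security parameter is among those that the inverter tries, because `i < 2 ^ i.size`
  -- and the root of the key length is `i.size`.
  have hi : i < 2 ^ root K (List.ofFn x).length := by
    rw [hlen, keyLen, root_pow hK]
    exact i.lt_size_self
  have hw : circuitWidth (fingerprint R.D R.c (List.ofFn x).length (R.f (List.ofFn x))) ≤
      S.stateGen.numQubits (List.ofFn x) := by
    rw [hS.numQubits_eq]
    exact circuitWidth_prep _ _ _
  have h := R.expect_le hS (hB₁ _ _) (hB₂ _ _) hi
  have h' := expect_tensorPow_le R.A [unary i] hw (R.t.eval i)
    fun k' => hS.acceptProb_le hδ₀ hδ₁ hδ k' (List.ofFn x)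
  rw [← hS.state_eq] at h'
  rw [hlen] at h
  exact h'.trans (add_le_add_left h δ)

end QCrypto

/-! ### Choice of the parameters -/

theorem mainTheorem6
    (hOWF : ∃ f : List Bool → List Bool, QCrypto.IsSubexpSecureOWF f) :
    ∀ ε : ℝ, 0 < ε →
      ∃ (S : QCrypto.StateGenScheme) (m : ℕ → ℕ),
        S.IsOWSG (fun _ => ε) ∧
        S.HasOutputLength m ∧
        S.HasPureOutputs ∧
        (fun n : ℕ => (m n : ℝ)) =O[Filter.atTop] (fun n : ℕ => Real.log (Real.log n)) := by
  obtain ⟨f, hpoly, c, hc₀, -, hsec⟩ := hOWF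
  intro ε hε
  have hf := hpoly.fp
  obtain ⟨Q, hQ⟩ := hf.size_bd
  obtain ⟨a, D, hD⟩ := QCrypto.exists_polynomial_eval_le Q
  -- Keys of length `(size n)^K` are long enough for the time `poly(n)` to be within `2^(m^c)`,
  -- where `m` is the key length.
  obtain ⟨K, hK⟩ := exists_nat_ge (2 / c)
  have hK₀ : K ≠ 0 := by
    rintro rfl
    have : 0 < 2 / c := by positivity
    exact absurd hK (by push_cast; linarith)
  -- Half of `ε` is spent on wrong keys that pass verification, the other half on inverting `f`.
  set δ := min 1 (ε / 2) with hδ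
  have hδ₀ : 0 < δ := by positivity
  -- The exponent `D` bounds the growth of the values of `f`; the constant `c₀` turns the factor `a`
  -- into the relative error `δ`.
  obtain ⟨c₀, hc₀'⟩ := pow_unbounded_of_one_lt (a / δ) (one_lt_two (α := ℝ))
  have hlen : ∀ x : List Bool,
      ((f x).length : ℝ) ≤ δ * 2 ^ QCrypto.idxBits D c₀ x.length := by
    intro x
    have h₁ : (f x).length ≤ a * (2 ^ x.length.size) ^ D :=
      ((hQ x).trans (hD _)).trans
        (Nat.mul_le_mul_left a (Nat.pow_le_pow_left x.length.lt_size_self D))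
    have h₂ : (a : ℝ) ≤ δ * 2 ^ c₀ := by
      rw [div_lt_iff₀ hδ₀] at hc₀'
      linarith
    calc ((f x).length : ℝ) ≤ ((a * (2 ^ x.length.size) ^ D : ℕ) : ℝ) := Nat.cast_le.2 h₁
      _ = a * ((2 : ℝ) ^ x.length.size) ^ D := by push_cast; rfl
      _ ≤ δ * 2 ^ c₀ * ((2 : ℝ) ^ x.length.size) ^ D :=
          mul_le_mul_of_nonneg_right h₂ (by positivity)
      _ = δ * 2 ^ QCrypto.idxBits D c₀ x.length := by
          have := congrArg (Nat.cast : ℕ → ℝ) (QCrypto.two_pow_idxBits D c₀ x.length)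
          push_cast at this
          rw [this]
          ring
  obtain ⟨S, hS⟩ := QCrypto.exists_fingerprintScheme hf K D c₀
  refine ⟨S, _, ⟨⟨hS.keyGen_qpt, hS.stateGen_qpt, hS.ver_qpt⟩, ⟨0,
    Asymptotics.superpolynomialDecay_zero _ _, fun n => ?_⟩, fun A hA t => ?_⟩,
    hS.hasOutputLength, hS.hasPureOutputs, QCrypto.outputLength_isBigO K D c₀⟩
  · rw [hS.correctProb_eq]
    simp
  · obtain ⟨B, ⟨P, hP⟩, hB₁, hB₂⟩ :=
      QCrypto.Attack.exists_inverter (R := ⟨f, A, t, D, c₀⟩) hf hA K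
    have hB := hsec B (QCrypto.runsInSubexpTime hf hK₀ hK hc₀ hP)
    -- The security of `f` holds for all large key lengths, hence for all large security parameters.
    filter_upwards [(QCrypto.tendsto_keyLen hK₀).eventually
      (hB.and (QCrypto.eventually_two_rpow_neg_le hc₀ (half_pos hε)))] with i hi
    have h := hS.winProb_le (R := ⟨f, A, t, D, c₀⟩) hK₀ hδ₀.le (min_le_left _ _) hlen hB₁ hB₂ i
    have hδε : δ ≤ ε / 2 := min_le_right _ _
    have := hi.1.trans hi.2
    exact h.trans (by linarith)
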